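/- **Powers.** For real $x$ and a positive rational $r=p/q$ in lowest terms, $x^{r}=\operatorname{sign}(x)|x|^{r}$ if $p$ is odd and $x^{r}=|x|^{r}$ if $p$ is even. **Plant.** $\dot x_i=h_i(\bar x_i)x_{i+1}+f_i(\bar x_i)$ $(1\le i\le n)$, with $x_{n+1}:=u$ and $\bar x_i=(x_1,\dots,x_i)$, where $h_i,f_i:\mathbb R^i\to\mathbb R$ are arbitrary $C^1$ functions with $h_i\neq0$ everywhere. The condition $f_i(0)=0$ is not required. **Design parameters.** $\alpha\in(\frac12,1)$ is a ratio of odd integers; $q_1=1$, $q_{i+1}=\alpha-1+q_i$, with $q_{n+1}>0$; $K_i,U_i,a,\zeta,\varsigma,\varepsilon>0$; $c_{ij}>0$ for $j<i$ and $j=i+1$; $Q_i>\sum_{j>i}c_{ji}+c_{i-1,i}$ (with $c_{0,1}:=0$); $\theta_i:\mathbb N\to\mathbb R$ is increasing with $\theta_i(0)>0$ and $\theta_i(k)\to\infty$. **Controller.** Given switching signals $\sigma_i\in\mathbb N$ and barriers $\hat\chi_i$, put $\hat\Theta_i=(-1)^{\sigma_i}\theta_i(\sigma_i)$, $s_1=x_1$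 and $$x_{i+1}^*=\hat\Theta_i\Big[-K_is_i^{q_{i+1}}-\frac{U_is_i^{q_{i+1}}}{(\hat\chi_i^2-s_i^2)^{1+2\alpha}}\Big]\ (1\le i\le n),\qquad s_{i+1}=x_{i+1}^{1/q_{i+1}}-(x_{i+1}^*)^{1/q_{i+1}}\ (1\le i<n),\qquad u=x_{n+1}^*.$$ Let $$V_1=\tfrac12\ln\frac{\hat\chi_1^2}{\hat\chi_1^2-s_1^2},\qquad V_i=\int_{x_i^*}^{x_i}\frac{\upsilon_i(\tau)^{2-q_i}}{\hat\chi_i^2-\upsilon_i(\tau)^2}\,d\tau\ (i\ge2),\qquad \upsilon_i(\tau)=\tau^{1/q_i}-(x_i^*)^{1/q_i}.$$ **Switching logic (Algorithm 3.1′).** The auxiliary variables satisfy, with $s_{n+1}:=0$, $$\dot\eta_i=-a\,\eta_i^{(1+\alpha)/2}-Q_is_i^{1+\alpha}+\sum_{j<i}c_{ij}s_j^{1+\alpha}+c_{i,i+1}s_{i+1}^{1+\alpha}+\zeta .$$ Initially $\sigma_i(0)=1$, $\hat\chi_i(0)>|s_i(0)|$ and $\eta_i(0)=V_i(0)+\varepsilon$.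 Between switching times $\sigma_i,\hat\chi_i$ are constant, $x$ and $\eta$ solve the differential equations, and $V_i\le\eta_i$ for all $i$. The next switching time $t_s$ is the infimum of the times at which some $V_i-\eta_i$ becomes positive when the parameters are kept. At $t_s$: (a) $\sigma_i$ is increased by $1$ for each $i$ whose supervisory function $V_i-\eta_i$ has reached $0$; (b) for $i=1,\dots,n$ in this order, $s_i$ is recomputed and, if $|s_i|\ge\hat\chi_i$, $\hat\chi_i$ is set to $|s_i|+\varsigma$; (c) $V_i$ is recomputed and, if $V_i\ge\eta_i$, $\eta_i$ is reset to $V_i+\varepsilon$. The state $x$ is continuous. **Claim.** For every initial state $x(0)\in\mathbb R^n$ and all such initial barriers, the closed loop has a solution on $[0,\infty)$, and every solution on a bounded interval $[0,T)$ extends to a solution on $[0,\infty)$. For every solution on $[0,\infty)$: 1. $|s_i|<\hat\chi_i$ for all times and all $i$, and all signals ($x_i$, $\eta_i$, $\hat\chi_i$, $\sigma_i$, $\hat\Theta_i$, $s_i$, $x_i^*$, $V_i$ and $u$) are bounded on $[0,\infty)$. 2. Practical finite-time stability: there is a finite $T_0\ge0$ such that for all $t\ge T_0$ and all $i$ $$|V_i|\le\Big(\frac{2n\zeta}{a}\Big)^{2/(1+\alpha)},\qquad\text{and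 moreover}\qquad |V_i|\le\frac{2n\zeta}{a}\quad\text{if}\quad \frac{n\zeta}{a}<2^{(1+\alpha)/(1-\alpha)}$$ (in particular whenever $n\zeta/a\le 8$). -/

import Mathlib

open Set Filter Topology

namespace SwitchingControl

/-- The power `x ^ r` of a real number with a positive rational exponent `r = p / q` in lowest
terms: it is `|x| ^ r` when `p` is even and `sign x * |x| ^ r` when `p` is odd. -/
noncomputable def qpow (x : ℝ) (r : ℚ) : ℝ :=
  if Even r.num then |x| ^ (r : ℝ) else Real.sign x * |x| ^ (r : ℝ)

/-- The plant functions: channel `i` (counted from `0`) has the gain `h i` and the nonlinearity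
`f i`, both functions of the first `i + 1` states. -/
structure Plant (n : ℕ) where
  h : (i : Fin n) → (Fin (i + 1) → ℝ) → ℝ
  f : (i : Fin n) → (Fin (i + 1) → ℝ) → ℝ

/-- The plant functions are continuously differentiable and the gains vanish nowhere. -/
structure Plant.Admissible {n : ℕ} (P : Plant n) : Prop where
  contDiff_h : ∀ i, ContDiff ℝ 1 (P.h i)
  contDiff_f : ∀ i, ContDiff ℝ 1 (P.f i)
  h_ne_zero : ∀ i z, P.h i z ≠ 0

/-- The design parameters of the controller and of the switching logic. -/
structure Design (n : ℕ) where
  α : ℚ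
  K : Fin n → ℝ
  U : Fin n → ℝ
  θ : Fin n → ℕ → ℝ
  a : ℝ
  ζ : ℝ
  Q : Fin n → ℝ
  c : Fin n → Fin n → ℝ
  /-- increment of a barrier -/
  ς : ℝ
  /-- increment of an auxiliary variable -/
  ε : ℝ

variable {n : ℕ}

/-- The exponents: `D.q i` is `q_{i+1}`, where `q_1 = 1` and `q_{i+1} = α - 1 + q_i`. -/
def Design.q (D : Design n) : ℕ → ℚ
  | 0 => 1
  | i + 1 => D.α - 1 + D.q i

/-- The requirements on the design parameters. -/
structure Design.Admissible (D : Design n) : Prop where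
  /-- `α` is a ratio of odd integers in `(1/2, 1)` -/
  odd_num : Odd D.α.num
  odd_den : Odd D.α.den
  half_lt : 1 / 2 < D.α
  lt_one : D.α < 1
  /-- all exponents `q_1 > q_2 > ... > q_{n+1}` are positive -/
  q_pos : 0 < D.q n
  K_pos : ∀ i, 0 < D.K i
  U_pos : ∀ i, 0 < D.U i
  θ_pos : ∀ i, 0 < D.θ i 0
  θ_mono : ∀ i, Monotone (D.θ i)
  θ_tendsto : ∀ i, Tendsto (D.θ i) atTop atTop
  a_pos : 0 < D.a
  ζ_pos : 0 < D.ζ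
  ς_pos : 0 < D.ς
  ε_pos : 0 < D.ε
  c_pos : ∀ i j : Fin n, (j < i ∨ (j : ℕ) = i + 1) → 0 < D.c i j
  /-- `Q_i > ∑_{j > i} c_{ji} + c_{i-1,i}`, with `c_{0,1} = 0` -/
  Q_large : ∀ i : Fin n,
    ∑ j ∈ Finset.univ.filter (fun j : Fin n => i < j), D.c j i
      + (if 0 < (i : ℕ) then D.c ⟨i - 1, by omega⟩ i else 0) < D.Q i

/-- The adaptive gain belonging to the value `k` of the switching signal of channel `i`. -/
noncomputable def Design.gain (D : Design n) (i : Fin n) (k : ℕ) : ℝ :=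
  (-1) ^ k * D.θ i k

/-- The virtual control error `x_i ^ (1/q_i) - (x_i^*) ^ (1/q_i)` as a function of the state `xi`
and the virtual control `v` of channel `i`. -/
noncomputable def Design.channelErr (D : Design n) (i : ℕ) (xi v : ℝ) : ℝ :=
  qpow xi (1 / D.q i) - qpow v (1 / D.q i)

/-- The control law of channel `i` at the error `s`, the switching signal `k` and the barrier
`b`. -/
noncomputable def Design.channelLaw (D : Design n) (i : Fin n) (k : ℕ) (b s : ℝ) : ℝ :=
  D.gain i k * (-D.K i * qpow s (D.q (i + 1))
    - D.U i * qpow s (D.q (i + 1)) / qpow (b ^ 2 - s ^ 2) (1 + 2 * D.α))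

/-- The virtual controls, in the state `x`, for the switching signals `σ` and the barriers `χ`.
With channels counted from `0`, `virtualControl i` is what `x i` should track. The first error is
`s_1 = x_1`, so the entry `0` is `0`; the entry `n` is the control input `u`. -/
noncomputable def Design.virtualControl (D : Design n) (σ : Fin n → ℕ) (χ x : Fin n → ℝ) : ℕ → ℝ
  | 0 => 0
  | i + 1 =>
    if hi : i < n then
      D.channelLaw ⟨i, hi⟩ (σ ⟨i, hi⟩) (χ ⟨i, hi⟩)
        (D.channelErr i (x ⟨i, hi⟩) (D.virtualControl σ χ x i))
    else 0

/-- The virtual control errors `s_i`. -/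
noncomputable def Design.err (D : Design n) (σ : Fin n → ℕ) (χ x : Fin n → ℝ) (i : Fin n) : ℝ :=
  D.channelErr i (x i) (D.virtualControl σ χ x i)

/-- The control input `u`. -/
noncomputable def Design.input (D : Design n) (σ : Fin n → ℕ) (χ x : Fin n → ℝ) : ℝ :=
  D.virtualControl σ χ x n

/-- The switching barrier Lyapunov functions `V_i`. -/
noncomputable def Design.lyap (D : Design n) (σ : Fin n → ℕ) (χ x : Fin n → ℝ) (i : Fin n) : ℝ :=
  if (i : ℕ) = 0 then
    1 / 2 * Real.log (χ i ^ 2 / (χ i ^ 2 - D.err σ χ x i ^ 2))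
  else
    ∫ τ in (D.virtualControl σ χ x i)..(x i),
      qpow (D.channelErr i τ (D.virtualControl σ χ x i)) (2 - D.q i)
        / (χ i ^ 2 - D.channelErr i τ (D.virtualControl σ χ x i) ^ 2)

/-- The supervisory functions `V_i - η_i`. -/
noncomputable def Design.superv (D : Design n) (σ : Fin n → ℕ) (χ x η : Fin n → ℝ)
    (i : Fin n) : ℝ :=
  D.lyap σ χ x i - η i

/-- Right-hand side of the plant equations in closed loop:
`h_i x_{i+1} + f_i`, where `x_{n+1}` is the control input. -/
noncomputable def stateRHS (D : Design n) (P : Plant n) (σ : Fin n → ℕ) (χ x : Fin n → ℝ)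
    (i : Fin n) : ℝ :=
  P.h i (fun j => x ⟨j, by omega⟩)
      * (if hi : (i : ℕ) + 1 < n then x ⟨i + 1, hi⟩ else D.input σ χ x)
    + P.f i (fun j => x ⟨j, by omega⟩)

/-- Right-hand side of the auxiliary equations, with the added constant `ζ`
and with `s_{n+1} = 0`. -/
noncomputable def auxRHS (D : Design n) (σ : Fin n → ℕ) (χ x η : Fin n → ℝ) (i : Fin n) : ℝ :=
  -D.a * qpow (η i) ((1 + D.α) / 2) - D.Q i * qpow (D.err σ χ x i) (1 + D.α)
    + ∑ j ∈ Finset.univ.filter (fun j : Fin n => j < i),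
        D.c i j * qpow (D.err σ χ x j) (1 + D.α)
    + (if hi : (i : ℕ) + 1 < n then
        D.c i ⟨i + 1, hi⟩ * qpow (D.err σ χ x ⟨i + 1, hi⟩) (1 + D.α) else 0)
    + D.ζ

/-- The event `𝒮_i > 0` occurs at time `t`: some solution of the closed loop which passes through
`(x, η)` at time `t` and keeps the adaptive parameters `σ, χ` has positive supervisory functions
at times arbitrarily close to `t` from the right. -/
def Event (D : Design n) (P : Plant n) (t : ℝ) (σ : Fin n → ℕ) (χ x η : Fin n → ℝ) : Prop :=
  ∃ δ > 0, ∃ y w : ℝ → Fin n → ℝ, y t = x ∧ w t = η ∧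
    ContinuousOn y (Ico t (t + δ)) ∧ ContinuousOn w (Ico t (t + δ)) ∧
    (∀ r ∈ Ico t (t + δ),
      HasDerivWithinAt y (stateRHS D P σ χ (y r)) (Ici r) r ∧
      HasDerivWithinAt w (auxRHS D σ χ (y r) (w r)) (Ici r) r) ∧
    ∃ᶠ r in 𝓝[>] t, ∃ i, 0 < D.superv σ χ (y r) (w r) i

/-- The update made at a switching time in the state `x`: from the values `σ, χ, η` just before to
the values `σ', χ', η'`. The errors `s_i` are recomputed for `i = 1, ..., n` in this order; `s_i`
depends on the new switching signals and on the new barriers of the earlier channels only. -/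
def Update (D : Design n) (x : Fin n → ℝ) (σ : Fin n → ℕ) (χ η : Fin n → ℝ)
    (σ' : Fin n → ℕ) (χ' η' : Fin n → ℝ) : Prop :=
  (∀ i, σ' i = if 0 ≤ D.superv σ χ x η i then σ i + 1 else σ i) ∧
  (∀ i, χ' i = if |χ i| ≤ |D.err σ' χ' x i| then |D.err σ' χ' x i| + D.ς else χ i) ∧
  (∀ i, η' i = if η i ≤ D.lyap σ' χ' x i then D.lyap σ' χ' x i + D.ε else η i)

/-- `x, η, χ, σ` are the signals of the closed loop on the time interval `[0, T)`, started at the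
state `x₀` with the barriers `χ₀`. -/
structure IsClosedLoop (D : Design n) (P : Plant n) (x₀ χ₀ : Fin n → ℝ) (T : EReal)
    (x η χ : ℝ → Fin n → ℝ) (σ : ℝ → Fin n → ℕ) : Prop where
  init_x : x 0 = x₀
  init_σ : ∀ i, σ 0 i = 1
  init_χ : χ 0 = χ₀
  init_η : ∀ i, η 0 i = D.lyap (σ 0) χ₀ x₀ i + D.ε
  /-- the state is continuous -/
  continuous_x : ContinuousOn x {t : ℝ | 0 ≤ t ∧ (t : EReal) < T}
  /-- the differential equations of the plant and of the auxiliary variables -/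
  deriv_x : ∀ t : ℝ, 0 ≤ t → (t : EReal) < T →
    HasDerivWithinAt x (stateRHS D P (σ t) (χ t) (x t)) (Ici t) t
  deriv_η : ∀ t : ℝ, 0 ≤ t → (t : EReal) < T →
    HasDerivWithinAt η (auxRHS D (σ t) (χ t) (x t) (η t)) (Ici t) t
  /-- the adaptive parameters are piecewise constant and continuous from the right -/
  const_right : ∀ t : ℝ, 0 ≤ t → (t : EReal) < T →
    ∀ᶠ r in 𝓝[>] t, σ r = σ t ∧ χ r = χ t
  /-- the supervisory functions, after the possible update, are not positive -/
  superv_nonpos : ∀ t : ℝ, 0 ≤ t → (t : EReal) < T → ∀ i,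
    D.superv (σ t) (χ t) (x t) (η t) i ≤ 0
  /-- at every time there are values `σ⁻, χ⁻, η⁻` from the left, and either nothing is updated, or
  the event occurs and the update is made -/
  logic : ∀ t : ℝ, 0 < t → (t : EReal) < T →
    ∃ (σm : Fin n → ℕ) (χm ηm : Fin n → ℝ),
      (∀ᶠ r in 𝓝[<] t, σ r = σm ∧ χ r = χm) ∧ Tendsto η (𝓝[<] t) (𝓝 ηm) ∧
      ((σ t = σm ∧ χ t = χm ∧ η t = ηm) ∨
        (Event D P t σm χm (x t) ηm ∧ Update D (x t) σm χm ηm (σ t) (χ t) (η t)))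

end SwitchingControl

open SwitchingControl

/-! The channels settle one after the other. Suppose that the switching signals before channel `i`
have stopped and that `x_i`, `x_i^*` and the derivative of `(x_i^*)^(1/q_i)` are bounded. The gain
`h_i` has a constant, though unknown, sign, so for suitable arbitrarily large values of `σ_i` of the
right parity the product of `h_i` with the adaptive gain exceeds any given constant. Young's
inequality (`exists_gain_domination`) then yields `V_i' ≤ -a V_i^φ - Q_i |s_i|^(1+α) + c_{i,i+1}
|s_{i+1}|^(1+α) + ζ/2` with `φ = (1+α)/2`. The nonlinearity `f_i` need not vanish at `0`, because
the constant `ζ` pays for it. Subtracting this from the equation of `η_i` shows that the gap `η_i -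
V_i` grows at least at the rate `ζ/4` as soon as it is small. It therefore cannot shrink to zero,
and `σ_i` never leaves such a value (`exists_no_switching`). Since `σ_i` rises in unit steps, it is
bounded and finally constant. From then on the barriers of the channels `i` and `i+1` are constant,
`η_i` is bounded, and `V_i ≤ η_i` keeps `s_i` uniformly away from its barrier. This bounds the next
virtual control, the next state and the derivative of the next root, so the assumptions pass to
channel `i+1` (`settled_succ`).

The argument works on every interval `[0, T)`, finite or not. For finite `T` it excludes both
blow-up and an accumulation of switching times: all signals have limits at `T`, at most one update
is made there, and the solution continues (`exists_extension`). Zorn's lemma then gives a solution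
for all times. The fractional powers make the right-hand sides continuous but not Lipschitz, so
local solutions come from Peano's theorem, and uniqueness is never used.

After the last switching the auxiliary equations are added. The choice of `Q_i` makes the coupling
terms disappear, so that `W = ∑ η_i` satisfies `W' ≤ -a W^φ + n ζ`. Hence `W`, and with it each
`V_i` in `[0, W]`, falls below any level `L` with `a L^φ > n ζ` in finite time (`exists_lyap_le`);
the two asserted bounds are two choices of `L`.

The analytic difficulty is that `x_i^*` is only Hölder continuous in `s_{i-1}`. The root
`(x_i^*)^(1/q_i)` is a `C^1` function of `s_{i-1}` inside the barrier, and `V_i` is differentiable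
as a function of this root and of `x_i`, even where its lower limit of integration is not. -/

namespace SwitchingControl

/-! ### Odd real powers -/

/-- The odd power `sign x * |x| ^ r` with a real exponent. -/
noncomputable def opow (x r : ℝ) : ℝ := Real.sign x * |x| ^ r

theorem qpow_odd {r : ℚ} (hr : Odd r.num) (x : ℝ) : qpow x r = opow x r := by
  rw [qpow, if_neg (Int.not_even_iff_odd.2 hr), opow]

theorem qpow_even {r : ℚ} (hr : Even r.num) (x : ℝ) : qpow x r = |x| ^ (r : ℝ) := by
  rw [qpow, if_pos hr]

theorem opow_zero_left {r : ℝ} : opow 0 r = 0 := by simp [opow]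

theorem opow_of_pos {x r : ℝ} (hx : 0 < x) : opow x r = x ^ r := by
  rw [opow, Real.sign_of_pos hx, abs_of_pos hx, one_mul]

theorem opow_of_nonneg {x r : ℝ} (hr : r ≠ 0) (hx : 0 ≤ x) : opow x r = x ^ r := by
  rcases hx.eq_or_lt with rfl | h
  · rw [opow_zero_left, Real.zero_rpow hr]
  · exact opow_of_pos h

theorem opow_neg (x r : ℝ) : opow (-x) r = -opow x r := by
  rw [opow, opow, abs_neg, Real.sign_neg, neg_mul]

theorem opow_of_neg {x r : ℝ} (hx : x < 0) : opow x r = -(-x) ^ r := by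
  rw [← opow_of_pos (neg_pos.2 hx), opow_neg, neg_neg]

theorem opow_one (x : ℝ) : opow x 1 = x := by
  rcases lt_trichotomy x 0 with h | rfl | h
  · rw [opow_of_neg h, Real.rpow_one, neg_neg]
  · exact opow_zero_left
  · rw [opow_of_pos h, Real.rpow_one]

theorem abs_opow {r : ℝ} (hr : r ≠ 0) (x : ℝ) : |opow x r| = |x| ^ r := by
  rcases lt_trichotomy x 0 with h | rfl | h
  · rw [opow_of_neg h, abs_neg, abs_of_neg h, abs_of_nonneg (Real.rpow_nonneg (by linarith) _)]
  · rw [opow_zero_left, abs_zero, Real.zero_rpow hr]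
  · rw [opow_of_pos h, abs_of_pos h, abs_of_nonneg (Real.rpow_nonneg h.le _)]

theorem mul_opow (x y r : ℝ) : opow (x * y) r = opow x r * opow y r := by
  rw [opow, opow, opow, abs_mul, Real.mul_rpow (abs_nonneg _) (abs_nonneg _)]
  have : Real.sign (x * y) = Real.sign x * Real.sign y := by
    rcases lt_trichotomy x 0 with h | rfl | h <;> rcases lt_trichotomy y 0 with h' | rfl | h' <;>
    simp [Real.sign_of_pos, Real.sign_of_neg, *, mul_pos_of_neg_of_neg, mul_neg_of_neg_of_pos,
      mul_neg_of_pos_of_neg]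
  rw [this]; ring

theorem opow_opow {r : ℝ} (x s : ℝ) : opow (opow x r) s = opow x (r * s) := by
  rcases lt_trichotomy x 0 with h | rfl | h
  · have h' : 0 < -x := by linarith
    rw [opow_of_neg h, opow_of_neg h, opow_neg, opow_of_pos (Real.rpow_pos_of_pos h' _),
      ← Real.rpow_mul h'.le]
  · simp [opow_zero_left]
  · rw [opow_of_pos h, opow_of_pos h, opow_of_pos (Real.rpow_pos_of_pos h _), ← Real.rpow_mul h.le]

theorem opow_inv_left {r : ℝ} (hr : r ≠ 0) (x : ℝ) : opow (opow x (1 / r)) r = x := by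
  rw [opow_opow, one_div_mul_cancel hr, opow_one]

theorem opow_inv_right {r : ℝ} (hr : r ≠ 0) (x : ℝ) : opow (opow x r) (1 / r) = x := by
  rw [opow_opow, mul_one_div_cancel hr, opow_one]

/-- At least one of the two terms vanishes, so this form without a sign function makes continuity
immediate. -/
theorem opow_eq_max {r : ℝ} (hr : 0 < r) (x : ℝ) :
    opow x r = (max x 0) ^ r - (max (-x) 0) ^ r := by
  rcases lt_trichotomy x 0 with h | rfl | h
  · rw [opow_of_neg h, max_eq_right h.le, max_eq_left (by linarith), Real.zero_rpow hr.ne']; ring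
  · simp [opow_zero_left]
  · rw [opow_of_pos h, max_eq_left h.le, max_eq_right (by linarith), Real.zero_rpow hr.ne']; ring

theorem continuous_opow {r : ℝ} (hr : 0 < r) : Continuous fun x => opow x r := by
  simp_rw [opow_eq_max hr]
  exact ((continuous_id.max continuous_const).rpow_const fun _ => Or.inr hr.le).sub
    ((continuous_neg.max continuous_const).rpow_const fun _ => Or.inr hr.le)

theorem opow_strictMono {r : ℝ} (hr : 0 < r) : StrictMono fun x => opow x r := by
  have hpos : ∀ x y : ℝ, 0 ≤ x → x < y → opow x r < opow y r := fun x y hx hxy => by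
    rw [opow_of_nonneg hr.ne' hx, opow_of_pos (hx.trans_lt hxy)]
    exact Real.rpow_lt_rpow hx hxy hr
  intro x y hxy
  rcases le_or_gt 0 x with hx | hx
  · exact hpos x y hx hxy
  rcases le_or_gt y 0 with hy | hy
  · have := hpos (-y) (-x) (by linarith) (by linarith)
    rw [opow_neg, opow_neg] at this
    exact neg_lt_neg_iff.1 this
  · have h1 := hpos 0 (-x) le_rfl (by linarith)
    have h2 := hpos 0 y le_rfl hy
    rw [opow_neg, opow_zero_left] at h1
    rw [opow_zero_left] at h2
    change opow x r < opow y r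
    linarith

theorem hasDerivAt_opow {r : ℝ} (hr : 1 ≤ r) (x : ℝ) :
    HasDerivAt (fun y => opow y r) (r * |x| ^ (r - 1)) x := by
  rcases lt_trichotomy x 0 with h | rfl | h
  · have h1 : HasDerivAt (fun y : ℝ => -(-y) ^ r) (r * |x| ^ (r - 1)) x := by
      have h2 : HasDerivAt (fun y : ℝ => -y) (-1) x := (hasDerivAt_id x).neg
      have h3 := (h2.rpow_const (p := r) (Or.inl (neg_ne_zero.2 h.ne))).neg
      rw [abs_of_neg h]
      exact h3.congr_deriv (by ring)
    refine h1.congr_of_eventuallyEq ?_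
    filter_upwards [eventually_lt_nhds h] with y hy using opow_of_neg hy
  · rw [hasDerivAt_iff_tendsto_slope]
    have h1 : Tendsto (fun y : ℝ => |y| ^ (r - 1)) (𝓝[≠] 0) (𝓝 (r * |(0 : ℝ)| ^ (r - 1))) := by
      have hc : Continuous fun y : ℝ => |y| ^ (r - 1) :=
        continuous_abs.rpow_const fun _ => Or.inr (by linarith)
      -- The factor `r` can be dropped: for `r = 1` it is one, and for `r > 1` both sides are zero.
      have h2 : r * |(0 : ℝ)| ^ (r - 1) = |(0 : ℝ)| ^ (r - 1) := by
        rcases hr.eq_or_lt with rfl | h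
        · simp
        · rw [abs_zero, Real.zero_rpow (by linarith), mul_zero]
      rw [h2]
      exact (hc.tendsto 0).mono_left nhdsWithin_le_nhds
    refine h1.congr' ?_
    filter_upwards [self_mem_nhdsWithin] with y hy
    have hy' : y ≠ 0 := hy
    rw [slope_def_field, opow_zero_left, sub_zero, sub_zero, Real.rpow_sub_one (by simpa using hy'),
      opow]
    rcases hy'.lt_or_gt with h | h
    · rw [abs_of_neg h, Real.sign_of_neg h]; field_simp
    · rw [abs_of_pos h, Real.sign_of_pos h, one_mul]
  · have h1 := (hasDerivAt_id x).rpow_const (p := r) (Or.inl h.ne')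
    simp only [id, one_mul] at h1
    rw [abs_of_pos h]
    refine h1.congr_of_eventuallyEq ?_
    filter_upwards [eventually_gt_nhds h] with y hy using opow_of_pos hy

/-- For equal signs this is the subadditivity of `t ↦ t ^ q`, even with constant `1`. For opposite
signs both `|x|` and `|y|` are at most `|x - y|`, which costs the factor `2`. -/
theorem abs_opow_sub_le {q : ℝ} (hq : 0 < q) (hq1 : q ≤ 1) (x y : ℝ) :
    |opow x q - opow y q| ≤ 2 * |x - y| ^ q := by
  wlog hxy : y ≤ x generalizing x y
  · rw [abs_sub_comm, abs_sub_comm x]; exact this y x (by linarith)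
  have key : ∀ x y : ℝ, 0 ≤ y → y ≤ x → opow x q - opow y q ≤ 2 * (x - y) ^ q := by
    intro x y hy hxy
    rw [opow_of_nonneg hq.ne' hy, opow_of_nonneg hq.ne' (hy.trans hxy)]
    have := Real.rpow_add_le_add_rpow (p := q) (sub_nonneg.2 hxy) hy hq.le hq1
    rw [sub_add_cancel] at this
    have := Real.rpow_nonneg (sub_nonneg.2 hxy) q
    linarith
  rw [abs_of_nonneg (sub_nonneg.2 ((opow_strictMono hq).monotone hxy)),
    abs_of_nonneg (sub_nonneg.2 hxy)]
  rcases le_or_gt 0 y with hy | hy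
  · exact key x y hy hxy
  rcases le_or_gt x 0 with hx | hx
  · have := key (-y) (-x) (by linarith) (by linarith)
    rw [opow_neg, opow_neg] at this
    rw [show x - y = -y - -x by ring]
    linarith
  · rw [opow_of_neg hy, opow_of_pos hx]
    have h1 : x ^ q ≤ (x - y) ^ q := Real.rpow_le_rpow hx.le (by linarith) hq.le
    have h2 : (-y) ^ q ≤ (x - y) ^ q := Real.rpow_le_rpow (by linarith) (by linarith) hq.le
    linarith

theorem mul_opow_self {r : ℝ} (x : ℝ) : opow x r * x = |x| ^ r * |x| := by
  rcases lt_trichotomy x 0 with h | rfl | h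
  · rw [opow_of_neg h, abs_of_neg h]; ring
  · simp
  · rw [opow_of_pos h, abs_of_pos h]

theorem opow_mul_opow {r s : ℝ} (x : ℝ) (hrs : r + s ≠ 0) :
    opow x r * opow x s = |x| ^ (r + s) := by
  rcases lt_trichotomy x 0 with h | rfl | h
  · rw [opow_of_neg h, opow_of_neg h, abs_of_neg h, Real.rpow_add (by linarith)]; ring
  · simp [opow_zero_left, Real.zero_rpow hrs]
  · rw [opow_of_pos h, opow_of_pos h, abs_of_pos h, Real.rpow_add h]

end SwitchingControl

/-! ### Barrier integrals and their blow-up at the barrier -/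

namespace SwitchingControl

/-- The integrand `y ^ p / (b ^ 2 - y ^ 2)` of the barrier Lyapunov functions. -/
noncomputable def barrierRate (b p y : ℝ) : ℝ := opow y p / (b ^ 2 - y ^ 2)

/-- The derivative of `barrierRate b p`. -/
noncomputable def barrierRateDeriv (b p y : ℝ) : ℝ :=
  p * |y| ^ (p - 1) / (b ^ 2 - y ^ 2) + opow y p * (2 * y) / (b ^ 2 - y ^ 2) ^ 2

/-- The barrier Lyapunov function of one channel, as a function of `v = (x^*) ^ (1 / q)` and of the
state `x`. -/
noncomputable def barrierInt (b q v x : ℝ) : ℝ :=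
  ∫ τ in (opow v q)..x, barrierRate b (2 - q) (opow τ (1 / q) - v)

theorem sq_sub_sq_pos {b y : ℝ} (h : |y| < b) : 0 < b ^ 2 - y ^ 2 := by
  have := sq_lt_sq' (by linarith [abs_nonneg y]) h
  rw [sq_abs] at this; linarith

theorem hasDerivAt_barrierRate {b p y : ℝ} (hp : 1 ≤ p) (h : |y| < b) :
    HasDerivAt (barrierRate b p) (barrierRateDeriv b p y) y := by
  have h1 := sq_sub_sq_pos h
  have h2 : HasDerivAt (fun y : ℝ => b ^ 2 - y ^ 2) (-(2 * y)) y := by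
    simpa using (hasDerivAt_pow 2 y).const_sub (b ^ 2)
  refine ((hasDerivAt_opow hp y).div h2 h1.ne').congr_deriv ?_
  rw [barrierRateDeriv]; field_simp; ring

theorem continuousOn_barrierRate {b p : ℝ} (hp : 1 ≤ p) :
    ContinuousOn (barrierRate b p) {y | |y| < b} :=
  fun _ hy => (hasDerivAt_barrierRate hp hy).continuousAt.continuousWithinAt

theorem continuousOn_barrierRateDeriv {b p : ℝ} (hp : 1 ≤ p) :
    ContinuousOn (barrierRateDeriv b p) {y | |y| < b} := by
  have h0 : ContinuousOn (fun y : ℝ => b ^ 2 - y ^ 2) {y | |y| < b} := by fun_prop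
  have h1 : Continuous fun y : ℝ => |y| ^ (p - 1) :=
    continuous_abs.rpow_const fun _ => Or.inr (by linarith)
  refine ((continuous_const.mul h1).continuousOn.div h0 fun y hy =>
    (sq_sub_sq_pos hy).ne').add (((continuous_opow (by linarith)).mul
      (by fun_prop)).continuousOn.div (h0.pow 2) fun y hy => (pow_pos (sq_sub_sq_pos hy) 2).ne')

theorem abs_barrierRate_le {b p y s : ℝ} (hp : 0 < p) (hy : |y| ≤ |s|) (hs : |s| < b) :
    |barrierRate b p y| ≤ |s| ^ p / (b ^ 2 - s ^ 2) := by
  have h1 := sq_sub_sq_pos hs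
  have h2 : y ^ 2 ≤ s ^ 2 := sq_le_sq.2 hy
  rw [barrierRate, abs_div, abs_opow hp.ne', abs_of_pos (by linarith : 0 < b ^ 2 - y ^ 2)]
  gcongr

/-- Over a common denominator the derivative is `|y|^(p-1) (p (b² - y²) + 2 y²) / (b² - y²)²`. The
bracket is at most `4 b²`, and the remaining factors increase with `|y|`. -/
theorem abs_barrierRateDeriv_le {b p y s : ℝ} (hp : 1 ≤ p) (hp2 : p ≤ 2) (hy : |y| ≤ |s|)
    (hs : |s| < b) :
    |barrierRateDeriv b p y| ≤ 4 * b ^ 2 * |s| ^ (p - 1) / (b ^ 2 - s ^ 2) ^ 2 := by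
  have h1 := sq_sub_sq_pos hs
  have h2 : y ^ 2 ≤ s ^ 2 := sq_le_sq.2 hy
  have h3 : 0 < b ^ 2 - y ^ 2 := by linarith
  have h4 : |y| ^ (p - 1) ≤ |s| ^ (p - 1) :=
    Real.rpow_le_rpow (abs_nonneg _) hy (by linarith)
  have h5 : opow y p * (2 * y) = 2 * (|y| ^ (p - 1) * y ^ 2) := by
    rcases eq_or_ne y 0 with rfl | hy0
    · simp
    · have := mul_opow_self (r := p) y
      rw [Real.rpow_sub_one (abs_ne_zero.2 hy0), ← sq_abs y]
      have h0 : |y| ≠ 0 := abs_ne_zero.2 hy0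
      field_simp
      linarith
  have h6 : 0 ≤ |y| ^ (p - 1) := Real.rpow_nonneg (abs_nonneg _) _
  have h7 : barrierRateDeriv b p y
      = |y| ^ (p - 1) * (p * (b ^ 2 - y ^ 2) + 2 * y ^ 2) / (b ^ 2 - y ^ 2) ^ 2 := by
    rw [barrierRateDeriv, h5]; field_simp
  have h8 : p * (b ^ 2 - y ^ 2) + 2 * y ^ 2 ≤ 4 * b ^ 2 := by nlinarith
  have h9 : 0 ≤ p * (b ^ 2 - y ^ 2) + 2 * y ^ 2 := by positivity
  rw [h7, abs_of_nonneg (by positivity), mul_comm (4 * b ^ 2)]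
  gcongr


/-- By monotonicity the shifted root moves from `0` at the lower limit of integration to the full
error at `x`. Pointwise bounds at the error therefore hold on the whole range of integration. -/
theorem abs_opow_sub_mono {q : ℝ} (hq : 0 < q) {v x τ : ℝ} (hτ : τ ∈ uIcc (opow v q) x) :
    |opow τ (1 / q) - v| ≤ |opow x (1 / q) - v| := by
  have hm := (opow_strictMono (one_div_pos.2 hq)).monotone
  have hv := opow_inv_right hq.ne' v
  rcases le_total (opow v q) x with h | h
  · rw [uIcc_of_le h] at hτ
    have h1 : opow (opow v q) (1 / q) ≤ opow τ (1 / q) := hm hτ.1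
    have h2 : opow τ (1 / q) ≤ opow x (1 / q) := hm hτ.2
    rw [abs_of_nonneg (by linarith), abs_of_nonneg (by linarith)]; linarith
  · rw [uIcc_of_ge h] at hτ
    have h1 : opow τ (1 / q) ≤ opow (opow v q) (1 / q) := hm hτ.2
    have h2 : opow x (1 / q) ≤ opow τ (1 / q) := hm hτ.1
    rw [abs_of_nonpos (by linarith), abs_of_nonpos (by linarith)]; linarith

/-- This is Hölder continuity applied to the roots. It bounds the length of the range of integration
and also the tracking error that enters the equation of the preceding channel. -/
theorem abs_sub_opow_le {q : ℝ} (hq : 0 < q) (hq1 : q ≤ 1) (v x : ℝ) : |x - opow v q| ≤ 2 * |opow x (1 / q) - v| ^ q := by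
  have := abs_opow_sub_le hq hq1 (opow x (1 / q)) v
  rwa [opow_inv_left hq.ne'] at this

/-- The integrand is at most `|s|^(2-q) / (b² - s²)` and the range has length at most `2 |s|^q`. The
exponent `2 - q` is the one that makes the product quadratic in `s`. -/
theorem abs_barrierInt_le {b q : ℝ} (hq : 0 < q) (hq1 : q ≤ 1) {v x : ℝ} (hs : |opow x (1 / q) - v| < b) :
    |barrierInt b q v x|
      ≤ 2 * (opow x (1 / q) - v) ^ 2 / (b ^ 2 - (opow x (1 / q) - v) ^ 2) := by
  have h1 := sq_sub_sq_pos hs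
  have h2 := intervalIntegral.norm_integral_le_of_norm_le_const (a := opow v q) (b := x)
    (f := fun τ => barrierRate b (2 - q) (opow τ (1 / q) - v)) fun τ hτ =>
      abs_barrierRate_le (by linarith : 0 < 2 - q)
        (abs_opow_sub_mono hq (uIoc_subset_uIcc hτ)) hs
  rw [Real.norm_eq_abs] at h2
  refine h2.trans ((mul_le_mul_of_nonneg_left (abs_sub_opow_le hq hq1 v x) (by positivity)).trans
    (le_of_eq ?_))
  set s := opow x (1 / q) - v
  have h3 : s ^ 2 = |s| ^ (2 - q) * |s| ^ q := by
    rw [← Real.rpow_add_of_nonneg (abs_nonneg _) (by linarith) hq.le, sub_add_cancel,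
      Real.rpow_two, sq_abs]
  field_simp
  rw [h3]

/-- The symmetry reduces one-sided estimates to nonnegative errors. -/
theorem barrierInt_neg {b q : ℝ} (v x : ℝ) : barrierInt b q (-v) (-x) = barrierInt b q v x := by
  have := intervalIntegral.integral_comp_neg (a := opow v q) (b := x)
    (fun τ => barrierRate b (2 - q) (opow τ (1 / q) - -v))
  rw [barrierInt, barrierInt, opow_neg, intervalIntegral.integral_symm, ← this,
    ← intervalIntegral.integral_neg]
  congr 1
  ext τ
  rw [opow_neg, show -opow τ (1 / q) - -v = -(opow τ (1 / q) - v) by ring, barrierRate, opow_neg,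
    barrierRate, neg_sq, neg_div, neg_neg]

theorem continuousOn_barrierRate_comp {b q : ℝ} (hq : 0 < q) (hq1 : q ≤ 1) (v : ℝ) :
    ContinuousOn (fun τ => barrierRate b (2 - q) (opow τ (1 / q) - v))
      {τ | |opow τ (1 / q) - v| < b} :=
  (continuousOn_barrierRate (by linarith)).comp
    (((continuous_opow (one_div_pos.2 hq)).sub continuous_const).continuousOn) fun _ h => h

theorem uIcc_subset_barrier {b q : ℝ} (hq : 0 < q) {v x : ℝ} (hs : |opow x (1 / q) - v| < b) :
    uIcc (opow v q) x ⊆ {τ | |opow τ (1 / q) - v| < b} := fun _ hτ =>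
  (abs_opow_sub_mono hq hτ).trans_lt hs

theorem le_of_opow_sub_nonneg {q : ℝ} (hq : 0 < q) {v x : ℝ} (h : 0 ≤ opow x (1 / q) - v) : opow v q ≤ x := by
  have := (opow_strictMono hq).monotone (sub_nonneg.1 h)
  simpa only [opow_inv_left hq.ne'] using this

theorem opow_sub_nonneg {q : ℝ} (hq : 0 < q) {v τ : ℝ} (h : opow v q ≤ τ) : 0 ≤ opow τ (1 / q) - v := by
  have := (opow_strictMono (one_div_pos.2 hq)).monotone h
  simp only [opow_inv_right hq.ne'] at this
  linarith

theorem barrierInt_nonneg {b q : ℝ} (hq : 0 < q) {v x : ℝ} (hs : |opow x (1 / q) - v| < b) :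
    0 ≤ barrierInt b q v x := by
  wlog h : 0 ≤ opow x (1 / q) - v generalizing v x
  · rw [← barrierInt_neg]
    refine this (v := -v) (x := -x) ?_ ?_ <;> rw [opow_neg]
    · rwa [show -opow x (1 / q) - -v = -(opow x (1 / q) - v) by ring, abs_neg]
    · linarith
  have hle := le_of_opow_sub_nonneg hq h
  refine intervalIntegral.integral_nonneg hle fun τ hτ => ?_
  have h1 := sq_sub_sq_pos (uIcc_subset_barrier hq hs (Icc_subset_uIcc hτ))
  rw [barrierRate]
  refine div_nonneg ?_ h1.le
  have := opow_sub_nonneg hq hτ.1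
  rcases this.eq_or_lt with h | h
  · rw [← h, opow_zero_left]
  · rw [opow_of_pos h]; positivity

/-- A bound of the barrier Lyapunov function keeps the error away from the barrier. -/
theorem exists_le_sq_sub_sq_of_barrierInt_le {b q : ℝ} (hq : 0 < q) (hq1 : q ≤ 1) (hb : 0 < b) (B M : ℝ) :
    ∃ κ > 0, ∀ v x, |v| ≤ M → |opow x (1 / q) - v| < b → barrierInt b q v x ≤ B →
      κ ≤ b ^ 2 - (opow x (1 / q) - v) ^ 2 := by
  -- `L` bounds the derivative of `τ ^ (1/q)` on the range of integration, where `|τ^(1/q)| ≤ |M| +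
  -- b`. The constant `κ` below results from solving the logarithmic estimate `hlog` for the
  -- distance to the barrier.
  set L : ℝ := 1 / q * (|M| + b) ^ (1 - q) with hL
  have hLpos : 0 < L := by positivity
  have hbq : 0 < b ^ (1 + q) := Real.rpow_pos_of_pos hb _
  refine ⟨b ^ 2 * Real.exp (-(2 * (B * (L * b ^ (1 + q))) + b ^ 2) / b ^ 2), by positivity, ?_⟩
  intro v x hv hs hB
  wlog h : 0 ≤ opow x (1 / q) - v generalizing v x
  · have := this (-v) (-x) (by rwa [abs_neg]) ?_ (by rwa [barrierInt_neg]) ?_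
    · rw [opow_neg, show -opow x (1 / q) - -v = -(opow x (1 / q) - v) by ring, neg_sq] at this
      exact this
    · rwa [opow_neg, show -opow x (1 / q) - -v = -(opow x (1 / q) - v) by ring, abs_neg]
    · rw [opow_neg]; linarith
  have hle := le_of_opow_sub_nonneg hq h
  have hsub := uIcc_subset_barrier hq hs
  have hq' : 1 ≤ 1 / q := (one_le_div hq).2 hq1
  set Y : ℝ → ℝ := fun τ => opow τ (1 / q) - v with hY
  have hYd : ∀ τ, HasDerivAt Y (1 / q * |τ| ^ (1 / q - 1)) τ := fun τ =>
    (hasDerivAt_opow hq' τ).sub_const v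
  have hYc : Continuous Y := (continuous_opow (one_div_pos.2 hq)).sub continuous_const
  -- `H` is an antiderivative of `Y³ Y' / (b² - Y²)` and tends to infinity at the barrier. The
  -- integrand of the Lyapunov function lacks the factor `Y'`, which may vanish but is at most `L`,
  -- so it dominates this one up to a constant.
  set H : ℝ → ℝ := fun τ => -(1 / 2) * b ^ 2 * Real.log (b ^ 2 - Y τ ^ 2) - Y τ ^ 2 / 2 with hH
  have hHd : ∀ τ ∈ uIcc (opow v q) x, HasDerivAt H
      (Y τ ^ 3 / (b ^ 2 - Y τ ^ 2) * (1 / q * |τ| ^ (1 / q - 1))) τ := by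
    intro τ hτ
    have h1 := sq_sub_sq_pos (hsub hτ)
    change 0 < b ^ 2 - Y τ ^ 2 at h1
    have h2 := (hYd τ).pow 2
    have h3 := (((h2.const_sub (b ^ 2)).log h1.ne').const_mul (-(1 / 2) * b ^ 2)).sub
      (h2.div_const 2)
    refine h3.congr_deriv ?_
    have h4 : b ^ 2 - (Y ^ 2) τ = b ^ 2 - Y τ ^ 2 := rfl
    rw [h4]
    generalize |τ| ^ (1 / q - 1) = z
    field_simp
    simp
    ring
  have hHc : ContinuousOn (fun τ => Y τ ^ 3 / (b ^ 2 - Y τ ^ 2) * (1 / q * |τ| ^ (1 / q - 1)))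
      (uIcc (opow v q) x) := by
    refine ContinuousOn.mul (ContinuousOn.div (by fun_prop) (by fun_prop)
      fun τ hτ => (sq_sub_sq_pos (hsub hτ)).ne') (Continuous.continuousOn ?_)
    exact continuous_const.mul (continuous_abs.rpow_const fun _ => Or.inr (by linarith))
  have hFTC := intervalIntegral.integral_eq_sub_of_hasDerivAt hHd hHc.intervalIntegrable
  have hmono : (∫ τ in (opow v q)..x, Y τ ^ 3 / (b ^ 2 - Y τ ^ 2) * (1 / q * |τ| ^ (1 / q - 1)))
      ≤ ∫ τ in (opow v q)..x, (L * b ^ (1 + q)) * barrierRate b (2 - q) (opow τ (1 / q) - v) := by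
    refine intervalIntegral.integral_mono_on hle hHc.intervalIntegrable
      (ContinuousOn.intervalIntegrable (continuousOn_const.mul
        ((continuousOn_barrierRate_comp hq hq1 v).mono hsub))) fun τ hτ => ?_
    have hτ' := Icc_subset_uIcc hτ
    have h1 := sq_sub_sq_pos (hsub hτ')
    change 0 < b ^ 2 - Y τ ^ 2 at h1
    have h0 : 0 ≤ Y τ := opow_sub_nonneg hq hτ.1
    have hYb : Y τ ≤ b := (le_abs_self _).trans (show |Y τ| < b from hsub hτ').le
    have h2 : 1 / q * |τ| ^ (1 / q - 1) ≤ L := by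
      have h3 : |τ| ^ (1 / q - 1) = (|opow τ (1 / q)|) ^ (1 - q) := by
        rw [abs_opow (by linarith), ← Real.rpow_mul (abs_nonneg _)]
        congr 1; field_simp
      have h4 : |opow τ (1 / q)| ≤ |M| + b := by
        have h5 := abs_add_le (Y τ) v
        rw [show Y τ + v = opow τ (1 / q) by simp [hY]] at h5
        have : |Y τ| < b := hsub hτ'
        linarith [le_abs_self M]
      rw [h3, hL]
      have : 0 ≤ 1 - q := by linarith
      gcongr
    change _ ≤ L * b ^ (1 + q) * (opow (Y τ) (2 - q) / (b ^ 2 - Y τ ^ 2))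
    -- The exponent `3` exceeds `2 - q`, so the excess power `Y^(1+q)` is bounded by `b^(1+q)`, and
    -- the antiderivative is still elementary.
    have h5 : Y τ ^ 3 ≤ b ^ (1 + q) * opow (Y τ) (2 - q) := by
      rw [opow_of_nonneg (by linarith) h0]
      have : Y τ ^ 3 = Y τ ^ (1 + q) * Y τ ^ (2 - q) := by
        rw [← Real.rpow_add_of_nonneg h0 (by linarith) (by linarith), ← Real.rpow_natCast]
        norm_num
      rw [this]
      have : 0 ≤ 1 + q := by linarith
      gcongr
    calc Y τ ^ 3 / (b ^ 2 - Y τ ^ 2) * (1 / q * |τ| ^ (1 / q - 1))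
        ≤ Y τ ^ 3 / (b ^ 2 - Y τ ^ 2) * L := by gcongr
      _ ≤ (b ^ (1 + q) * opow (Y τ) (2 - q)) / (b ^ 2 - Y τ ^ 2) * L := by gcongr
      _ = _ := by ring
  rw [hFTC, intervalIntegral.integral_const_mul] at hmono
  have hY0 : Y (opow v q) = 0 := by simp only [hY]; rw [opow_inv_right hq.ne', sub_self]
  have hs2 := sq_sub_sq_pos hs
  change 0 < b ^ 2 - Y x ^ 2 at hs2
  have hYx : Y x ^ 2 ≤ b ^ 2 := by linarith
  -- `H` takes the value `-(b²/2) log b²` at the lower limit, and the term `Y² / 2` is estimated by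
  -- `b² / 2`.
  have hlog : Real.log (b ^ 2) - (2 * (B * (L * b ^ (1 + q))) + b ^ 2) / b ^ 2
      ≤ Real.log (b ^ 2 - Y x ^ 2) := by
    have h1 : H x - H (opow v q) ≤ L * b ^ (1 + q) * B :=
      hmono.trans (mul_le_mul_of_nonneg_left hB (by positivity))
    simp only [hH, hY0] at h1
    rw [sub_le_iff_le_add, ← sub_le_iff_le_add', le_div_iff₀ (by positivity)]
    simp only [ne_eq, OfNat.ofNat_ne_zero, not_false_eq_true, zero_pow, sub_zero, zero_div] at h1
    nlinarith
  change _ ≤ b ^ 2 - Y x ^ 2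
  rw [← Real.exp_log hs2, ← Real.exp_log (by positivity : 0 < b ^ 2), ← Real.exp_add]
  refine Real.exp_le_exp.2 ?_
  rw [Real.exp_log (by positivity : 0 < b ^ 2)]
  refine le_trans (le_of_eq ?_) hlog
  ring

end SwitchingControl

/-! ### Differentiability of the barrier integral in both variables -/

namespace SwitchingControl

/-- The partial derivative of `barrierInt b q v x` with respect to `v`, up to the sign. -/
noncomputable def barrierIntDeriv (b q v x : ℝ) : ℝ :=
  ∫ τ in (opow v q)..x, barrierRateDeriv b (2 - q) (opow τ (1 / q) - v)

/-- The integrand is at most a constant times `|s|^(1-q)` and the range has length at most `2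
|s|^q`, so one power of `|s|` remains. -/
theorem abs_barrierIntDeriv_le {b q : ℝ} (hq : 0 < q) (hq1 : q ≤ 1) {v x : ℝ}
    (hs : |opow x (1 / q) - v| < b) :
    |barrierIntDeriv b q v x| ≤
      8 * b ^ 2 * |opow x (1 / q) - v| / (b ^ 2 - (opow x (1 / q) - v) ^ 2) ^ 2 := by
  have h1 := sq_sub_sq_pos hs
  have h2 := intervalIntegral.norm_integral_le_of_norm_le_const (a := opow v q) (b := x)
    (f := fun τ => barrierRateDeriv b (2 - q) (opow τ (1 / q) - v)) fun τ hτ =>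
      abs_barrierRateDeriv_le (by linarith : 1 ≤ 2 - q) (by linarith)
        (abs_opow_sub_mono hq (uIoc_subset_uIcc hτ)) hs
  rw [Real.norm_eq_abs] at h2
  refine h2.trans ((mul_le_mul_of_nonneg_left (abs_sub_opow_le hq hq1 v x) (by positivity)).trans
    (le_of_eq ?_))
  set s := opow x (1 / q) - v
  have h3 : |s| = |s| ^ (2 - q - 1) * |s| ^ q := by
    rw [← Real.rpow_add_of_nonneg (abs_nonneg _) (by linarith) hq.le,
      show 2 - q - 1 + q = 1 by ring, Real.rpow_one]
  generalize |s| ^ (2 - q - 1) = A at *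
  generalize |s| ^ q = A' at *
  rw [h3]; ring

theorem continuousOn_barrierRateDeriv_comp {b q : ℝ} (hq : 0 < q) (hq1 : q ≤ 1) (v : ℝ) :
    ContinuousOn (fun τ => barrierRateDeriv b (2 - q) (opow τ (1 / q) - v))
      {τ | |opow τ (1 / q) - v| < b} :=
  (continuousOn_barrierRateDeriv (by linarith)).comp
    (((continuous_opow (one_div_pos.2 hq)).sub continuous_const).continuousOn) fun _ h => h

/-- Derivative of the integral with respect to the parameter, for fixed limits. -/
theorem hasDerivAt_integral_barrierRate {b q : ℝ} (hq : 0 < q) (hq1 : q ≤ 1) {v x : ℝ}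
    (hs : |opow x (1 / q) - v| < b) :
    HasDerivAt (fun w => ∫ τ in (opow v q)..x, barrierRate b (2 - q) (opow τ (1 / q) - w))
      (-barrierIntDeriv b q v x) v := by
  -- Half of the distance to the barrier: perturbing the parameter by less than `ρ` keeps the
  -- integrand's argument within `k < b`, which supplies a constant dominating function.
  set ρ : ℝ := (b - |opow x (1 / q) - v|) / 2 with hρ
  have hρ0 : 0 < ρ := by rw [hρ]; linarith
  set k : ℝ := |opow x (1 / q) - v| + ρ with hk
  have hk0 : 0 ≤ k := by rw [hk]; positivity
  have hkb : k < b := by rw [hk, hρ]; linarith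
  have hnear : ∀ τ ∈ uIoc (opow v q) x, ∀ w ∈ Metric.ball v ρ, |opow τ (1 / q) - w| ≤ |k| := by
    intro τ hτ w hw
    have h1 := abs_opow_sub_mono hq (uIoc_subset_uIcc hτ)
    have h2 : |v - w| < ρ := by rwa [Metric.mem_ball, dist_comm, Real.dist_eq] at hw
    have h3 := abs_sub_le (opow τ (1 / q)) v w
    rw [abs_of_nonneg hk0]; linarith
  have hcont : ∀ w ∈ Metric.ball v ρ, ContinuousOn
      (fun τ => barrierRate b (2 - q) (opow τ (1 / q) - w)) (uIoc (opow v q) x) := fun w hw =>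
    (continuousOn_barrierRate_comp hq hq1 w).mono fun τ hτ =>
      (hnear τ hτ w hw).trans_lt (by rwa [abs_of_nonneg hk0])
  have key := intervalIntegral.hasDerivAt_integral_of_dominated_loc_of_deriv_le
    (μ := MeasureTheory.volume)
    (F := fun w τ => barrierRate b (2 - q) (opow τ (1 / q) - w))
    (F' := fun w τ => -barrierRateDeriv b (2 - q) (opow τ (1 / q) - w))
    (a := opow v q) (b := x) (x₀ := v) (s := Metric.ball v ρ)
    (bound := fun _ => 4 * b ^ 2 * |k| ^ (2 - q - 1) / (b ^ 2 - k ^ 2) ^ 2)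
    (Metric.ball_mem_nhds v hρ0)
    (by
      filter_upwards [Metric.ball_mem_nhds v hρ0] with w hw
      exact (hcont w hw).aestronglyMeasurable measurableSet_uIoc)
    (((continuousOn_barrierRate_comp hq hq1 v).mono (uIcc_subset_barrier hq hs)).intervalIntegrable)
    (((continuousOn_barrierRateDeriv_comp hq hq1 v).mono
      (uIoc_subset_uIcc.trans (uIcc_subset_barrier hq hs))).neg.aestronglyMeasurable
        measurableSet_uIoc)
    (by
      refine Eventually.of_forall fun τ hτ w hw => ?_
      rw [norm_neg]
      exact abs_barrierRateDeriv_le (by linarith) (by linarith) (hnear τ hτ w hw)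
        (by rwa [abs_of_nonneg hk0]))
    intervalIntegrable_const
    (by
      refine Eventually.of_forall fun τ hτ w hw => ?_
      have h1 : HasDerivAt (fun w : ℝ => opow τ (1 / q) - w) (-1) w := by
        simpa using (hasDerivAt_id w).const_sub (opow τ (1 / q))
      have h2 := (hasDerivAt_barrierRate (b := b) (p := 2 - q) (y := opow τ (1 / q) - w)
        (by linarith) ((hnear τ hτ w hw).trans_lt (by rwa [abs_of_nonneg hk0]))).comp w h1
      exact h2.congr_deriv (by ring))
  refine key.2.congr_deriv ?_
  rw [intervalIntegral.integral_neg, barrierIntDeriv]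

/-- The barrier Lyapunov function is differentiable in both variables. -/
theorem hasFDerivAt_barrierInt {b q : ℝ} (hq : 0 < q) (hq1 : q ≤ 1) {v x : ℝ}
    (hs : |opow x (1 / q) - v| < b) :
    HasFDerivAt (fun p : ℝ × ℝ => barrierInt b q p.1 p.2)
      (barrierRate b (2 - q) (opow x (1 / q) - v) • ContinuousLinearMap.snd ℝ ℝ ℝ
        - barrierIntDeriv b q v x • ContinuousLinearMap.fst ℝ ℝ ℝ) (v, x) := by
  have hb : 0 < b := (abs_nonneg _).trans_lt hs
  have hopen : Continuous fun p : ℝ × ℝ => opow p.2 (1 / q) - p.1 :=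
    ((continuous_opow (one_div_pos.2 hq)).comp continuous_snd).sub continuous_fst
  have hev : ∀ᶠ p in 𝓝 (v, x), |opow p.2 (1 / q) - p.1| < b :=
    (hopen.abs.tendsto _).eventually (eventually_lt_nhds hs)
  have hcv : ∀ᶠ p in 𝓝 (v, x), |opow x (1 / q) - p.1| < b := by
    have : Continuous fun p : ℝ × ℝ => |opow x (1 / q) - p.1| := by fun_prop
    exact (this.tendsto (v, x)).eventually (eventually_lt_nhds hs)
  -- variation of the parameter
  have hB : HasFDerivAt (fun p : ℝ × ℝ =>
      ∫ τ in (opow v q)..x, barrierRate b (2 - q) (opow τ (1 / q) - p.1))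
      (-barrierIntDeriv b q v x • ContinuousLinearMap.fst ℝ ℝ ℝ) (v, x) := by
    have h := (hasDerivAt_integral_barrierRate hq hq1 hs).comp_hasFDerivAt_of_eq
      (x := ((v, x) : ℝ × ℝ)) (f := Prod.fst)
      (hasFDerivAt_fst (𝕜 := ℝ) (E := ℝ) (F := ℝ)) rfl
    exact h
  -- variation of the upper limit
  have hA : HasFDerivAt (fun p : ℝ × ℝ =>
      ∫ τ in x..p.2, barrierRate b (2 - q) (opow τ (1 / q) - p.1))
      (barrierRate b (2 - q) (opow x (1 / q) - v) • ContinuousLinearMap.snd ℝ ℝ ℝ) (v, x) := by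
    rw [hasFDerivAt_iff_isLittleO_nhds_zero, Asymptotics.isLittleO_iff]
    intro c hc
    set G : ℝ × ℝ → ℝ := fun p => barrierRate b (2 - q) (opow p.2 (1 / q) - p.1) with hG
    have hGc : ContinuousAt G (v, x) :=
      (hasDerivAt_barrierRate (by linarith : 1 ≤ 2 - q) hs).continuousAt.comp_of_eq
        hopen.continuousAt rfl
    have h1 : ∀ᶠ p in 𝓝 (v, x), |G p - G (v, x)| < c ∧ |opow p.2 (1 / q) - p.1| < b :=
      (Metric.tendsto_nhds.1 hGc c hc).and hev
    obtain ⟨ρ, hρ, hball⟩ := Metric.eventually_nhds_iff.1 h1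
    filter_upwards [Metric.ball_mem_nhds (0 : ℝ × ℝ) hρ] with h hh
    rw [mem_ball_zero_iff, Prod.norm_def, max_lt_iff] at hh
    have hin : ∀ τ ∈ uIcc x (x + h.2), |G (v + h.1, τ) - G (v, x)| < c ∧
        |opow τ (1 / q) - (v + h.1)| < b := fun τ hτ => by
      refine hball (y := (v + h.1, τ)) ?_
      rw [Prod.dist_eq, max_lt_iff]
      refine ⟨by simpa using hh.1, (lt_of_le_of_lt ?_ hh.2)⟩
      have := abs_sub_left_of_mem_uIcc hτ
      simpa [Real.dist_eq] using this
    have hint : IntervalIntegrable (fun τ => G (v + h.1, τ)) MeasureTheory.volume x (x + h.2) :=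
      ((continuousOn_barrierRate_comp hq hq1 (v + h.1)).mono fun τ hτ =>
        (hin τ hτ).2).intervalIntegrable
    have h2 : (∫ τ in x..(x + h.2), G (v + h.1, τ)) - G (v, x) * h.2
        = ∫ τ in x..(x + h.2), (G (v + h.1, τ) - G (v, x)) := by
      rw [intervalIntegral.integral_sub hint intervalIntegrable_const,
        intervalIntegral.integral_const]
      simp [mul_comm]
    have h3 := intervalIntegral.norm_integral_le_of_norm_le_const (a := x) (b := x + h.2)
      (f := fun τ => G (v + h.1, τ) - G (v, x)) (C := c) fun τ hτ =>
        (hin τ (uIoc_subset_uIcc hτ)).1.le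
    rw [← h2] at h3
    simp only [Prod.fst_add, Prod.snd_add, intervalIntegral.integral_same, sub_zero]
    refine le_trans (le_of_eq ?_) (h3.trans ?_)
    · simp [hG]
    · rw [add_sub_cancel_left]
      gcongr
      exact norm_snd_le h
  -- variation of the lower limit
  have hC : HasFDerivAt (fun p : ℝ × ℝ =>
      ∫ τ in (opow p.1 q)..(opow v q), barrierRate b (2 - q) (opow τ (1 / q) - p.1))
      (0 : ℝ × ℝ →L[ℝ] ℝ) (v, x) := by
    rw [hasFDerivAt_iff_isLittleO_nhds_zero, Asymptotics.isLittleO_iff]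
    intro c hc
    -- This piece is a barrier integral with error `-h.1`, hence at most `2 h.1² / (b² - h.1²)`. It
    -- is of second order although `opow · q` need not be differentiable at zero. The bound `b/2`
    -- keeps the denominator above `3b²/4`, and `c b²/4` turns the quadratic bound into `c |h.1|`.
    set ρ : ℝ := min (b / 2) (c * b ^ 2 / 4) with hρ
    have hρ0 : 0 < ρ := by positivity
    filter_upwards [Metric.ball_mem_nhds (0 : ℝ × ℝ) hρ0] with h hh
    rw [mem_ball_zero_iff, Prod.norm_def, max_lt_iff, hρ, lt_min_iff, Real.norm_eq_abs] at hh
    have hs' : |opow (opow v q) (1 / q) - (v + h.1)| < b := by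
      rw [opow_inv_right hq.ne', sub_add_cancel_left, abs_neg]; linarith
    have h1 := abs_barrierInt_le hq hq1 hs'
    rw [opow_inv_right hq.ne', sub_add_cancel_left, neg_sq] at h1
    simp only [intervalIntegral.integral_same, sub_zero,
      zero_apply]
    refine h1.trans ?_
    have h2 : h.1 ^ 2 ≤ b ^ 2 / 4 := by
      rw [← sq_abs]; nlinarith [abs_nonneg h.1]
    have h3 : 2 * h.1 ^ 2 / (b ^ 2 - h.1 ^ 2) ≤ c * |h.1| := by
      rw [div_le_iff₀ (by nlinarith), ← sq_abs]
      rw [← sq_abs] at h2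
      nlinarith [abs_nonneg h.1, mul_nonneg hc.le (abs_nonneg h.1)]
    exact h3.trans (by gcongr; exact norm_fst_le h)
  -- The barrier integral near `(v, x)` splits at `opow v q` and at `x` into these three pieces, all
  -- with the perturbed parameter in the integrand.
  have hsum := (hB.add hA).add hC
  refine (hsum.congr_of_eventuallyEq ?_).congr_fderiv (by
    ext <;> simp)
  have hcv2 : ∀ᶠ p in 𝓝 (v, x), |opow (opow v q) (1 / q) - p.1| < b := by
    have : Continuous fun p : ℝ × ℝ => |opow (opow v q) (1 / q) - p.1| := by fun_prop
    refine (this.tendsto (v, x)).eventually (eventually_lt_nhds ?_)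
    rw [opow_inv_right hq.ne', sub_self, abs_zero]
    exact hb
  filter_upwards [hev, hcv, hcv2] with p hp1 hp2 hp3
  have hint : ∀ y, |opow y (1 / q) - p.1| < b → IntervalIntegrable
      (fun τ => barrierRate b (2 - q) (opow τ (1 / q) - p.1)) MeasureTheory.volume
        (opow p.1 q) y := fun y hy =>
    ((continuousOn_barrierRate_comp hq hq1 p.1).mono (uIcc_subset_barrier hq hy)).intervalIntegrable
  have e1 := intervalIntegral.integral_add_adjacent_intervals
    ((hint _ hp3).symm.trans (hint _ hp2)) ((hint _ hp2).symm.trans (hint _ hp1))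
  have e2 := intervalIntegral.integral_add_adjacent_intervals
    (hint _ hp3) ((hint _ hp3).symm.trans (hint _ hp1))
  simp only [Pi.add_apply]
  rw [barrierInt, e1, add_comm, e2]

theorem hasDerivWithinAt_barrierInt {b q : ℝ} (hq : 0 < q) (hq1 : q ≤ 1) {v x : ℝ → ℝ}
    {s : Set ℝ} {t v' x' : ℝ} (hs : |opow (x t) (1 / q) - v t| < b)
    (hv : HasDerivWithinAt v v' s t) (hx : HasDerivWithinAt x x' s t) :
    HasDerivWithinAt (fun r => barrierInt b q (v r) (x r))
      (barrierRate b (2 - q) (opow (x t) (1 / q) - v t) * x'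
        - barrierIntDeriv b q (v t) (x t) * v') s t := by
  have h := (hasFDerivAt_barrierInt hq hq1 hs).comp_hasDerivWithinAt_of_eq t (hv.prodMk hx) rfl
  exact h.congr_deriv (by simp)

theorem continuousAt_barrierInt {b q : ℝ} (hq : 0 < q) (hq1 : q ≤ 1) {v x : ℝ}
    (hs : |opow x (1 / q) - v| < b) :
    ContinuousAt (fun p : ℝ × ℝ => barrierInt b q p.1 p.2) (v, x) :=
  (hasFDerivAt_barrierInt hq hq1 hs).continuousAt

/-- For `q = 1` and `v = 0` the barrier Lyapunov function is the logarithmic one. -/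
theorem barrierInt_one_zero {b x : ℝ} (hx : |x| < b) :
    barrierInt b 1 0 x = 1 / 2 * Real.log (b ^ 2 / (b ^ 2 - x ^ 2)) := by
  have hb : 0 < b := (abs_nonneg _).trans_lt hx
  have hsub : ∀ τ ∈ uIcc 0 x, 0 < b ^ 2 - τ ^ 2 := fun τ hτ => by
    have := abs_sub_left_of_mem_uIcc hτ
    exact sq_sub_sq_pos ((by simpa using this : |τ| ≤ |x|).trans_lt hx)
  have hd : ∀ τ ∈ uIcc 0 x, HasDerivAt (fun τ : ℝ => -(1 / 2) * Real.log (b ^ 2 - τ ^ 2))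
      (τ / (b ^ 2 - τ ^ 2)) τ := fun τ hτ => by
    have h1 := hsub τ hτ
    have h2 : HasDerivAt (fun y : ℝ => b ^ 2 - y ^ 2) (-(2 * τ)) τ := by
      simpa using (hasDerivAt_pow 2 τ).const_sub (b ^ 2)
    refine ((h2.log h1.ne').const_mul (-(1 / 2))).congr_deriv ?_
    field_simp
  have hc : ContinuousOn (fun τ : ℝ => τ / (b ^ 2 - τ ^ 2)) (uIcc 0 x) :=
    continuousOn_id.div (by fun_prop) fun τ hτ => (hsub τ hτ).ne'
  have := intervalIntegral.integral_eq_sub_of_hasDerivAt hd hc.intervalIntegrable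
  have h1 := sq_sub_sq_pos hx
  rw [barrierInt, opow_zero_left, Real.log_div (by positivity) h1.ne']
  simp only [barrierRate, div_one, opow_one, sub_zero, show (2 : ℝ) - 1 = 1 by norm_num]
  rw [this]
  norm_num
  ring

end SwitchingControl

/-! ### Domination by a large gain -/

namespace SwitchingControl

/-- Young's inequality with a prescribed small coefficient. -/
theorem exists_rpow_mul_rpow_le {ρ : ℝ} (hρ : 0 < ρ) (hρ1 : ρ < 1) (C : ℝ) {δ : ℝ} (hδ : 0 < δ) :
    ∃ A, 0 ≤ A ∧ ∀ Z X : ℝ, 0 ≤ Z → 0 ≤ X → C * (Z ^ ρ * X ^ (1 - ρ)) ≤ A * Z + δ * X := by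
  -- Weighted AM-GM for `A Z` and `δ X` has the coefficient `A^ρ δ^(1-ρ)`; this `A` makes it equal
  -- to `|C|`.
  refine ⟨(|C| / δ ^ (1 - ρ)) ^ (1 / ρ), by positivity, fun Z X hZ hX => ?_⟩
  set A : ℝ := (|C| / δ ^ (1 - ρ)) ^ (1 / ρ)
  have hA : 0 ≤ A := by positivity
  have h1 := Real.geom_mean_le_arith_mean2_weighted hρ.le (by linarith : 0 ≤ 1 - ρ)
    (mul_nonneg hA hZ) (mul_nonneg hδ.le hX) (by ring)
  have h2 : A ^ ρ * δ ^ (1 - ρ) = |C| := by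
    have : A ^ ρ = |C| / δ ^ (1 - ρ) := by
      rw [← Real.rpow_mul (by positivity), one_div_mul_cancel hρ.ne', Real.rpow_one]
    rw [this, div_mul_cancel₀ _ (Real.rpow_pos_of_pos hδ _).ne']
  rw [Real.mul_rpow hA hZ, Real.mul_rpow hδ.le hX] at h1
  have h3 : A ^ ρ * Z ^ ρ * (δ ^ (1 - ρ) * X ^ (1 - ρ)) = |C| * (Z ^ ρ * X ^ (1 - ρ)) := by
    rw [← h2]; ring
  rw [h3] at h1
  have h4 : C * (Z ^ ρ * X ^ (1 - ρ)) ≤ |C| * (Z ^ ρ * X ^ (1 - ρ)) :=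
    mul_le_mul_of_nonneg_right (le_abs_self C) (by positivity)
  have h5 : 0 ≤ A * Z := by positivity
  have h6 : 0 ≤ δ * X := by positivity
  nlinarith

/-- Since `B w ≥ 1`, raising the exponent only enlarges `(B w)^e`. With `w = 1 / (b² - s²)` and `B =
b²` this brings all powers of `w` to a common exponent. -/
theorem rpow_le_mul_rpow {w B e₁ e₂ : ℝ} (hB : 0 < B) (hw : 1 / B ≤ w) (he : e₁ ≤ e₂) :
    w ^ e₁ ≤ B ^ (e₂ - e₁) * w ^ e₂ := by
  have hw0 : 0 < w := (one_div_pos.2 hB).trans_le hw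
  have h1 : 1 ≤ B * w := by rwa [div_le_iff₀' hB] at hw
  have h2 : B ^ (e₂ - e₁) * w ^ e₂ = (B * w) ^ (e₂ - e₁) * w ^ e₁ := by
    rw [Real.mul_rpow hB.le hw0.le, mul_assoc, ← Real.rpow_add hw0, sub_add_cancel]
  rw [h2]
  exact le_mul_of_one_le_left (by positivity) (Real.one_le_rpow h1 (by linarith))

set_option maxHeartbeats 600000 in
/-- A sufficiently large gain of the right sign dominates all other terms in the derivative of the
barrier Lyapunov function of a channel. -/
theorem exists_gain_domination {α q b a Q U K c ζ : ℝ} (hα : 0 < α) (hq1 : q ≤ 1)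
    (hq' : 0 < q + α - 1) (hb : 0 < b) (ha : 0 < a) (hU : 0 < U)
    (hK : 0 < K) (hc : 0 < c) (hζ : 0 < ζ) (H F M : ℝ) :
    ∃ A : ℝ, 0 < A ∧ ∀ γ h f s z Δ V d v' : ℝ, A ≤ γ * h → |h| ≤ H → |f| ≤ F → |v'| ≤ M → |s| < b →
      |Δ| ≤ 2 * |z| ^ (q + α - 1) → 0 ≤ V → V ≤ 2 * s ^ 2 / (b ^ 2 - s ^ 2) →
      |d| ≤ 8 * b ^ 2 * |s| / (b ^ 2 - s ^ 2) ^ 2 →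
      barrierRate b (2 - q) s * (h * (γ * (-K * opow s (q + α - 1)
        - U * opow s (q + α - 1) / (b ^ 2 - s ^ 2) ^ (1 + 2 * α)) + Δ) + f) - d * v'
      ≤ -a * V ^ ((1 + α) / 2) - Q * |s| ^ (1 + α) + c * |z| ^ (1 + α) + ζ / 2 := by
  have h1α : 0 < 1 + α := by linarith
  -- The rate is of order `|s|^(2-q)` and the tracking error of order `|z|^(q+α-1)`. The exponents
  -- add up to `1 + α`, so `ρ` and `1 - ρ` are the conjugate weights in Young's inequality.
  set ρ : ℝ := (2 - q) / (1 + α) with hρ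
  have hρ0 : 0 < ρ := div_pos (by linarith) h1α
  have hρ1 : ρ < 1 := (div_lt_one h1α).2 (by linarith)
  have hρ' : (1 + α) * (1 - ρ) = q + α - 1 := by rw [hρ]; field_simp; ring
  have hρ2 : (1 + α) * ρ = 2 - q := by rw [hρ]; field_simp
  set C₀ : ℝ := (b ^ 2) ^ (2 * (2 - q) - 1) with hC₀
  have hC₀p : 0 < C₀ := by positivity
  obtain ⟨A₁, hA₁, hY₁⟩ := exists_rpow_mul_rpow_le hρ0 hρ1 (C₀ * |H| * 2) hc
  obtain ⟨A₂, hA₂, hY₂⟩ := exists_rpow_mul_rpow_le hρ0 hρ1 (C₀ * |F|)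
    (by linarith : 0 < ζ / 4)
  -- The terms with `f` and `v'` do not involve `z`, so Young's inequality is used with `X = 1` and
  -- each leaves `ζ/4`. The weight here is `1 / (1 + α)` because `|s| w²` is that power of the
  -- quantity `Z` below.
  obtain ⟨A₃, hA₃, hY₃⟩ := exists_rpow_mul_rpow_le (one_div_pos.2 h1α)
    ((div_lt_one h1α).2 (by linarith)) (8 * b ^ 2 * |M|) (by linarith : 0 < ζ / 4)
  set A₄ : ℝ := a * 2 ^ ((1 + α) / 2) * (b ^ 2) ^ ((2 + 2 * α) - (1 + α) / 2) with hA₄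
  set A₅ : ℝ := |Q| * (b ^ 2) ^ ((2 + 2 * α) - 0) with hA₅
  have hA₄p : 0 < A₄ := by positivity
  have hA₅p : 0 ≤ A₅ := by positivity
  -- The gain has to pay for the tracking error, `f`, `v'`, the power of `V` and the `Q` term.
  refine ⟨(A₁ + A₂ + A₃ + A₄ + A₅) / U, by positivity, ?_⟩
  intro γ h f s z Δ V d v' hγ hh hf hv hs hΔ hV0 hV hd
  have hpos := sq_sub_sq_pos hs
  set w : ℝ := 1 / (b ^ 2 - s ^ 2) with hw
  have hw0 : 0 < w := by positivity
  have hwb : 1 / b ^ 2 ≤ w := by rw [hw]; gcongr; nlinarith [sq_nonneg s]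
  have hb2 : 0 < b ^ 2 := by positivity
  -- All terms are measured against `Z`, the amount produced by the `U` part of the control law.
  set Z : ℝ := |s| ^ (1 + α) * w ^ (2 + 2 * α) with hZ
  have hZ0 : 0 ≤ Z := by positivity
  set X : ℝ := |z| ^ (1 + α) with hX
  have hX0 : 0 ≤ X := by positivity
  clear_value w Z X C₀ A₄ A₅ ρ
  replace hh := hh.trans (le_abs_self _)
  replace hf := hf.trans (le_abs_self _)
  replace hv := hv.trans (le_abs_self _)
  have hH0 := abs_nonneg H
  have hF0 := abs_nonneg F
  have hM0 := abs_nonneg M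
  generalize |H| = H at *
  generalize |F| = F at *
  generalize |M| = M at *
  have hs0 := abs_nonneg s
  have hsα : 0 ≤ |s| ^ (1 + α) := by positivity
  -- the rate
  have hZρ : Z ^ ρ = |s| ^ (2 - q) * w ^ (2 * (2 - q)) := by
    rw [hZ, Real.mul_rpow hsα (by positivity), ← Real.rpow_mul hs0, ← Real.rpow_mul hw0.le,
      show (2 + 2 * α) * ρ = 2 * ((1 + α) * ρ) by ring, hρ2]
  have hgabs : |barrierRate b (2 - q) s| ≤ C₀ * Z ^ ρ := by
    have h1 := abs_barrierRate_le (p := 2 - q) (by linarith) le_rfl hs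
    have h2 := rpow_le_mul_rpow hb2 hwb (by linarith : (1 : ℝ) ≤ 2 * (2 - q))
    rw [Real.rpow_one, ← hC₀] at h2
    calc _ ≤ |s| ^ (2 - q) / (b ^ 2 - s ^ 2) := h1
      _ = |s| ^ (2 - q) * w := by rw [hw]; ring
      _ ≤ |s| ^ (2 - q) * (C₀ * w ^ (2 * (2 - q))) := by gcongr
      _ = _ := by rw [hZρ]; ring
  have hXρ : X ^ (1 - ρ) = |z| ^ (q + α - 1) := by
    rw [hX, ← Real.rpow_mul (abs_nonneg _), hρ']
  -- the control term
  have hmain : barrierRate b (2 - q) s * (h * (γ * (-K * opow s (q + α - 1)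
        - U * opow s (q + α - 1) / (b ^ 2 - s ^ 2) ^ (1 + 2 * α))))
      ≤ -((A₁ + A₂ + A₃ + A₄ + A₅) * Z) := by
    have h1 : opow s (2 - q) * opow s (q + α - 1) = |s| ^ (1 + α) := by
      rw [opow_mul_opow s (by linarith), show 2 - q + (q + α - 1) = 1 + α by ring]
    have h2 : 1 / (b ^ 2 - s ^ 2) ^ (1 + 2 * α) = w ^ (1 + 2 * α) := by
      rw [hw, Real.div_rpow zero_le_one hpos.le, Real.one_rpow]
    have h3 : w * w ^ (1 + 2 * α) = w ^ (2 + 2 * α) := by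
      have := Real.rpow_add hw0 1 (1 + 2 * α)
      rw [Real.rpow_one] at this
      rw [← this]
      congr 1; ring
    have h4 : barrierRate b (2 - q) s * (h * (γ * (-K * opow s (q + α - 1)
        - U * opow s (q + α - 1) / (b ^ 2 - s ^ 2) ^ (1 + 2 * α))))
        = -(γ * h) * (K * (|s| ^ (1 + α) * w) + U * Z) := by
      rw [hZ, ← h3, ← h2, ← h1, barrierRate, hw]; ring
    rw [h4]
    have h5 : A₁ + A₂ + A₃ + A₄ + A₅ ≤ γ * h * U := by rwa [div_le_iff₀ hU] at hγ
    have h6 : 0 ≤ γ * h := le_trans (by positivity) hγ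
    have h7 : 0 ≤ γ * h * (K * (|s| ^ (1 + α) * w)) := by positivity
    have h8 := mul_le_mul_of_nonneg_right h5 hZ0
    linarith
  -- the other terms
  have h1 : barrierRate b (2 - q) s * (h * Δ) ≤ A₁ * Z + c * X := by
    refine le_trans ?_ (hY₁ Z X hZ0 hX0)
    rw [hXρ]
    calc _ ≤ |barrierRate b (2 - q) s * (h * Δ)| := le_abs_self _
      _ = |barrierRate b (2 - q) s| * (|h| * |Δ|) := by rw [abs_mul, abs_mul]
      _ ≤ (C₀ * Z ^ ρ) * (H * (2 * |z| ^ (q + α - 1))) := by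
        gcongr
      _ = _ := by ring
  have h2 : barrierRate b (2 - q) s * f ≤ A₂ * Z + ζ / 4 := by
    have := hY₂ Z 1 hZ0 zero_le_one
    rw [Real.one_rpow, mul_one, mul_one] at this
    refine le_trans ?_ this
    calc _ ≤ |barrierRate b (2 - q) s * f| := le_abs_self _
      _ = |barrierRate b (2 - q) s| * |f| := by rw [abs_mul]
      _ ≤ (C₀ * Z ^ ρ) * F := by gcongr
      _ = _ := by ring
  have h3 : -(d * v') ≤ A₃ * Z + ζ / 4 := by
    have := hY₃ Z 1 hZ0 zero_le_one
    rw [Real.one_rpow, mul_one, mul_one] at this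
    refine le_trans ?_ this
    have hZα : Z ^ (1 / (1 + α)) = |s| * w ^ 2 := by
      rw [hZ, Real.mul_rpow hsα (by positivity), ← Real.rpow_mul hs0, ← Real.rpow_mul hw0.le,
        mul_one_div_cancel h1α.ne', Real.rpow_one,
        show (2 + 2 * α) * (1 / (1 + α)) = 2 by field_simp, Real.rpow_two]
    calc _ ≤ |d * v'| := neg_le_abs _
      _ = |d| * |v'| := abs_mul _ _
      _ ≤ (8 * b ^ 2 * |s| / (b ^ 2 - s ^ 2) ^ 2) * M := by gcongr
      _ = _ := by rw [hZα, hw]; field_simp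
  have h4 : a * V ^ ((1 + α) / 2) ≤ A₄ * Z := by
    have e1 : V ≤ 2 * (s ^ 2 * w) := hV.trans (le_of_eq (by rw [hw]; ring))
    have e2 : V ^ ((1 + α) / 2) ≤ 2 ^ ((1 + α) / 2) * (|s| ^ (1 + α) * w ^ ((1 + α) / 2)) := by
      refine (Real.rpow_le_rpow hV0 e1 (by positivity)).trans (le_of_eq ?_)
      rw [Real.mul_rpow (by norm_num) (by positivity), Real.mul_rpow (by positivity) hw0.le,
        ← sq_abs, ← Real.rpow_natCast |s| 2, ← Real.rpow_mul hs0]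
      congr 3; push_cast; ring_nf
    have e3 := rpow_le_mul_rpow hb2 hwb (by linarith : (1 + α) / 2 ≤ 2 + 2 * α)
    calc _ ≤ a * (2 ^ ((1 + α) / 2) * (|s| ^ (1 + α) * w ^ ((1 + α) / 2))) := by gcongr
      _ ≤ a * (2 ^ ((1 + α) / 2) * (|s| ^ (1 + α) *
          ((b ^ 2) ^ ((2 + 2 * α) - (1 + α) / 2) * w ^ (2 + 2 * α)))) := by gcongr
      _ = _ := by rw [hA₄, hZ]; ring
  have h5 : Q * |s| ^ (1 + α) ≤ A₅ * Z := by
    have e3 := rpow_le_mul_rpow hb2 hwb (by linarith : (0 : ℝ) ≤ 2 + 2 * α)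
    rw [Real.rpow_zero] at e3
    calc _ ≤ |Q| * |s| ^ (1 + α) * 1 := by rw [mul_one]; gcongr; exact le_abs_self _
      _ ≤ |Q| * |s| ^ (1 + α) * ((b ^ 2) ^ ((2 + 2 * α) - 0) * w ^ (2 + 2 * α)) := by gcongr
      _ = _ := by rw [hA₅, hZ]; ring
  have hsplit : ∀ G L : ℝ, G * (h * (L + Δ) + f) - d * v'
      = G * (h * L) + G * (h * Δ) + G * f + -(d * v') := fun G L => by ring
  rw [hsplit]
  linarith

end SwitchingControl

/-! ### Peano's existence theorem -/

namespace SwitchingControl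

section Peano
variable {E : Type*} [NormedAddCommGroup E] [NormedSpace ℝ E]

/-- The iterates of the integral operator with delay `ε`. -/
noncomputable def delayIter (G : E → E) (x₀ : E) (ε : ℝ) : ℕ → ℝ → E
  | 0 => fun _ => x₀
  | m + 1 => fun t => x₀ + ∫ s in (0 : ℝ)..t, G (delayIter G x₀ ε m (max (s - ε) 0))

theorem continuous_delayIter [CompleteSpace E] {G : E → E} (hG : Continuous G) (x₀ : E) (ε : ℝ)
    (m : ℕ) : Continuous (delayIter G x₀ ε m) := by
  induction m with
  | zero => exact continuous_const
  | succ m ih =>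
    refine continuous_const.add (intervalIntegral.continuous_primitive (fun a b => ?_) 0)
    exact Continuous.intervalIntegrable (by fun_prop) _ _

theorem delayIter_lipschitz [CompleteSpace E] {G : E → E} (hG : Continuous G) {M : ℝ}
    (hM : ∀ x, ‖G x‖ ≤ M) (x₀ : E) (ε : ℝ) (m : ℕ) (t t' : ℝ) :
    ‖delayIter G x₀ ε m t - delayIter G x₀ ε m t'‖ ≤ M * |t - t'| := by
  have hM0 : 0 ≤ M := (norm_nonneg _).trans (hM x₀)
  cases m with
  | zero => simp only [delayIter, sub_self, norm_zero]; positivity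
  | succ m =>
    have hc : Continuous fun s => G (delayIter G x₀ ε m (max (s - ε) 0)) := by
      have := continuous_delayIter hG x₀ ε m
      fun_prop
    simp only [delayIter]
    rw [add_sub_add_left_eq_sub, intervalIntegral.integral_interval_sub_left
      (hc.intervalIntegrable _ _) (hc.intervalIntegrable _ _)]
    exact intervalIntegral.norm_integral_le_of_norm_le_const fun _ _ => hM _

/-- The value at `t` uses the preceding iterate only up to `max (t - ε) 0`, so each iteration makes
the next interval of length `ε` final. -/
theorem delayIter_succ_eq (G : E → E) (x₀ : E) {ε : ℝ} (hε : 0 < ε) (m : ℕ) :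
    ∀ t ∈ Icc 0 (m * ε), delayIter G x₀ ε (m + 1) t = delayIter G x₀ ε m t := by
  induction m with
  | zero =>
    intro t ht
    simp only [Nat.cast_zero, zero_mul, Icc_self, mem_singleton_iff] at ht
    simp [delayIter, ht]
  | succ m ih =>
    intro t ht
    rw [delayIter, delayIter]
    refine congrArg (x₀ + ·) (intervalIntegral.integral_congr fun s hs => ?_)
    rw [uIcc_of_le ht.1] at hs
    have h1 : max (s - ε) 0 ∈ Icc 0 (m * ε) := by
      refine ⟨le_max_right _ _, max_le ?_ (by positivity)⟩
      have := hs.2.trans ht.2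
      push_cast at this
      linarith
    exact congrArg G (ih _ h1)

theorem exists_delay_solution [CompleteSpace E] {G : E → E} (hG : Continuous G) {M : ℝ}
    (hM : ∀ x, ‖G x‖ ≤ M) (x₀ : E) {ε : ℝ} (hε : 0 < ε) :
    ∃ u : ℝ → E, (∀ t t', ‖u t - u t'‖ ≤ M * |t - t'|) ∧
      ∀ t ∈ Icc (0 : ℝ) 1, u t = x₀ + ∫ s in (0 : ℝ)..t, G (u (max (s - ε) 0)) := by
  -- After `N ≥ 1 / ε` iterations the values on `[0, 1]` no longer change, which makes the iterate
  -- an exact solution of the delayed equation.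
  obtain ⟨N, hN⟩ := exists_nat_ge (1 / ε)
  rw [div_le_iff₀ hε] at hN
  refine ⟨delayIter G x₀ ε N, delayIter_lipschitz hG hM x₀ ε N, fun t ht => ?_⟩
  rw [← delayIter_succ_eq G x₀ hε N t ⟨ht.1, ht.2.trans hN⟩]
  rfl

/-- The solutions with delay `1 / (k + 1)` share the Lipschitz constant `M` and stay in a fixed ball
on `[0, 1]`. Arzelà-Ascoli yields a uniformly convergent subsequence, and dominated convergence
passes to the limit in the integral equation. -/
theorem exists_integral_solution [FiniteDimensional ℝ E] {G : E → E} (hG : Continuous G) {M : ℝ}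
    (hM : ∀ x, ‖G x‖ ≤ M) (x₀ : E) :
    ∃ u : ℝ → E, Continuous u ∧
      ∀ t ∈ Icc (0 : ℝ) 1, u t = x₀ + ∫ s in (0 : ℝ)..t, G (u s) := by
  have : CompleteSpace E := FiniteDimensional.complete ℝ E
  have : ProperSpace E := FiniteDimensional.proper ℝ E
  have hM0 : 0 ≤ M := (norm_nonneg _).trans (hM x₀)
  have hpos : ∀ k : ℕ, (0 : ℝ) < 1 / (k + 1) := fun k => Nat.one_div_pos_of_nat
  choose u hlip hu using fun k : ℕ => exists_delay_solution hG hM x₀ (hpos k)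
  have hucont : ∀ k, Continuous (u k) := fun k => by
    have : LipschitzWith (Real.toNNReal M) (u k) := LipschitzWith.of_dist_le_mul fun s t => by
      rw [dist_eq_norm, Real.dist_eq, Real.coe_toNNReal _ hM0]; exact hlip k s t
    exact this.continuous
  let I : Set ℝ := Icc (0 : ℝ) 1
  let A : Set (BoundedContinuousFunction I E) :=
    {f | ∀ s t : I, ‖f s - f t‖ ≤ M * |(s : ℝ) - t| ∧ f s ∈ Metric.closedBall x₀ M}
  have heval : ∀ s : I, Continuous fun f : BoundedContinuousFunction I E => f s := fun s =>
    continuous_eval_const s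
  have hAcl : IsClosed A := by
    simp only [A, ofPred_forall, ofPred_and]
    refine isClosed_iInter fun s => isClosed_iInter fun t => IsClosed.inter ?_ ?_
    · exact isClosed_le (((heval s).sub (heval t)).norm) continuous_const
    · exact Metric.isClosed_closedBall.preimage (heval s)
  have hAc : IsCompact A := by
    refine BoundedContinuousFunction.arzela_ascoli₂ _ (isCompact_closedBall x₀ M) A hAcl
      (fun f x hf => (hf x x).2) ?_
    have : ∀ f : A, LipschitzWith (Real.toNNReal M) ((f : BoundedContinuousFunction I E) : I → E) :=
      fun f => LipschitzWith.of_dist_le_mul fun s t => by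
        rw [dist_eq_norm, Real.coe_toNNReal _ hM0]; exact (f.2 s t).1
    exact (LipschitzWith.uniformEquicontinuous _ _ this).equicontinuous
  let f : ℕ → BoundedContinuousFunction I E := fun k =>
    BoundedContinuousFunction.mkOfCompact ⟨fun s => u k s, (hucont k).comp continuous_subtype_val⟩
  have hfA : ∀ k, f k ∈ A := fun k s t => by
    refine ⟨hlip k s t, ?_⟩
    change u k s ∈ _
    have h0 := hu k 0 ⟨le_rfl, zero_le_one⟩
    rw [intervalIntegral.integral_same, add_zero] at h0
    rw [mem_closedBall_iff_norm, ← h0]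
    refine (hlip k s 0).trans (mul_le_of_le_one_right hM0 ?_)
    rw [sub_zero, abs_of_nonneg s.2.1]; exact s.2.2
  obtain ⟨g, -, φ, hφ, hg⟩ := hAc.tendsto_subseq hfA
  have hgpt : ∀ s (hs : s ∈ I), Tendsto (fun k => u (φ k) s) atTop (𝓝 (g ⟨s, hs⟩)) := fun s hs =>
    ((heval ⟨s, hs⟩).tendsto g).comp hg
  have hε : Tendsto (fun k : ℕ => (1 : ℝ) / ((φ k : ℝ) + 1)) atTop (𝓝 0) :=
    tendsto_one_div_add_atTop_nhds_zero_nat.comp hφ.tendsto_atTop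
  -- The delay shifts the argument by at most `1 / (φ k + 1)`, which the common Lipschitz constant
  -- makes negligible.
  have hshift : ∀ s (hs : s ∈ I), Tendsto
      (fun k => u (φ k) (max (s - 1 / ((φ k : ℝ) + 1)) 0)) atTop (𝓝 (g ⟨s, hs⟩)) := by
    intro s hs
    have h1 : Tendsto (fun k => u (φ k) (max (s - 1 / ((φ k : ℝ) + 1)) 0) - u (φ k) s) atTop
        (𝓝 0) := by
      refine squeeze_zero_norm (fun k => ?_) (by simpa using hε.const_mul M)
      refine (hlip (φ k) _ s).trans (mul_le_mul_of_nonneg_left ?_ hM0)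
      have := hpos (φ k)
      have hs0 := hs.1
      rw [abs_sub_comm, abs_of_nonneg (by rw [sub_nonneg]; exact max_le (by linarith) hs0)]
      rw [← one_div]
      exact sub_le_comm.1 (le_max_left _ _)
    simpa using h1.add (hgpt s hs)
  refine ⟨fun t => g (projIcc 0 1 zero_le_one t), g.continuous.comp continuous_projIcc, ?_⟩
  intro t ht
  have hlim := hgpt t ht
  have hint : Tendsto (fun k => ∫ s in (0 : ℝ)..t,
      G (u (φ k) (max (s - 1 / ((φ k : ℝ) + 1)) 0))) atTop
      (𝓝 (∫ s in (0 : ℝ)..t, G (g (projIcc 0 1 zero_le_one s)))) := by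
    refine intervalIntegral.tendsto_integral_filter_of_dominated_convergence (fun _ => M) ?_ ?_
      intervalIntegrable_const ?_
    · refine Eventually.of_forall fun k => Continuous.aestronglyMeasurable ?_
      have := hucont (φ k)
      fun_prop
    · exact Eventually.of_forall fun k => Eventually.of_forall fun s _ => hM _
    · refine Eventually.of_forall fun s hs => ?_
      rw [uIoc_of_le ht.1] at hs
      have hsI : s ∈ I := ⟨hs.1.le, hs.2.trans ht.2⟩
      rw [projIcc_of_mem zero_le_one hsI]
      exact (hG.tendsto _).comp (hshift s hsI)
  have h2 := tendsto_nhds_unique hlim ((tendsto_const_nhds.add hint).congr fun k =>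
    (hu (φ k) t ht).symm)
  rw [← h2]
  simp only [projIcc_of_mem zero_le_one ht]

/-- Peano's theorem for an autonomous system. -/
theorem exists_local_solution [FiniteDimensional ℝ E] {F : E → E} {x₀ : E}
    (hF : ∀ᶠ x in 𝓝 x₀, ContinuousAt F x) (t₀ : ℝ) :
    ∃ δ > 0, ∃ y : ℝ → E, y t₀ = x₀ ∧ Continuous y ∧
      ∀ r ∈ Ico t₀ (t₀ + δ), HasDerivWithinAt y (F (y r)) (Ici r) r := by
  have : ProperSpace E := FiniteDimensional.proper ℝ E
  obtain ⟨R, hR, hball⟩ := Metric.eventually_nhds_iff_ball.1 hF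
  set ρ : ℝ := R / 2 with hρ
  have hρ0 : 0 < ρ := by positivity
  have hsub : Metric.closedBall x₀ ρ ⊆ Metric.ball x₀ R :=
    Metric.closedBall_subset_ball (by linarith)
  -- Radial retraction onto the closed ball: composed with it, the field is bounded and continuous
  -- on the whole space and unchanged near `x₀`.
  let p : E → E := fun x => x₀ + (ρ / max ρ ‖x - x₀‖) • (x - x₀)
  have hmax : ∀ x, 0 < max ρ ‖x - x₀‖ := fun x => hρ0.trans_le (le_max_left _ _)
  have hpc : Continuous p := by
    refine continuous_const.add (Continuous.smul (continuous_const.div (by fun_prop)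
      fun x => (hmax x).ne') (by fun_prop))
  have hpm : ∀ x, p x ∈ Metric.closedBall x₀ ρ := fun x => by
    rw [mem_closedBall_iff_norm, add_sub_cancel_left, norm_smul, Real.norm_of_nonneg
      (div_nonneg hρ0.le (hmax x).le), div_mul_eq_mul_div, div_le_iff₀ (hmax x)]
    exact mul_le_mul_of_nonneg_left (le_max_right _ _) hρ0.le
  have hpi : ∀ x ∈ Metric.closedBall x₀ ρ, p x = x := fun x hx => by
    rw [mem_closedBall_iff_norm] at hx
    simp only [p]
    rw [max_eq_left hx, div_self hρ0.ne', one_smul, add_sub_cancel]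
  set G : E → E := fun x => F (p x) with hGdef
  have hG : Continuous G := continuous_iff_continuousAt.2 fun x =>
    (hball _ (hsub (hpm x))).comp_of_eq hpc.continuousAt rfl
  obtain ⟨M, hM⟩ := (isCompact_closedBall x₀ ρ).exists_bound_of_continuousOn
    (f := F) fun x hx => (hball x (hsub hx)).continuousWithinAt
  obtain ⟨u, huc, hu⟩ := exists_integral_solution hG (fun x => hM _ (hpm x)) x₀
  have hu0 : u 0 = x₀ := by
    rw [hu 0 ⟨le_rfl, zero_le_one⟩, intervalIntegral.integral_same, add_zero]
  have hnear : ∀ᶠ t in 𝓝 (0 : ℝ), u t ∈ Metric.closedBall x₀ ρ := by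
    refine huc.continuousAt.eventually_mem ?_
    rw [hu0]
    exact Metric.closedBall_mem_nhds x₀ hρ0
  obtain ⟨d, hd, hdb⟩ := Metric.eventually_nhds_iff_ball.1 hnear
  refine ⟨min d 1, by positivity, fun t => u (t - t₀), by simp [hu0],
    huc.comp (by fun_prop), fun r hr => ?_⟩
  have hr0 : 0 ≤ r - t₀ := by linarith [hr.1]
  have hr1 : r - t₀ < min d 1 := by linarith [hr.2]
  have hmem : u (r - t₀) ∈ Metric.closedBall x₀ ρ := hdb _ (by
    rw [Metric.mem_ball, Real.dist_eq, sub_zero, abs_of_nonneg hr0]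
    exact hr1.trans_le (min_le_left _ _))
  have hder : HasDerivAt (fun t => x₀ + ∫ s in (0 : ℝ)..t, G (u s)) (G (u (r - t₀))) (r - t₀) := by
    have : CompleteSpace E := FiniteDimensional.complete ℝ E
    exact ((intervalIntegral.integral_hasDerivAt_right
      ((hG.comp huc).intervalIntegrable _ _)
      (hG.comp huc).stronglyMeasurable.stronglyMeasurableAtFilter
      (hG.comp huc).continuousAt).const_add x₀)
  have hw : HasDerivWithinAt u (F (u (r - t₀))) (Ici (r - t₀)) (r - t₀) := by
    have e : G (u (r - t₀)) = F (u (r - t₀)) := by rw [hGdef]; simp only [hpi _ hmem]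
    rw [← e]
    refine hder.hasDerivWithinAt.congr_of_eventuallyEq ?_ (hu _ ⟨hr0, (hr1.trans_le
      (min_le_right _ _)).le⟩)
    filter_upwards [Icc_mem_nhdsGE (hr1.trans_le (min_le_right _ _))] with t ht
    exact hu t ⟨hr0.trans ht.1, ht.2⟩
  have hs : HasDerivWithinAt (fun t : ℝ => t - t₀) 1 (Ici r) r :=
    (hasDerivWithinAt_id r _).sub_const t₀
  have := HasDerivWithinAt.scomp r hw hs fun t ht => by
    have : r ≤ t := ht
    change r - t₀ ≤ t - t₀
    linarith
  exact this.congr_deriv (one_smul _ _)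

end Peano
end SwitchingControl

/-! ### Parity of the exponents; continuity of the control signals -/

namespace SwitchingControl

theorem odd_of_dvd_odd {a b : ℤ} (hb : Odd b) (h : a ∣ b) : Odd a := by
  obtain ⟨c, rfl⟩ := h
  exact (Int.odd_mul.1 hb).1

/-- Numerator and denominator in lowest terms divide `a` and `b`. This decides the branch of `qpow`
for every exponent of the controller that must be an odd power. -/
theorem odd_num_den_of_eq {r : ℚ} {a b : ℤ} (ha : Odd a) (hb : Odd b) (h : r = (a : ℚ) / b) :
    Odd r.num ∧ Odd (r.den : ℤ) := by
  rw [← Rat.divInt_eq_div] at h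
  subst h
  exact ⟨odd_of_dvd_odd ha (Rat.num_dvd a (by rintro rfl; simp at hb)),
    odd_of_dvd_odd hb (Rat.den_dvd a b)⟩

variable {n : ℕ} {D : Design n}

theorem Design.Admissible.exists_q_eq (hD : D.Admissible) (i : ℕ) :
    ∃ a b : ℤ, Odd a ∧ Odd b ∧ D.q i = (a : ℚ) / b := by
  have hden : (D.α.den : ℚ) ≠ 0 := by exact_mod_cast D.α.den_nz
  induction i with
  | zero => exact ⟨1, 1, odd_one, odd_one, by simp [Design.q]⟩
  | succ i ih =>
    obtain ⟨a, b, ha, hb, h⟩ := ih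
    have hb0 : (b : ℚ) ≠ 0 := by
      have : b ≠ 0 := by rintro rfl; simp at hb
      exact_mod_cast this
    have hd : Odd (D.α.den : ℤ) := by exact_mod_cast hD.odd_den
    refine ⟨(D.α.num - D.α.den) * b + a * D.α.den, D.α.den * b,
      ((hD.odd_num.sub_odd hd).mul_right b).add_odd (ha.mul hd), hd.mul hb, ?_⟩
    rw [Design.q, h]
    nth_rewrite 1 [← Rat.num_div_den D.α]
    push_cast
    field_simp

theorem Design.Admissible.odd_q (hD : D.Admissible) (i : ℕ) : Odd (D.q i).num := by
  obtain ⟨a, b, ha, hb, h⟩ := hD.exists_q_eq i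
  exact (odd_num_den_of_eq ha hb h).1

theorem Design.Admissible.odd_inv_q (hD : D.Admissible) (i : ℕ) : Odd (1 / D.q i).num := by
  obtain ⟨a, b, ha, hb, h⟩ := hD.exists_q_eq i
  exact (odd_num_den_of_eq hb ha (by rw [h, one_div_div])).1

theorem Design.Admissible.odd_two_sub_q (hD : D.Admissible) (i : ℕ) : Odd (2 - D.q i).num := by
  obtain ⟨a, b, ha, hb, h⟩ := hD.exists_q_eq i
  have hb0 : (b : ℚ) ≠ 0 := by
    have : b ≠ 0 := by rintro rfl; simp at hb
    exact_mod_cast this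
  exact (odd_num_den_of_eq (a := 2 * b - a) ((even_two_mul b).sub_odd ha) hb
    (by rw [h]; push_cast; field_simp)).1

theorem Design.Admissible.odd_one_add_two_mul (hD : D.Admissible) : Odd (1 + 2 * D.α).num := by
  have hd : Odd (D.α.den : ℤ) := by exact_mod_cast hD.odd_den
  have hden : (D.α.den : ℚ) ≠ 0 := by exact_mod_cast D.α.den_nz
  refine (odd_num_den_of_eq (a := 2 * D.α.num + D.α.den) ((even_two_mul _).add_odd hd) hd ?_).1
  nth_rewrite 1 [← Rat.num_div_den D.α]
  push_cast
  field_simp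
  ring

/-- The sum of the odd numerator and the odd denominator of `α` is even, and reduction by an odd
denominator cannot remove the factor `2`. So the powers of the errors in the auxiliary equations are
nonnegative. -/
theorem Design.Admissible.even_one_add (hD : D.Admissible) : Even (1 + D.α).num := by
  have hd : Odd (D.α.den : ℤ) := by exact_mod_cast hD.odd_den
  have hden : (D.α.den : ℚ) ≠ 0 := by exact_mod_cast D.α.den_nz
  have h1 : 1 + D.α = ((D.α.den + D.α.num : ℤ) : ℚ) / (D.α.den : ℤ) := by
    nth_rewrite 1 [← Rat.num_div_den D.α]
    push_cast
    field_simp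
  have h2 : (1 + D.α).num * (D.α.den : ℤ) = (D.α.den + D.α.num : ℤ) * (1 + D.α).den := by
    have hne : ((1 + D.α).den : ℚ) ≠ 0 := by exact_mod_cast (1 + D.α).den_nz
    have h3 := Rat.num_div_den (1 + D.α)
    have h4 := h3.trans h1
    rw [div_eq_div_iff hne (by exact_mod_cast D.α.den_nz)] at h4
    exact_mod_cast h4
  have h5 : Even ((1 + D.α).num * (D.α.den : ℤ)) := by
    rw [h2]; exact (hd.add_odd hD.odd_num).mul_right _
  rcases Int.even_mul.1 h5 with h | h
  · exact h
  · exact absurd h (Int.not_even_iff_odd.2 hd)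

theorem Design.q_succ (D : Design n) (i : ℕ) :
    ((D.q (i + 1) : ℚ) : ℝ) = D.q i + D.α - 1 := by
  rw [Design.q]; push_cast; ring

theorem Design.Admissible.antitone_q (hD : D.Admissible) : Antitone D.q :=
  antitone_nat_of_succ_le fun i => by
    have := hD.lt_one
    rw [Design.q]; linarith

theorem Design.Admissible.q_pos' (hD : D.Admissible) {i : ℕ} (hi : i ≤ n) :
    (0 : ℝ) < D.q i := by
  exact_mod_cast hD.q_pos.trans_le (hD.antitone_q hi)

theorem Design.Admissible.q_le_one (hD : D.Admissible) (i : ℕ) : (D.q i : ℝ) ≤ 1 := by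
  have : D.q i ≤ 1 := hD.antitone_q (Nat.zero_le i)
  exact_mod_cast this

theorem Design.Admissible.α_pos (hD : D.Admissible) : (0 : ℝ) < D.α := by
  have : 0 < D.α := by linarith [hD.half_lt]
  exact_mod_cast this

theorem Design.Admissible.α_lt_one (hD : D.Admissible) : (D.α : ℝ) < 1 := by
  exact_mod_cast hD.lt_one

theorem Design.Admissible.channelErr_eq (hD : D.Admissible) (i : ℕ) (x v : ℝ) :
    D.channelErr i x v = opow x (1 / D.q i) - opow v (1 / D.q i) := by
  rw [Design.channelErr, qpow_odd (hD.odd_inv_q i), qpow_odd (hD.odd_inv_q i)]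
  push_cast; rfl

/-- The root `(x_i^*) ^ (1 / q_i)` of the virtual control. -/
noncomputable def Design.root (D : Design n) (σ : Fin n → ℕ) (χ x : Fin n → ℝ) (i : ℕ) : ℝ :=
  opow (D.virtualControl σ χ x i) (1 / D.q i)

theorem Design.Admissible.err_eq (hD : D.Admissible) (σ : Fin n → ℕ) (χ x : Fin n → ℝ)
    (i : Fin n) : D.err σ χ x i = opow (x i) (1 / D.q i) - D.root σ χ x i := by
  rw [Design.err, hD.channelErr_eq, Design.root]

theorem Design.Admissible.opow_root (hD : D.Admissible) (σ : Fin n → ℕ) (χ x : Fin n → ℝ)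
    {i : ℕ} (hi : i ≤ n) : opow (D.root σ χ x i) (D.q i) = D.virtualControl σ χ x i :=
  opow_inv_left (hD.q_pos' hi).ne' _

theorem Design.root_zero (D : Design n) (σ : Fin n → ℕ) (χ x : Fin n → ℝ) :
    D.root σ χ x 0 = 0 := by
  rw [Design.root, Design.virtualControl, opow_zero_left]

theorem Design.Admissible.lyap_eq (hD : D.Admissible) {σ : Fin n → ℕ} {χ x : Fin n → ℝ}
    {i : Fin n} (h : |D.err σ χ x i| < χ i) :
    D.lyap σ χ x i = barrierInt (χ i) (D.q i) (D.root σ χ x i) (x i) := by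
  rw [Design.lyap]
  split_ifs with hi
  · have h1 : D.err σ χ x i = x i := by
      rw [hD.err_eq, hi, D.root_zero, Design.q]; simp [opow_one]
    rw [h1] at h ⊢
    rw [hi, D.root_zero, ← barrierInt_one_zero h, Design.q]
    simp
  · rw [barrierInt, hD.opow_root σ χ x i.2.le]
    simp_rw [qpow_odd (hD.odd_two_sub_q i), hD.channelErr_eq, barrierRate, Design.root]
    push_cast
    rfl

theorem Design.Admissible.channelLaw_eq (hD : D.Admissible) (i : Fin n) (k : ℕ) {b s : ℝ}
    (hs : |s| < b) :
    D.channelLaw i k b s = D.gain i k * (-D.K i * opow s (D.q i + D.α - 1)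
      - D.U i * opow s (D.q i + D.α - 1) / (b ^ 2 - s ^ 2) ^ (1 + 2 * (D.α : ℝ))) := by
  rw [Design.channelLaw, qpow_odd (hD.odd_q _), qpow_odd hD.odd_one_add_two_mul,
    opow_of_pos (sq_sub_sq_pos hs), D.q_succ]
  push_cast
  rfl

theorem Design.virtualControl_succ (D : Design n) (σ : Fin n → ℕ) (χ x : Fin n → ℝ) (i : Fin n) :
    D.virtualControl σ χ x (i + 1) = D.channelLaw i (σ i) (χ i) (D.err σ χ x i) := by
  rw [Design.virtualControl, dif_pos i.2]; rfl

theorem Design.virtualControl_congr (D : Design n) {σ σ' : Fin n → ℕ} {χ χ' x x' : Fin n → ℝ}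
    {i : ℕ} (h : ∀ j : Fin n, (j : ℕ) < i → σ j = σ' j ∧ χ j = χ' j ∧ x j = x' j) :
    D.virtualControl σ χ x i = D.virtualControl σ' χ' x' i := by
  induction i with
  | zero => rfl
  | succ i ih =>
    rw [Design.virtualControl, Design.virtualControl]
    split_ifs with hi
    · obtain ⟨h1, h2, h3⟩ := h ⟨i, hi⟩ (Nat.lt_succ_self i)
      rw [h1, h2, h3, ih fun j hj => h j (hj.trans (Nat.lt_succ_self i))]
    · rfl

theorem Design.err_congr (D : Design n) {σ σ' : Fin n → ℕ} {χ χ' : Fin n → ℝ} (x : Fin n → ℝ)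
    {i : Fin n} (h : ∀ j : Fin n, j < i → σ j = σ' j ∧ χ j = χ' j) :
    D.err σ χ x i = D.err σ' χ' x i := by
  rw [Design.err, Design.err,
    D.virtualControl_congr fun j hj => ⟨(h j hj).1, (h j hj).2, rfl⟩]

theorem Design.lyap_congr (D : Design n) {σ σ' : Fin n → ℕ} {χ χ' : Fin n → ℝ} (x : Fin n → ℝ)
    {i : Fin n} (h : ∀ j : Fin n, j < i → σ j = σ' j ∧ χ j = χ' j) (hi : χ i = χ' i) :
    D.lyap σ χ x i = D.lyap σ' χ' x i := by
  rw [Design.lyap, Design.lyap, D.err_congr x h, hi,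
    D.virtualControl_congr fun j hj => ⟨(h j hj).1, (h j hj).2, rfl⟩]

/-- The root `(x_{i+1}^*) ^ (1 / q_{i+1})` as a function of the error `s_i`. -/
noncomputable def rootLaw (γ K U b q α s : ℝ) : ℝ :=
  -(opow γ (1 / q) * (s * (K + U / (b ^ 2 - s ^ 2) ^ (1 + 2 * α)) ^ (1 / q)))

/-- Taking the root turns the factor `s ^ q` of the control law into `s` itself, multiplied by a
smooth positive function. So the root is differentiable at `s = 0`, where the virtual control is
not. -/
theorem contDiffOn_rootLaw {γ K U b q α : ℝ} (hK : 0 < K) (hU : 0 < U) :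
    ContDiffOn ℝ 1 (rootLaw γ K U b q α) (Ioo (-b) b) := by
  have h0 : ∀ s ∈ Ioo (-b) b, 0 < b ^ 2 - s ^ 2 := fun s hs => sq_sub_sq_pos (abs_lt.2 hs)
  have h1 : ∀ s ∈ Ioo (-b) b, (0 : ℝ) < (b ^ 2 - s ^ 2) ^ (1 + 2 * α) := fun s hs =>
    Real.rpow_pos_of_pos (h0 s hs) _
  refine (contDiffOn_const.mul (contDiffOn_id.mul (ContDiffOn.rpow_const_of_ne
    (contDiffOn_const.add (contDiffOn_const.div (ContDiffOn.rpow_const_of_ne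
      (by fun_prop) fun s hs => (h0 s hs).ne') fun s hs => (h1 s hs).ne')) fun s hs => ?_))).neg
  have h2 := div_pos hU (h1 s hs)
  exact (add_pos hK h2).ne'

theorem Design.Admissible.root_succ (hD : D.Admissible) {σ : Fin n → ℕ} {χ x : Fin n → ℝ}
    {i : Fin n} (h : |D.err σ χ x i| < χ i) :
    D.root σ χ x (i + 1) = rootLaw (D.gain i (σ i)) (D.K i) (D.U i) (χ i) (D.q (i + 1)) D.α
      (D.err σ χ x i) := by
  have hpos := sq_sub_sq_pos h
  have hq : (0 : ℝ) < D.q (i + 1) := hD.q_pos' i.2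
  rw [Design.root, D.virtualControl_succ, hD.channelLaw_eq i _ h, ← D.q_succ, rootLaw]
  set s := D.err σ χ x i
  have hK := hD.K_pos i
  have hU := hD.U_pos i
  have h1 : (0 : ℝ) < (χ i ^ 2 - s ^ 2) ^ (1 + 2 * (D.α : ℝ)) := Real.rpow_pos_of_pos hpos _
  have h2 : D.gain i (σ i) * (-D.K i * opow s (D.q (i + 1))
      - D.U i * opow s (D.q (i + 1)) / (χ i ^ 2 - s ^ 2) ^ (1 + 2 * (D.α : ℝ)))
      = -(D.gain i (σ i) * (opow s (D.q (i + 1)) *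
        (D.K i + D.U i / (χ i ^ 2 - s ^ 2) ^ (1 + 2 * (D.α : ℝ))))) := by
    field_simp; ring
  rw [h2, opow_neg, mul_opow, mul_opow, opow_inv_right hq.ne',
    opow_of_pos (add_pos hK (div_pos hU h1))]

/-- The errors stay within the barriers. -/
def Design.InBarrier (D : Design n) (σ : Fin n → ℕ) (χ x : Fin n → ℝ) : Prop :=
  ∀ i, |D.err σ χ x i| < χ i

/-- Each root is a continuous function of the preceding error, and this error involves only one
state and the preceding root. The formula `root_succ` holds inside the barrier only, hence the
eventual equality. -/
theorem Design.Admissible.continuousAt_root (hD : D.Admissible) {σ : Fin n → ℕ}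
    {χ x : Fin n → ℝ} {i : ℕ} (hi : i ≤ n)
    (h : ∀ j : Fin n, (j : ℕ) < i → |D.err σ χ x j| < χ j) :
    ContinuousAt (fun y => D.root σ χ y i) x := by
  induction i with
  | zero => simp_rw [Design.root_zero]; exact continuousAt_const
  | succ i ih =>
    have ih' := ih (by omega) fun j hj => h j (by omega)
    have hlt : |D.err σ χ x ⟨i, hi⟩| < χ ⟨i, hi⟩ := h ⟨i, hi⟩ (Nat.lt_succ_self i)
    have herr : ContinuousAt (fun y => D.err σ χ y ⟨i, hi⟩) x := by
      simp_rw [hD.err_eq]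
      exact ((continuous_opow (one_div_pos.2 (hD.q_pos' (by omega)))).comp
        (continuous_apply _)).continuousAt.sub ih'
    have hev : ∀ᶠ y in 𝓝 x, |D.err σ χ y ⟨i, hi⟩| < χ ⟨i, hi⟩ :=
      herr.abs.eventually (eventually_lt_nhds hlt)
    have hc := (contDiffOn_rootLaw (γ := D.gain ⟨i, hi⟩ (σ ⟨i, hi⟩)) (b := χ ⟨i, hi⟩)
      (q := D.q (i + 1)) (α := D.α) (hD.K_pos ⟨i, hi⟩) (hD.U_pos ⟨i, hi⟩)).continuousOn.continuousAt
        (Ioo_mem_nhds (abs_lt.1 hlt).1 (abs_lt.1 hlt).2)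
    refine (ContinuousAt.comp_of_eq hc herr rfl).congr ?_
    filter_upwards [hev] with y hy
    exact (hD.root_succ (i := ⟨i, hi⟩) hy).symm

theorem Design.Admissible.continuousAt_virtualControl (hD : D.Admissible) {σ : Fin n → ℕ}
    {χ x : Fin n → ℝ} {i : ℕ} (hi : i ≤ n)
    (h : ∀ j : Fin n, (j : ℕ) < i → |D.err σ χ x j| < χ j) :
    ContinuousAt (fun y => D.virtualControl σ χ y i) x := by
  have := (continuous_opow (hD.q_pos' hi)).continuousAt.comp_of_eq (hD.continuousAt_root hi h) rfl
  refine this.congr (Eventually.of_forall fun y => ?_)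
  exact hD.opow_root σ χ y hi

theorem Design.Admissible.continuousAt_err (hD : D.Admissible) {σ : Fin n → ℕ}
    {χ x : Fin n → ℝ} {i : Fin n} (h : ∀ j : Fin n, j < i → |D.err σ χ x j| < χ j) :
    ContinuousAt (fun y => D.err σ χ y i) x := by
  simp_rw [hD.err_eq]
  exact ((continuous_opow (one_div_pos.2 (hD.q_pos' i.2.le))).comp
    (continuous_apply _)).continuousAt.sub (hD.continuousAt_root i.2.le h)

theorem Design.Admissible.eventually_inBarrier (hD : D.Admissible) {σ : Fin n → ℕ}
    {χ x : Fin n → ℝ} (h : D.InBarrier σ χ x) : ∀ᶠ y in 𝓝 x, D.InBarrier σ χ y :=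
  eventually_all.2 fun i => (hD.continuousAt_err fun j _ => h j).abs.eventually
    (eventually_lt_nhds (h i))

theorem Design.Admissible.continuousAt_lyap (hD : D.Admissible) {σ : Fin n → ℕ}
    {χ x : Fin n → ℝ} (h : D.InBarrier σ χ x) (i : Fin n) :
    ContinuousAt (fun y => D.lyap σ χ y i) x := by
  have hs := h i
  rw [hD.err_eq] at hs
  have h1 := continuousAt_barrierInt (hD.q_pos' i.2.le) (hD.q_le_one i) hs
  have h2 : ContinuousAt (fun y : Fin n → ℝ => (D.root σ χ y i, y i)) x :=
    (hD.continuousAt_root i.2.le fun j _ => h j).prodMk (continuous_apply i).continuousAt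
  refine (ContinuousAt.comp_of_eq h1 h2 rfl).congr ?_
  filter_upwards [hD.eventually_inBarrier h] with y hy
  exact (hD.lyap_eq (hy i)).symm

theorem Design.Admissible.lyap_nonneg (hD : D.Admissible) {σ : Fin n → ℕ}
    {χ x : Fin n → ℝ} {i : Fin n} (h : |D.err σ χ x i| < χ i) : 0 ≤ D.lyap σ χ x i := by
  rw [hD.lyap_eq h]
  rw [hD.err_eq] at h
  exact barrierInt_nonneg (hD.q_pos' i.2.le) h

theorem Design.Admissible.lyap_le (hD : D.Admissible) {σ : Fin n → ℕ}
    {χ x : Fin n → ℝ} {i : Fin n} (h : |D.err σ χ x i| < χ i) :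
    D.lyap σ χ x i ≤ 2 * D.err σ χ x i ^ 2 / (χ i ^ 2 - D.err σ χ x i ^ 2) := by
  rw [hD.lyap_eq h]
  rw [hD.err_eq] at h ⊢
  exact (le_abs_self _).trans (abs_barrierInt_le (hD.q_pos' i.2.le) (hD.q_le_one i) h)

theorem Design.Admissible.qpow_err (hD : D.Admissible) (s : ℝ) :
    qpow s (1 + D.α) = |s| ^ (1 + (D.α : ℝ)) := by
  rw [qpow_even hD.even_one_add]; push_cast; rfl

theorem Design.Admissible.continuous_qpow_err (hD : D.Admissible) :
    Continuous fun s => qpow s (1 + D.α) := by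
  simp_rw [hD.qpow_err]
  exact continuous_abs.rpow_const fun _ => Or.inr (by linarith [hD.α_pos])

theorem continuous_qpow {r : ℚ} (hr : 0 < r) : Continuous fun x => qpow x r := by
  have hr' : (0 : ℝ) < r := by exact_mod_cast hr
  rcases Int.even_or_odd r.num with h | h
  · simp_rw [qpow_even h]
    exact continuous_abs.rpow_const fun _ => Or.inr hr'.le
  · simp_rw [qpow_odd h]
    exact continuous_opow hr'

theorem qpow_of_nonneg {x : ℝ} {r : ℚ} (hr : r ≠ 0) (hx : 0 ≤ x) : qpow x r = x ^ (r : ℝ) := by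
  rcases Int.even_or_odd r.num with h | h
  · rw [qpow_even h, abs_of_nonneg hx]
  · rw [qpow_odd h, opow_of_nonneg (by exact_mod_cast hr) hx]

theorem Design.Admissible.continuousAt_stateRHS (hD : D.Admissible) {P : Plant n}
    (hP : P.Admissible) {σ : Fin n → ℕ} {χ x : Fin n → ℝ} (h : D.InBarrier σ χ x) :
    ContinuousAt (fun y => stateRHS D P σ χ y) x := by
  refine continuousAt_pi.2 fun i => ?_
  have hproj : Continuous fun (y : Fin n → ℝ) (j : Fin (i + 1)) => y ⟨j, by omega⟩ := by fun_prop
  refine ContinuousAt.add (ContinuousAt.mul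
    ((hP.contDiff_h i).continuous.comp hproj).continuousAt ?_)
    ((hP.contDiff_f i).continuous.comp hproj).continuousAt
  split_ifs
  · exact (continuous_apply _).continuousAt
  · exact hD.continuousAt_virtualControl le_rfl fun j _ => h j

theorem Design.Admissible.continuousAt_auxRHS (hD : D.Admissible)
    {σ : Fin n → ℕ} {χ x : Fin n → ℝ} (h : D.InBarrier σ χ x) (η : Fin n → ℝ) :
    ContinuousAt (fun z : (Fin n → ℝ) × (Fin n → ℝ) => auxRHS D σ χ z.1 z.2) (x, η) := by
  have hs : ∀ j, ContinuousAt (fun z : (Fin n → ℝ) × (Fin n → ℝ) =>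
      qpow (D.err σ χ z.1 j) (1 + D.α)) (x, η) := fun j => by
    have h1 : ContinuousAt (fun z : (Fin n → ℝ) × (Fin n → ℝ) => D.err σ χ z.1 j) (x, η) :=
      ContinuousAt.comp_of_eq (g := fun y => D.err σ χ y j)
        (hD.continuousAt_err fun j _ => h j) continuousAt_fst rfl
    exact hD.continuous_qpow_err.continuousAt.comp_of_eq h1 rfl
  have hα : 0 < (1 + D.α) / 2 := by linarith [hD.half_lt]
  refine continuousAt_pi.2 fun i => ?_
  unfold auxRHS
  refine ContinuousAt.add (ContinuousAt.add (ContinuousAt.add (ContinuousAt.sub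
    (continuousAt_const.mul ?_) (continuousAt_const.mul (hs i))) ?_) ?_) continuousAt_const
  · exact ((continuous_qpow hα).comp ((continuous_apply i).comp continuous_snd)).continuousAt
  · exact tendsto_finsetSum _ fun j _ => continuousAt_const.mul (hs j)
  · split_ifs
    · exact continuousAt_const.mul (hs _)
    · exact continuousAt_const

end SwitchingControl

/-! ### Barriers, jumps and one-sided derivatives along a solution -/

namespace SwitchingControl

/-- Induction along a real interval that is closed on the left. -/
theorem real_interval_induction {a : ℝ} {T : EReal} {p : ℝ → Prop}
    (left : ∀ t, a ≤ t → (t : EReal) < T → (∀ r, a ≤ r → r < t → p r) → p t)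
    (right : ∀ t, a ≤ t → (t : EReal) < T → p t → ∀ᶠ r in 𝓝[>] t, p r) :
    ∀ t, a ≤ t → (t : EReal) < T → p t := by
  intro t hat htT
  by_contra hp
  set S : Set ℝ := {r | a ≤ r ∧ ¬ p r} with hS
  have hne : S.Nonempty := ⟨t, hat, hp⟩
  have hbdd : BddBelow S := ⟨a, fun r hr => hr.1⟩
  have h1 : a ≤ sInf S := le_csInf hne fun r hr => hr.1
  have h2 : sInf S ≤ t := csInf_le hbdd ⟨hat, hp⟩
  have h3 : ((sInf S : ℝ) : EReal) < T := (EReal.coe_le_coe_iff.2 h2).trans_lt htT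
  have h4 : p (sInf S) := left _ h1 h3 fun r har hr => by
    by_contra hpr
    exact absurd (csInf_le hbdd ⟨har, hpr⟩) (not_le.2 hr)
  obtain ⟨u, hu, hsub⟩ := mem_nhdsGT_iff_exists_Ioo_subset.1 (right _ h1 h3 h4)
  have h5 : u ≤ sInf S := le_csInf hne fun r hr => by
    by_contra hlt
    have hlt := not_le.1 hlt
    rcases (csInf_le hbdd hr).eq_or_lt with h | h
    · exact hr.2 (h ▸ h4)
    · exact hr.2 (hsub ⟨h, hlt⟩)
  exact absurd hu (not_lt.2 h5)

theorem eventually_coe_lt {t : ℝ} {T : EReal} (h : (t : EReal) < T) :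
    ∀ᶠ r : ℝ in 𝓝 t, (r : EReal) < T :=
  continuous_coe_real_ereal.continuousAt.eventually (eventually_lt_nhds h)

variable {n : ℕ} {D : Design n} {P : Plant n}

/-- Bounded Lyapunov functions keep the errors within the barriers in the limit. -/
theorem Design.Admissible.inBarrier_of_tendsto (hD : D.Admissible) {σ : Fin n → ℕ}
    {χ xT ηT : Fin n → ℝ} {l : Filter ℝ} [l.NeBot] {x η : ℝ → Fin n → ℝ}
    (hx : Tendsto x l (𝓝 xT)) (hη : Tendsto η l (𝓝 ηT))
    (hb : ∀ᶠ r in l, D.InBarrier σ χ (x r))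
    (hV : ∀ᶠ r in l, ∀ i, D.lyap σ χ (x r) i ≤ η r i) : D.InBarrier σ χ xT := by
  intro i
  induction i using WellFoundedLT.induction with
  | ind i ih =>
    have hχ : 0 < χ i := by
      obtain ⟨r, hr⟩ := hb.exists
      exact (abs_nonneg _).trans_lt (hr i)
    have hroot := (hD.continuousAt_root i.2.le fun j hj => ih j hj).tendsto.comp hx
    have herr := (hD.continuousAt_err fun j hj => ih j hj).tendsto.comp hx
    -- The earlier errors are already known to be inside their barriers in the limit, so the root of
    -- this channel converges. Near the limit it and `η` are bounded by their limits plus one, and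
    -- the errors keep a distance that survives the passage to the limit.
    obtain ⟨κ, hκ, hbar⟩ := exists_le_sq_sub_sq_of_barrierInt_le (hD.q_pos' i.2.le)
      (hD.q_le_one i) hχ (ηT i + 1) (|D.root σ χ xT i| + 1)
    have h1 : ∀ᶠ r in l, κ ≤ χ i ^ 2 - D.err σ χ (x r) i ^ 2 := by
      have e1 : ∀ᶠ r in l, |D.root σ χ (x r) i| < |D.root σ χ xT i| + 1 :=
        hroot.abs.eventually (eventually_lt_nhds (lt_add_one _))
      have e2 : ∀ᶠ r in l, η r i < ηT i + 1 :=
        ((tendsto_pi_nhds.1 hη) i).eventually (eventually_lt_nhds (lt_add_one _))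
      filter_upwards [e1, e2, hb, hV] with r h1 h2 h3 h4
      have h5 := h3 i
      have h6 := h4 i
      rw [hD.lyap_eq h5] at h6
      rw [hD.err_eq] at h5 ⊢
      exact hbar _ _ h1.le h5 (h6.trans h2.le)
    have h2 : κ ≤ χ i ^ 2 - D.err σ χ xT i ^ 2 :=
      ge_of_tendsto (tendsto_const_nhds.sub (herr.pow 2)) h1
    exact abs_lt_of_sq_lt_sq (by linarith) hχ.le

theorem Update.inBarrier {σ σ' : Fin n → ℕ} {χ χ' η η' x : Fin n → ℝ} (hD : D.Admissible)
    (h : Update D x σ χ η σ' χ' η') (hχ : ∀ i, 0 < χ i) : D.InBarrier σ' χ' x := by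
  intro i
  have h1 := h.2.1 i
  split_ifs at h1 with hi
  · rw [h1]; linarith [hD.ς_pos]
  · rw [h1]; rwa [not_le, abs_of_pos (hχ i)] at hi

theorem Design.InBarrier.pos {σ : Fin n → ℕ} {χ x : Fin n → ℝ} (h : D.InBarrier σ χ x)
    (i : Fin n) : 0 < χ i := (abs_nonneg _).trans_lt (h i)

theorem Update.σ_eq_or {σ σ' : Fin n → ℕ} {χ χ' η η' x : Fin n → ℝ}
    (h : Update D x σ χ η σ' χ' η') (i : Fin n) :
    σ' i = σ i ∨ (σ' i = σ i + 1 ∧ η i ≤ D.lyap σ χ x i) := by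
  have h1 := h.1 i
  split_ifs at h1 with hi
  · exact Or.inr ⟨h1, by rwa [Design.superv, sub_nonneg] at hi⟩
  · exact Or.inl h1

/-- Before the update the error is inside its barrier. Only a jump of the error can enlarge the
barrier, and such a jump goes back to a change of an earlier switching signal. -/
theorem Update.χ_eq {σ σ' : Fin n → ℕ} {χ χ' η η' x : Fin n → ℝ}
    (h : Update D x σ χ η σ' χ' η') (hb : D.InBarrier σ χ x) {i : Fin n}
    (hσ : ∀ j < i, σ' j = σ j) : χ' i = χ i := by
  induction i using WellFoundedLT.induction with
  | ind i ih =>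
    have h1 := h.2.1 i
    rw [D.err_congr x fun j hj => ⟨hσ j hj, ih j hj fun k hk => hσ k (hk.trans hj)⟩,
      if_neg (by rw [abs_of_pos (hb.pos i), not_le]; exact hb i)] at h1
    exact h1

/-- If no signal up to channel `i` changes, then `V_i` does not jump. As channel `i` itself did not
switch, `V_i < η_i` holds strictly, so there is no reset. -/
theorem Update.η_eq {σ σ' : Fin n → ℕ} {χ χ' η η' x : Fin n → ℝ}
    (h : Update D x σ χ η σ' χ' η') (hb : D.InBarrier σ χ x) {i : Fin n}
    (hσ : ∀ j ≤ i, σ' j = σ j) : η' i = η i := by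
  have h1 := h.2.2 i
  have hχ : ∀ j ≤ i, χ' j = χ j := fun j hj => h.χ_eq hb fun k hk => hσ k (hk.le.trans hj)
  rw [D.lyap_congr x (fun j hj => ⟨hσ j hj.le, hχ j hj.le⟩) (hχ i le_rfl)] at h1
  have h2 := h.1 i
  rw [hσ i le_rfl] at h2
  split_ifs at h2 with h3
  · omega
  · rw [if_neg (by rw [Design.superv] at h3; linarith)] at h1
    exact h1

namespace IsClosedLoop
variable {x₀ χ₀ : Fin n → ℝ} {T : EReal} {x η χ : ℝ → Fin n → ℝ} {σ : ℝ → Fin n → ℕ}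

theorem tendsto_left (hs : IsClosedLoop D P x₀ χ₀ T x η χ σ) {t : ℝ} (ht : 0 < t)
    (htT : (t : EReal) < T) : Tendsto x (𝓝[<] t) (𝓝 (x t)) := by
  refine (hs.continuous_x t ⟨ht.le, htT⟩).mono_left ?_
  rw [nhdsWithin_le_iff]
  filter_upwards [Ioo_mem_nhdsLT ht, self_mem_nhdsWithin] with r hr hr'
  exact ⟨hr.1.le, (EReal.coe_lt_coe_iff.2 hr').trans htT⟩

theorem tendsto_right (hs : IsClosedLoop D P x₀ χ₀ T x η χ σ) {t : ℝ} (ht : 0 ≤ t)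
    (htT : (t : EReal) < T) : Tendsto x (𝓝[>] t) (𝓝 (x t)) :=
  (hs.deriv_x t ht htT).continuousWithinAt.tendsto.mono_left (nhdsWithin_mono _ Ioi_subset_Ici_self)

theorem inBarrier_left (hs : IsClosedLoop D P x₀ χ₀ T x η χ σ) (hD : D.Admissible) {t : ℝ}
    (ht : 0 < t) (htT : (t : EReal) < T)
    (hb : ∀ r, 0 ≤ r → r < t → D.InBarrier (σ r) (χ r) (x r)) {σm : Fin n → ℕ}
    {χm ηm : Fin n → ℝ} (hconst : ∀ᶠ r in 𝓝[<] t, σ r = σm ∧ χ r = χm)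
    (hη : Tendsto η (𝓝[<] t) (𝓝 ηm)) : D.InBarrier σm χm (x t) := by
  refine hD.inBarrier_of_tendsto (hs.tendsto_left ht htT) hη ?_ ?_
  · filter_upwards [hconst, Ioo_mem_nhdsLT ht] with r hr hr0
    rw [← hr.1, ← hr.2]
    exact hb r hr0.1.le hr0.2
  · filter_upwards [hconst, Ioo_mem_nhdsLT ht] with r hr hr0 i
    rw [← hr.1, ← hr.2]
    exact sub_nonpos.1 (hs.superv_nonpos r hr0.1.le ((EReal.coe_lt_coe_iff.2 hr0.2).trans htT) i)

/-- The errors stay within the barriers. -/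
theorem inBarrier (hs : IsClosedLoop D P x₀ χ₀ T x η χ σ) (hD : D.Admissible)
    (hχ₀ : ∀ i, |D.err (fun _ => 1) χ₀ x₀ i| < χ₀ i) :
    ∀ t : ℝ, 0 ≤ t → (t : EReal) < T → D.InBarrier (σ t) (χ t) (x t) := by
  refine real_interval_induction (fun t ht htT hprev => ?_) (fun t ht htT hp => ?_)
  · rcases ht.eq_or_lt with rfl | ht0
    · intro i
      rw [hs.init_x, hs.init_χ, show σ 0 = fun _ => 1 from funext hs.init_σ]
      exact hχ₀ i
    · obtain ⟨σm, χm, ηm, hconst, hη, halt⟩ := hs.logic t ht0 htT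
      have hb := hs.inBarrier_left hD ht0 htT hprev hconst hη
      rcases halt with ⟨h1, h2, -⟩ | ⟨-, hupd⟩
      · rwa [h1, h2]
      · exact hupd.inBarrier hD hb.pos
  · filter_upwards [hs.const_right t ht htT,
      (hs.tendsto_right ht htT).eventually (hD.eventually_inBarrier hp)] with r h1 h2
    rwa [h1.1, h1.2]

/-- The values from the left at a time `t`, and what an update can change. -/
theorem left_values (hs : IsClosedLoop D P x₀ χ₀ T x η χ σ) (hD : D.Admissible)
    (hχ₀ : ∀ i, |D.err (fun _ => 1) χ₀ x₀ i| < χ₀ i) {t : ℝ} (ht : 0 < t)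
    (htT : (t : EReal) < T) :
    ∃ (σm : Fin n → ℕ) (χm ηm : Fin n → ℝ),
      (∀ᶠ r in 𝓝[<] t, σ r = σm ∧ χ r = χm) ∧ Tendsto η (𝓝[<] t) (𝓝 ηm) ∧
      D.InBarrier σm χm (x t) ∧
      (∀ i, σ t i = σm i ∨ (σ t i = σm i + 1 ∧ ηm i ≤ D.lyap σm χm (x t) i)) ∧
      (∀ i, (∀ j < i, σ t j = σm j) → χ t i = χm i) ∧
      (∀ i, (∀ j ≤ i, σ t j = σm j) → η t i = ηm i) := by
  obtain ⟨σm, χm, ηm, hconst, hη, halt⟩ := hs.logic t ht htT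
  have hb := hs.inBarrier_left hD ht htT (fun r hr hrt => hs.inBarrier hD hχ₀ r hr
    ((EReal.coe_lt_coe_iff.2 hrt).trans htT)) hconst hη
  refine ⟨σm, χm, ηm, hconst, hη, hb, ?_⟩
  rcases halt with ⟨h1, h2, h3⟩ | ⟨-, hupd⟩
  · exact ⟨fun i => Or.inl (by rw [h1]), fun i _ => by rw [h2], fun i _ => by rw [h3]⟩
  · exact ⟨hupd.σ_eq_or, fun i => hupd.χ_eq hb, fun i => hupd.η_eq hb⟩

/-- The barriers of the first channels are constant as long as the switching signals of the
preceding channels are. -/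
theorem χ_const (hs : IsClosedLoop D P x₀ χ₀ T x η χ σ) (hD : D.Admissible)
    (hχ₀ : ∀ i, |D.err (fun _ => 1) χ₀ x₀ i| < χ₀ i) {t₀ : ℝ} (ht₀ : 0 ≤ t₀) {i : ℕ}
    (hσ : ∀ t, t₀ ≤ t → (t : EReal) < T → ∀ j : Fin n, (j : ℕ) < i → σ t j = σ t₀ j) :
    ∀ t, t₀ ≤ t → (t : EReal) < T → ∀ j : Fin n, (j : ℕ) ≤ i → χ t j = χ t₀ j := by
  refine real_interval_induction (fun t ht htT hprev => ?_) (fun t ht htT hp => ?_)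
  · rcases ht.eq_or_lt with rfl | ht0
    · exact fun _ _ => rfl
    · obtain ⟨σm, χm, ηm, hconst, -, -, -, hχ, -⟩ := hs.left_values hD hχ₀ (ht₀.trans_lt ht0) htT
      intro j hj
      obtain ⟨r, hr, hr0⟩ := (hconst.and (Ioo_mem_nhdsLT ht0)).exists
      rw [hχ j fun k hk => ?_, ← hr.2, hprev r hr0.1.le hr0.2 j hj]
      have hk' : (k : ℕ) < i := lt_of_lt_of_le hk hj
      rw [hσ t ht htT k hk', ← hr.1,
        hσ r hr0.1.le ((EReal.coe_lt_coe_iff.2 hr0.2).trans htT) k hk']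
  · filter_upwards [hs.const_right t (ht₀.trans ht) htT] with r hr j hj
    rw [hr.2, hp j hj]

theorem continuousAt_η (hs : IsClosedLoop D P x₀ χ₀ T x η χ σ) (hD : D.Admissible)
    (hχ₀ : ∀ i, |D.err (fun _ => 1) χ₀ x₀ i| < χ₀ i) {t : ℝ} (ht : 0 < t)
    (htT : (t : EReal) < T) {i : Fin n} (hσ : ∀ j ≤ i, ∃ᶠ r in 𝓝[<] t, σ r j = σ t j) :
    ContinuousAt (fun r => η r i) t := by
  obtain ⟨σm, χm, ηm, hconst, hη, -, -, -, hηeq⟩ := hs.left_values hD hχ₀ ht htT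
  have h1 : η t i = ηm i := hηeq i fun j hj => by
    obtain ⟨r, hr1, hr2⟩ := ((hσ j hj).and_eventually hconst).exists
    rw [← hr1, hr2.1]
  rw [continuousAt_iff_continuous_left'_right']
  constructor
  · rw [ContinuousWithinAt, h1]
    exact (tendsto_pi_nhds.1 hη) i
  · exact ((hasDerivWithinAt_pi.1 (hs.deriv_η t ht.le htT) i).continuousWithinAt).mono
      Ioi_subset_Ici_self

end IsClosedLoop

/-- Derivative of the barrier Lyapunov function of a channel along a curve of states. -/
theorem Design.Admissible.hasDerivWithinAt_lyap (hD : D.Admissible) {σ : Fin n → ℕ}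
    {χ x' : Fin n → ℝ} {x : ℝ → Fin n → ℝ} {t d : ℝ} {i : Fin n} (hb : D.InBarrier σ χ (x t))
    (hx : HasDerivWithinAt x x' (Ici t) t)
    (hr : HasDerivWithinAt (fun r => D.root σ χ (x r) i) d (Ici t) t) :
    HasDerivWithinAt (fun r => D.lyap σ χ (x r) i)
      (barrierRate (χ i) (2 - D.q i) (D.err σ χ (x t) i) * x' i
        - barrierIntDeriv (χ i) (D.q i) (D.root σ χ (x t) i) (x t i) * d) (Ici t) t := by
  have hs := hb i
  rw [hD.err_eq] at hs ⊢
  have h1 := hasDerivWithinAt_barrierInt (hD.q_pos' i.2.le) (hD.q_le_one i)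
    (x := fun r => x r i) hs hr (hasDerivWithinAt_pi.1 hx i)
  refine h1.congr_of_eventuallyEq ?_ (hD.lyap_eq (hb i))
  filter_upwards [hx.continuousWithinAt.eventually (hD.eventually_inBarrier hb)] with r hr
  exact hD.lyap_eq (hr i)

/-- Derivative of the root of the next virtual control along a curve of states. -/
theorem Design.Admissible.hasDerivWithinAt_root_succ (hD : D.Admissible) {σ : Fin n → ℕ}
    {χ x' : Fin n → ℝ} {x : ℝ → Fin n → ℝ} {t d : ℝ} {i : Fin n} (hb : D.InBarrier σ χ (x t))
    (hx : HasDerivWithinAt x x' (Ici t) t)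
    (hr : HasDerivWithinAt (fun r => D.root σ χ (x r) i) d (Ici t) t) :
    HasDerivWithinAt (fun r => D.root σ χ (x r) (i + 1))
      (deriv (rootLaw (D.gain i (σ i)) (D.K i) (D.U i) (χ i) (D.q (i + 1)) D.α)
        (D.err σ χ (x t) i) * (1 / D.q i * |x t i| ^ (1 / (D.q i : ℝ) - 1) * x' i - d))
      (Ici t) t := by
  have hq := hD.q_pos' i.2.le
  have h1 : HasDerivWithinAt (fun r => D.err σ χ (x r) i)
      (1 / D.q i * |x t i| ^ (1 / (D.q i : ℝ) - 1) * x' i - d) (Ici t) t := by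
    simp_rw [hD.err_eq]
    exact ((hasDerivAt_opow ((one_le_div hq).2 (hD.q_le_one i)) (x t i)).comp_hasDerivWithinAt t
      (hasDerivWithinAt_pi.1 hx i)).sub hr
  have hmem : Ioo (-χ i) (χ i) ∈ 𝓝 (D.err σ χ (x t) i) :=
    Ioo_mem_nhds (abs_lt.1 (hb i)).1 (abs_lt.1 (hb i)).2
  have h2 := (((contDiffOn_rootLaw (γ := D.gain i (σ i)) (b := χ i) (q := D.q (i + 1)) (α := D.α)
    (hD.K_pos i) (hD.U_pos i)).contDiffAt hmem).differentiableAt one_ne_zero).hasDerivAt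
  refine (h2.comp_hasDerivWithinAt_of_eq t h1 rfl).congr_of_eventuallyEq ?_ (hD.root_succ (hb i))
  filter_upwards [hx.continuousWithinAt.eventually (hD.eventually_inBarrier hb)] with r hr
  exact hD.root_succ (hr i)

end SwitchingControl

/-! ### A channel stops switching -/

namespace SwitchingControl

theorem add_mul_le_of_right_deriv_ge {f : ℝ → ℝ} {a b C : ℝ} (hab : a ≤ b)
    (hf : ContinuousOn f (Icc a b))
    (hf' : ∀ t ∈ Ico a b, ∃ f', HasDerivWithinAt f f' (Ici t) t ∧ C ≤ f') :
    f a + C * (b - a) ≤ f b := by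
  choose! f' h1 h2 using hf'
  have hB : ∀ t, HasDerivAt (fun t => f a + C * (t - a)) C t := fun t => by
    simpa using (((hasDerivAt_id t).sub_const a).const_mul C).const_add (f a)
  have := image_le_of_deriv_right_le_deriv_boundary (f := fun t => f a + C * (t - a))
    (f' := fun _ => C) (a := a) (b := b) (B := f) (B' := f')
    (fun t _ => (hB t).continuousAt.continuousWithinAt) (fun t _ => (hB t).hasDerivWithinAt)
    (by simp) hf h1 h2
  exact this ⟨hab, le_rfl⟩

theorem le_of_right_deriv_neg {f : ℝ → ℝ} {a b B : ℝ} (hf : ContinuousOn f (Icc a b))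
    (hab : a ≤ b) (ha : f a ≤ B)
    (hf' : ∀ t ∈ Ico a b, ∃ f', HasDerivWithinAt f f' (Ici t) t ∧ (f t = B → f' < 0)) :
    f b ≤ B := by
  choose! f' h1 h2 using hf'
  exact image_le_of_deriv_right_lt_deriv_boundary' (B := fun _ => B) (B' := fun _ => 0) hf h1 ha
    continuousOn_const (fun _ _ => hasDerivWithinAt_const _ _ _) h2 ⟨hab, le_rfl⟩

variable {n : ℕ} {D : Design n} {P : Plant n}

/-- This is the intermediate value theorem on the connected space of states. Which alternative holds
is not known to the controller, hence the alternating sign of the adaptive gain. -/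
theorem Plant.Admissible.pos_or_neg (hP : P.Admissible) (i : Fin n) :
    (∀ z, 0 < P.h i z) ∨ ∀ z, P.h i z < 0 := by
  by_contra hcon
  push Not at hcon
  obtain ⟨⟨z₁, h1⟩, z₂, h2⟩ := hcon
  obtain ⟨z, hz⟩ := mem_range_of_exists_le_of_exists_ge (hP.contDiff_h i).continuous
    ⟨z₁, h1⟩ ⟨z₂, h2⟩
  exact hP.h_ne_zero i z hz

/-- Large values of the switching signal with the right parity give a large gain. -/
theorem exists_le_gain_mul (hD : D.Admissible) (hP : P.Admissible) (i : Fin n) (M A : ℝ) (N : ℕ) :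
    ∃ k ≥ N, ∀ z : Fin (i + 1) → ℝ, ‖z‖ ≤ M → A ≤ D.gain i k * P.h i z := by
  rcases lt_or_ge M 0 with hM | hM
  · exact ⟨N, le_rfl, fun z hz => absurd (norm_nonneg z) (by linarith)⟩
  have hc := (hP.contDiff_h i).continuous
  obtain ⟨z₀, -, hz₀⟩ := (isCompact_closedBall (0 : Fin (i + 1) → ℝ) M).exists_isMinOn
    ⟨0, Metric.mem_closedBall_self hM⟩ hc.abs.continuousOn
  have hm : 0 < |P.h i z₀| := abs_pos.2 (hP.h_ne_zero i z₀)
  obtain ⟨k₀, hk₀⟩ := eventually_atTop.1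
    ((hD.θ_tendsto i).eventually (eventually_ge_atTop (|A| / |P.h i z₀|)))
  have key : ∀ k ≥ k₀, ∀ z : Fin (i + 1) → ℝ, ‖z‖ ≤ M → A ≤ D.θ i k * |P.h i z| := by
    intro k hk z hz
    have h1 : |P.h i z₀| ≤ |P.h i z| := hz₀ (by simpa using hz)
    have h2 := hk₀ k hk
    rw [div_le_iff₀ hm] at h2
    have h3 : 0 ≤ D.θ i k := (hD.θ_pos i).le.trans (hD.θ_mono i (Nat.zero_le k))
    exact (le_abs_self A).trans (h2.trans (mul_le_mul_of_nonneg_left h1 h3))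
  rcases hP.pos_or_neg i with h | h
  · refine ⟨2 * (N + k₀), by omega, fun z hz => ?_⟩
    have := key (2 * (N + k₀)) (by omega) z hz
    rw [abs_of_pos (h z)] at this
    rwa [Design.gain, pow_mul, neg_one_sq, one_pow, one_mul]
  · refine ⟨2 * (N + k₀) + 1, by omega, fun z hz => ?_⟩
    have := key (2 * (N + k₀) + 1) (by omega) z hz
    rw [abs_of_neg (h z)] at this
    rw [Design.gain, pow_succ, pow_mul, neg_one_sq, one_pow]
    linarith

/-- What is known of the signals from the time `t₀` on, once the switching signals of the first
`i` channels have settled. -/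
structure Settled (D : Design n) (T : EReal) (x η χ : ℝ → Fin n → ℝ) (σ : ℝ → Fin n → ℕ)
    (i : ℕ) (t₀ M : ℝ) : Prop where
  nonneg : 0 ≤ t₀
  lt : (t₀ : EReal) < T
  σ_const : ∀ t : ℝ, t₀ ≤ t → (t : EReal) < T → ∀ j : Fin n, (j : ℕ) < i → σ t j = σ t₀ j
  x_le : ∀ t : ℝ, t₀ ≤ t → (t : EReal) < T → ∀ j : Fin n, (j : ℕ) ≤ i → |x t j| ≤ M
  control_le : ∀ t : ℝ, t₀ ≤ t → (t : EReal) < T → ∀ j : ℕ, j ≤ i →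
    |D.virtualControl (σ t) (χ t) (x t) j| ≤ M
  η_le : ∀ t : ℝ, t₀ ≤ t → (t : EReal) < T → ∀ j : Fin n, (j : ℕ) < i → |η t j| ≤ M
  root_deriv : ∀ t : ℝ, t₀ ≤ t → (t : EReal) < T → ∃ d, |d| ≤ M ∧
    HasDerivWithinAt (fun r => D.root (σ t) (χ t) (x r) i) d (Ici t) t

theorem sum_nonneg_aux (hD : D.Admissible) (σ : Fin n → ℕ) (χ x : Fin n → ℝ) (i : Fin n) :
    0 ≤ ∑ j ∈ Finset.univ.filter (fun j : Fin n => j < i),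
        D.c i j * qpow (D.err σ χ x j) (1 + D.α) := by
  refine Finset.sum_nonneg fun j hj => ?_
  rw [hD.qpow_err]
  have := hD.c_pos i j (Or.inl (Finset.mem_filter.1 hj).2)
  positivity

theorem Design.Admissible.qpow_aux (hD : D.Admissible) {y : ℝ} (hy : 0 ≤ y) :
    qpow y ((1 + D.α) / 2) = y ^ ((1 + (D.α : ℝ)) / 2) := by
  rw [qpow_of_nonneg (by linarith [hD.half_lt]) hy]; push_cast; rfl

/-- Subadditivity of the power turns the difference of the damping terms of `η_i` and `V_i` into a
power of the gap `η_i - V_i`. -/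
theorem rpow_sub_rpow_le {φ y z : ℝ} (hφ : 0 ≤ φ) (hφ1 : φ ≤ 1) (hz : 0 ≤ z) (hzy : z ≤ y) :
    y ^ φ - z ^ φ ≤ (y - z) ^ φ := by
  have := Real.rpow_add_le_add_rpow (sub_nonneg.2 hzy) hz hφ hφ1
  rw [sub_add_cancel] at this
  linarith

theorem norm_restrict_le {i : Fin n} {x : Fin n → ℝ} {M : ℝ} (hM : 0 ≤ M)
    (h : ∀ j : Fin n, (j : ℕ) ≤ i → |x j| ≤ M) :
    ‖fun j : Fin (i + 1) => x ⟨j, by omega⟩‖ ≤ M :=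
  (pi_norm_le_iff_of_nonneg hM).2 fun j => h ⟨j, by omega⟩ (Nat.lt_succ_iff.1 j.2)

namespace IsClosedLoop
variable {x₀ χ₀ : Fin n → ℝ} {T : EReal} {x η χ : ℝ → Fin n → ℝ} {σ : ℝ → Fin n → ℕ}

theorem lyap_le_η (hs : IsClosedLoop D P x₀ χ₀ T x η χ σ) {t : ℝ} (ht : 0 ≤ t)
    (htT : (t : EReal) < T) (i : Fin n) : D.lyap (σ t) (χ t) (x t) i ≤ η t i :=
  sub_nonpos.1 (hs.superv_nonpos t ht htT i)

/-- There are arbitrarily large values of the switching signal for which the supervisory function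
decreases near zero. -/
theorem exists_superv_deriv_le (hs : IsClosedLoop D P x₀ χ₀ T x η χ σ) (hD : D.Admissible)
    (hP : P.Admissible) (hχ₀ : ∀ i, |D.err (fun _ => 1) χ₀ x₀ i| < χ₀ i) {i : Fin n} {t₀ M : ℝ}
    (hset : Settled D T x η χ σ i t₀ M) (N : ℕ) :
    ∃ k ≥ N, ∀ t : ℝ, t₀ ≤ t → (t : EReal) < T → σ t i = k →
      ∃ V', HasDerivWithinAt (fun r => D.lyap (σ t) (χ t) (x r) i) V' (Ici t) t ∧
        D.ζ / 2 - D.a * (η t i - D.lyap (σ t) (χ t) (x t) i) ^ ((1 + (D.α : ℝ)) / 2)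
          ≤ auxRHS D (σ t) (χ t) (x t) (η t) i - V' := by
  have hM : 0 ≤ M := (abs_nonneg _).trans (hset.x_le t₀ le_rfl hset.lt i le_rfl)
  have hb : 0 < χ t₀ i := (hs.inBarrier hD hχ₀ t₀ hset.nonneg hset.lt).pos i
  obtain ⟨H, hH⟩ := (isCompact_closedBall (0 : Fin (i + 1) → ℝ) M).exists_bound_of_continuousOn
    (hP.contDiff_h i).continuous.continuousOn
  obtain ⟨F, hF⟩ := (isCompact_closedBall (0 : Fin (i + 1) → ℝ) M).exists_bound_of_continuousOn
    (hP.contDiff_f i).continuous.continuousOn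
  -- The coefficient is that of the next error in the equation of `η i`, so that the two terms
  -- cancel. The last channel has no next error, and any positive value serves.
  set c : ℝ := if hi : (i : ℕ) + 1 < n then D.c i ⟨i + 1, hi⟩ else 1 with hc
  have hc0 : 0 < c := by
    rw [hc]; split_ifs with hi
    · exact hD.c_pos i _ (Or.inr rfl)
    · exact one_pos
  have hq' : (0 : ℝ) < D.q i + D.α - 1 := by rw [← D.q_succ]; exact hD.q_pos' i.2
  obtain ⟨A, -, hA⟩ := exists_gain_domination (α := D.α) (q := D.q i) (b := χ t₀ i) (a := D.a)
    (Q := D.Q i) (U := D.U i) (K := D.K i) (c := c) (ζ := D.ζ) hD.α_pos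
    (hD.q_le_one i) hq' hb hD.a_pos (hD.U_pos i) (hD.K_pos i) hc0 hD.ζ_pos H F M
  obtain ⟨k, hkN, hk⟩ := exists_le_gain_mul hD hP i M A N
  refine ⟨k, hkN, fun t ht htT hσ => ?_⟩
  have ht0 := hset.nonneg.trans ht
  have hbar := hs.inBarrier hD hχ₀ t ht0 htT
  obtain ⟨d, hd, hroot⟩ := hset.root_deriv t ht htT
  refine ⟨_, hD.hasDerivWithinAt_lyap hbar (hs.deriv_x t ht0 htT) hroot, ?_⟩
  have hχ : χ t i = χ t₀ i :=
    hs.χ_const hD hχ₀ hset.nonneg hset.σ_const t ht htT i le_rfl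
  have hz : ‖fun j : Fin (i + 1) => x t ⟨j, by omega⟩‖ ≤ M :=
    norm_restrict_le hM (hset.x_le t ht htT)
  set z : Fin (i + 1) → ℝ := fun j => x t ⟨j, by omega⟩
  set s := D.err (σ t) (χ t) (x t) i with hs_def
  have hsb : |s| < χ t₀ i := hχ ▸ hbar i
  have hVnn := hD.lyap_nonneg (hbar i)
  have hVle := hD.lyap_le (hbar i)
  have hVη := hs.lyap_le_η ht0 htT i
  set V := D.lyap (σ t) (χ t) (x t) i
  set e : ℝ := if hi : (i : ℕ) + 1 < n then D.err (σ t) (χ t) (x t) ⟨i + 1, hi⟩ else 0 with he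
  -- The tracking error of the next state, which is zero in the last channel because the input
  -- equals its virtual control.
  set Δ : ℝ := (if hi : (i : ℕ) + 1 < n then x t ⟨i + 1, hi⟩ else D.input (σ t) (χ t) (x t))
    - D.virtualControl (σ t) (χ t) (x t) (i + 1) with hΔ
  have hΔle : |Δ| ≤ 2 * |e| ^ ((D.q i : ℝ) + D.α - 1) := by
    rw [hΔ, he, ← D.q_succ]
    split_ifs with hi
    · rw [hD.err_eq, ← hD.opow_root _ _ _ hi.le]
      exact abs_sub_opow_le (hD.q_pos' hi.le) (hD.q_le_one _) _ _
    · have : (i : ℕ) + 1 = n := by omega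
      rw [this, Design.input, sub_self, abs_zero]
      positivity
  have hdw : |barrierIntDeriv (χ t i) (D.q i) (D.root (σ t) (χ t) (x t) i) (x t i)|
      ≤ 8 * χ t i ^ 2 * |s| / (χ t i ^ 2 - s ^ 2) ^ 2 := by
    have h1 := hbar i
    rw [hs_def]
    rw [hD.err_eq] at h1 ⊢
    exact abs_barrierIntDeriv_le (hD.q_pos' i.2.le) (hD.q_le_one i) h1
  have hx' : stateRHS D P (σ t) (χ t) (x t) i = P.h i z * (D.gain i k *
      (-D.K i * opow s (D.q i + D.α - 1) - D.U i * opow s (D.q i + D.α - 1)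
        / (χ t₀ i ^ 2 - s ^ 2) ^ (1 + 2 * (D.α : ℝ))) + Δ) + P.f i z := by
    have h1 := D.virtualControl_succ (σ t) (χ t) (x t) i
    rw [hD.channelLaw_eq i _ (hbar i), hσ, hχ] at h1
    rw [← hs_def] at h1
    rw [← h1, hΔ, stateRHS, add_sub_cancel]
  rw [hχ] at hVle hdw ⊢
  have key := hA (D.gain i k) (P.h i z) (P.f i z) s e Δ V _ d (hk z hz)
    (by simpa using hH z (by simpa using hz)) (by simpa using hF z (by simpa using hz)) hd hsb hΔle
    hVnn hVle hdw
  rw [hx']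
  have hnext : c * |e| ^ (1 + (D.α : ℝ)) = (if hi : (i : ℕ) + 1 < n then
      D.c i ⟨i + 1, hi⟩ * qpow (D.err (σ t) (χ t) (x t) ⟨i + 1, hi⟩) (1 + D.α) else 0) := by
    rw [hc, he]
    split_ifs
    · rw [hD.qpow_err]
    · rw [abs_zero, Real.zero_rpow (by linarith [hD.α_pos]), mul_zero]
  have hsub := rpow_sub_rpow_le (φ := (1 + (D.α : ℝ)) / 2) (by linarith [hD.α_pos])
    (by linarith [hD.α_lt_one]) hVnn hVη
  have hsum := sum_nonneg_aux hD (σ t) (χ t) (x t) i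
  have hsub' := mul_le_mul_of_nonneg_left hsub hD.a_pos.le
  -- The terms with `Q` and with the next error cancel against those in the bound of `V'`, the sum
  -- over earlier errors is nonnegative, and `ζ - ζ/2` remains beside the damping terms.
  rw [auxRHS, hD.qpow_aux (hVnn.trans hVη), hD.qpow_err, ← hs_def, ← hnext]
  linarith

/-- There are arbitrarily large values of the switching signal which, once reached, are kept. -/
theorem exists_no_switching (hs : IsClosedLoop D P x₀ χ₀ T x η χ σ) (hD : D.Admissible)
    (hP : P.Admissible) (hχ₀ : ∀ i, |D.err (fun _ => 1) χ₀ x₀ i| < χ₀ i) {i : Fin n} {t₀ M : ℝ}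
    (hset : Settled D T x η χ σ i t₀ M) (N : ℕ) :
    ∃ k ≥ N, ∀ t : ℝ, t₀ < t → (t : EReal) < T → (∀ᶠ r in 𝓝[<] t, σ r i = k) → σ t i = k := by
  obtain ⟨k, hkN, hk⟩ := hs.exists_superv_deriv_le hD hP hχ₀ hset N
  refine ⟨k, hkN, fun t ht htT hσ => ?_⟩
  have ht0 : 0 < t := hset.nonneg.trans_lt ht
  obtain ⟨σm, χm, ηm, hconst, hη, hb, hσt, -, -⟩ := hs.left_values hD hχ₀ ht0 htT
  have hσm : σm i = k := by
    obtain ⟨r, h1, h2⟩ := (hσ.and hconst).exists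
    rw [← h1, h2.1]
  rcases hσt i with h | ⟨-, hle⟩
  · rw [h, hσm]
  exfalso
  -- A switch needs the gap `f` to tend to zero. But a small nonnegative gap increases at least at
  -- the rate `ζ/4`, so its limit is positive.
  set f : ℝ → ℝ := fun r => η r i - D.lyap σm χm (x r) i with hf
  have hflim : Tendsto f (𝓝[<] t) (𝓝 (ηm i - D.lyap σm χm (x t) i)) :=
    ((tendsto_pi_nhds.1 hη) i).sub
      ((hD.continuousAt_lyap hb i).tendsto.comp (hs.tendsto_left ht0 htT))
  have hnn : ∀ᶠ r in 𝓝[<] t, 0 ≤ f r := by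
    filter_upwards [hconst, Ioo_mem_nhdsLT ht0] with r hr hr0
    have := hs.lyap_le_η hr0.1.le ((EReal.coe_lt_coe_iff.2 hr0.2).trans htT) i
    rw [hr.1, hr.2] at this
    exact sub_nonneg.2 this
  have hL : ηm i - D.lyap σm χm (x t) i = 0 := le_antisymm (by linarith) (ge_of_tendsto hflim hnn)
  rw [hL] at hflim
  have hφ : 0 < (1 + (D.α : ℝ)) / 2 := by linarith [hD.α_pos]
  -- The damping term takes at most half of the available `ζ/2`.
  have hsmall : ∀ᶠ r in 𝓝[<] t, D.a * f r ^ ((1 + (D.α : ℝ)) / 2) < D.ζ / 4 := by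
    have h1 := (hflim.rpow_const (Or.inr hφ.le)).const_mul D.a
    rw [Real.zero_rpow hφ.ne', mul_zero] at h1
    exact h1.eventually (eventually_lt_nhds (by linarith [hD.ζ_pos]))
  obtain ⟨c, hct, hcsub⟩ := (mem_nhdsLT_iff_exists_Ioo_subset' ht).1
    (((hconst.and hnn).and hsmall).and (Ioo_mem_nhdsLT ht))
  set r₁ : ℝ := (c + t) / 2
  have hct' : c < t := hct
  have hr₁ : c < r₁ := by simp only [r₁]; linarith
  have hr₁t : r₁ < t := by simp only [r₁]; linarith
  have hfge : ∀ r ∈ Ioo r₁ t, D.ζ / 4 * (r - r₁) ≤ f r := by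
    intro r hr
    have hin : ∀ u ∈ Icc r₁ r, u ∈ Ioo c t := fun u hu =>
      ⟨hr₁.trans_le hu.1, hu.2.trans_lt hr.2⟩
    have huT : ∀ u ∈ Ioo c t, 0 < u ∧ (u : EReal) < T := fun u hu =>
      ⟨hset.nonneg.trans_lt (hcsub hu).2.1, (EReal.coe_lt_coe_iff.2 hu.2).trans htT⟩
    have hbu : ∀ u ∈ Ioo c t, D.InBarrier σm χm (x u) := fun u hu => by
      have := hs.inBarrier hD hχ₀ u (huT u hu).1.le (huT u hu).2
      rwa [(hcsub hu).1.1.1.1, (hcsub hu).1.1.1.2] at this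
    have hcont : ContinuousOn f (Icc r₁ r) := by
      intro u hu
      have hu' := hin u hu
      refine ContinuousWithinAt.sub (ContinuousAt.continuousWithinAt ?_)
        ((hD.continuousAt_lyap (hbu u hu') i).comp_continuousWithinAt ?_)
      · refine hs.continuousAt_η hD hχ₀ (huT u hu').1 (huT u hu').2 fun j _ => ?_
        refine Eventually.frequently ?_
        filter_upwards [Ioo_mem_nhdsLT hu'.1] with v hv
        rw [(hcsub hu').1.1.1.1, (hcsub ⟨hv.1, hv.2.trans hu'.2⟩).1.1.1.1]
      · exact (hs.continuous_x u ⟨(huT u hu').1.le, (huT u hu').2⟩).mono fun v hv =>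
          ⟨(huT v (hin v hv)).1.le, (huT v (hin v hv)).2⟩
    have := add_mul_le_of_right_deriv_ge (C := D.ζ / 4) hr.1.le hcont fun u hu => by
      have hu' := hin u (Ico_subset_Icc_self hu)
      have hc := (hcsub hu').1.1.1
      obtain ⟨V', hV', hle⟩ := hk u (hcsub hu').2.1.le (huT u hu').2 (by rw [hc.1, hσm])
      refine ⟨_, (hasDerivWithinAt_pi.1 (hs.deriv_η u (huT u hu').1.le (huT u hu').2) i).sub
        (by rw [hc.1, hc.2] at hV'; exact hV'), ?_⟩
      rw [hc.1, hc.2] at hle ⊢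
      have h4 := (hcsub hu').1.2
      have h5 : D.a * (η u i - D.lyap σm χm (x u) i) ^ ((1 + (D.α : ℝ)) / 2) < D.ζ / 4 := h4
      linarith
    have h0 : 0 ≤ f r₁ := (hcsub ⟨hr₁, hr₁t⟩).1.1.2
    linarith
  have hlim2 : Tendsto (fun r => D.ζ / 4 * (r - r₁)) (𝓝[<] t) (𝓝 (D.ζ / 4 * (t - r₁))) := by
    have : Continuous fun r => D.ζ / 4 * (r - r₁) := by fun_prop
    exact (this.tendsto t).mono_left nhdsWithin_le_nhds
  have h0 := le_of_tendsto_of_tendsto hlim2 hflim (by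
    filter_upwards [Ioo_mem_nhdsLT hr₁t] with r hr using hfge r hr)
  nlinarith [hD.ζ_pos]

end IsClosedLoop
end SwitchingControl

/-! ### Induction over the channels -/

namespace SwitchingControl

/-- At the level `max (f a) L` the right derivative is negative, so the level cannot be crossed. -/
theorem le_max_of_right_deriv_le {f : ℝ → ℝ} {a b A C L φ : ℝ} (hab : a ≤ b) (hL : 0 ≤ L)
    (hA : 0 ≤ A) (hφ : 0 ≤ φ) (hCL : C < A * L ^ φ) (hf : ContinuousOn f (Icc a b))
    (hf' : ∀ t ∈ Ico a b, ∃ f', HasDerivWithinAt f f' (Ici t) t ∧ f' ≤ -A * f t ^ φ + C) :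
    f b ≤ max (f a) L := by
  refine le_of_right_deriv_neg hf hab (le_max_left _ _) fun t ht => ?_
  obtain ⟨f', h1, h2⟩ := hf' t ht
  refine ⟨f', h1, fun h => ?_⟩
  have h3 : L ^ φ ≤ f t ^ φ := Real.rpow_le_rpow hL (h ▸ le_max_right _ _) hφ
  have := mul_le_mul_of_nonneg_left h3 hA
  linarith

variable {n : ℕ} {D : Design n} {P : Plant n}

theorem Design.Admissible.Q_nonneg (hD : D.Admissible) (i : Fin n) : 0 ≤ D.Q i := by
  refine le_trans (add_nonneg (Finset.sum_nonneg fun j hj => ?_) ?_) (hD.Q_large i).le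
  · exact (hD.c_pos j i (Or.inl (Finset.mem_filter.1 hj).2)).le
  · split_ifs with hi
    · exact (hD.c_pos _ i (Or.inr (by simp only; omega))).le
    · exact le_rfl

/-- Bound of the right-hand side of an auxiliary equation by the barriers. -/
theorem auxRHS_le (hD : D.Admissible) {σ : Fin n → ℕ} {χ x η : Fin n → ℝ} {i : Fin n}
    (hb : D.InBarrier σ χ x) (hη : 0 ≤ η i) :
    auxRHS D σ χ x η i ≤ -D.a * η i ^ ((1 + (D.α : ℝ)) / 2)
      + (∑ j ∈ Finset.univ.filter (fun j : Fin n => j < i), D.c i j * χ j ^ (1 + (D.α : ℝ))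
        + (if hi : (i : ℕ) + 1 < n then
            D.c i ⟨i + 1, hi⟩ * χ ⟨i + 1, hi⟩ ^ (1 + (D.α : ℝ)) else 0) + D.ζ) := by
  have hα := hD.α_pos
  have hs : ∀ j, qpow (D.err σ χ x j) (1 + D.α) ≤ χ j ^ (1 + (D.α : ℝ)) := fun j => by
    rw [hD.qpow_err]
    exact Real.rpow_le_rpow (abs_nonneg _) (hb j).le (by linarith)
  have h1 : ∑ j ∈ Finset.univ.filter (fun j : Fin n => j < i),
        D.c i j * qpow (D.err σ χ x j) (1 + D.α)
      ≤ ∑ j ∈ Finset.univ.filter (fun j : Fin n => j < i), D.c i j * χ j ^ (1 + (D.α : ℝ)) :=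
    Finset.sum_le_sum fun j hj => mul_le_mul_of_nonneg_left (hs j)
      (hD.c_pos i j (Or.inl (Finset.mem_filter.1 hj).2)).le
  have h2 : (if hi : (i : ℕ) + 1 < n then
        D.c i ⟨i + 1, hi⟩ * qpow (D.err σ χ x ⟨i + 1, hi⟩) (1 + D.α) else 0)
      ≤ (if hi : (i : ℕ) + 1 < n then
            D.c i ⟨i + 1, hi⟩ * χ ⟨i + 1, hi⟩ ^ (1 + (D.α : ℝ)) else 0) := by
    split_ifs with hi
    · exact mul_le_mul_of_nonneg_left (hs _) (hD.c_pos i _ (Or.inr rfl)).le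
    · exact le_rfl
  have h3 : 0 ≤ D.Q i * qpow (D.err σ χ x i) (1 + D.α) := by
    rw [hD.qpow_err]
    exact mul_nonneg (hD.Q_nonneg i) (by positivity)
  rw [auxRHS, hD.qpow_aux hη]
  linarith

theorem abs_le_rpow_of_opow_le {x q R : ℝ} (hq : 0 < q) (h : |opow x (1 / q)| ≤ R) :
    |x| ≤ R ^ q := by
  rw [← opow_inv_left hq.ne' x, abs_opow hq.ne']
  exact Real.rpow_le_rpow (abs_nonneg _) h hq.le

/-- A continuous function on an open interval is bounded on the set of points which are uniformly
away from the ends. -/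
theorem exists_bound_of_le_sq_sub_sq {f : ℝ → ℝ} {b κ : ℝ} (hκ : 0 < κ)
    (hf : ContinuousOn f (Ioo (-b) b)) :
    ∃ R, ∀ s, |s| < b → κ ≤ b ^ 2 - s ^ 2 → |f s| ≤ R := by
  have hK : IsCompact {s : ℝ | |s| ≤ b ∧ κ ≤ b ^ 2 - s ^ 2} := by
    refine (isCompact_Icc (a := -b) (b := b)).of_isClosed_subset ?_ fun s hs => abs_le.1 hs.1
    exact (isClosed_le continuous_abs continuous_const).inter
      (isClosed_le continuous_const (continuous_const.sub (continuous_pow 2)))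
  obtain ⟨R, hR⟩ := hK.exists_bound_of_continuousOn (f := f) (hf.mono fun s hs => by
    have hb : 0 ≤ b := (abs_nonneg s).trans hs.1
    exact abs_lt.1 (abs_lt_of_sq_lt_sq (by linarith [hs.2]) hb))
  exact ⟨R, fun s h1 h2 => hR s ⟨h1.le, h2⟩⟩

namespace IsClosedLoop
variable {x₀ χ₀ : Fin n → ℝ} {T : EReal} {x η χ : ℝ → Fin n → ℝ} {σ : ℝ → Fin n → ℕ}

theorem settled_zero (hs : IsClosedLoop D P x₀ χ₀ T x η χ σ) (hD : D.Admissible)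
    (hχ₀ : ∀ i, |D.err (fun _ => 1) χ₀ x₀ i| < χ₀ i) (hT : 0 < T) :
    ∃ M, Settled D T x η χ σ 0 0 M := by
  have hpos : ∀ j, 0 < χ₀ j := fun j => (abs_nonneg _).trans_lt (hχ₀ j)
  have hM : 0 ≤ ∑ j, χ₀ j := Finset.sum_nonneg fun j _ => (hpos j).le
  refine ⟨∑ j, χ₀ j, le_rfl, hT, fun _ _ _ _ h => absurd h (Nat.not_lt_zero _), ?_, ?_,
    fun _ _ _ _ h => absurd h (Nat.not_lt_zero _), ?_⟩
  · intro t ht htT j hj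
    have h1 := hs.inBarrier hD hχ₀ t ht htT j
    have hj0 : (j : ℕ) = 0 := by omega
    rw [hs.χ_const hD hχ₀ le_rfl (i := 0) (fun _ _ _ _ h => absurd h (Nat.not_lt_zero _)) t ht htT
      j hj, hs.init_χ, hD.err_eq, hj0, D.root_zero, Design.q] at h1
    simp only [Rat.cast_one, div_one, opow_one, sub_zero] at h1
    exact h1.le.trans (Finset.single_le_sum (f := χ₀) (fun j _ => (hpos j).le)
      (Finset.mem_univ j))
  · intro t _ _ j hj
    obtain rfl : j = 0 := by omega
    rwa [Design.virtualControl, abs_zero]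
  · intro t _ _
    refine ⟨0, by rwa [abs_zero], ?_⟩
    simp_rw [D.root_zero]
    exact hasDerivWithinAt_const _ _ _

/-- The switching signal of a channel is finally constant if the preceding channels have
settled. -/
theorem exists_σ_const (hs : IsClosedLoop D P x₀ χ₀ T x η χ σ) (hD : D.Admissible)
    (hP : P.Admissible) (hχ₀ : ∀ i, |D.err (fun _ => 1) χ₀ x₀ i| < χ₀ i) {i : Fin n} {t₀ M : ℝ}
    (hset : Settled D T x η χ σ i t₀ M) :
    ∃ t₁ : ℝ, t₀ ≤ t₁ ∧ (t₁ : EReal) < T ∧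
      ∀ t : ℝ, t₁ ≤ t → (t : EReal) < T → σ t i = σ t₁ i := by
  -- The signal rises in unit steps, so it cannot jump over the value `k`, and `k` is never left
  -- once it is reached.
  obtain ⟨k, hk, hkeep⟩ := hs.exists_no_switching hD hP hχ₀ hset (σ t₀ i)
  have hle : ∀ t : ℝ, t₀ ≤ t → (t : EReal) < T → σ t i ≤ k := by
    refine real_interval_induction (fun t ht htT hprev => ?_) (fun t ht htT hp => ?_)
    · rcases ht.eq_or_lt with rfl | ht0
      · exact hk
      · obtain ⟨σm, χm, ηm, hconst, -, -, hσ, -, -⟩ :=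
          hs.left_values hD hχ₀ (hset.nonneg.trans_lt ht0) htT
        obtain ⟨r, hr, hr0⟩ := (hconst.and (Ioo_mem_nhdsLT ht0)).exists
        have h1 := hprev r hr0.1.le hr0.2
        rw [hr.1] at h1
        rcases h1.eq_or_lt with h | h
        · exact (hkeep t ht0 htT (hconst.mono fun r hr => by rw [hr.1, h])).le
        · rcases hσ i with h2 | ⟨h2, -⟩ <;> omega
    · filter_upwards [hs.const_right t (hset.nonneg.trans ht) htT] with r hr
      rwa [hr.1]
  have hmono : ∀ t₁ : ℝ, t₀ ≤ t₁ → ∀ t : ℝ, t₁ ≤ t → (t : EReal) < T → σ t₁ i ≤ σ t i := by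
    intro t₁ ht₁
    refine real_interval_induction (fun t ht htT hprev => ?_) (fun t ht htT hp => ?_)
    · rcases ht.eq_or_lt with rfl | ht0
      · exact le_rfl
      · obtain ⟨σm, χm, ηm, hconst, -, -, hσ, -, -⟩ :=
          hs.left_values hD hχ₀ ((hset.nonneg.trans ht₁).trans_lt ht0) htT
        obtain ⟨r, hr, hr0⟩ := (hconst.and (Ioo_mem_nhdsLT ht0)).exists
        have h1 := hprev r hr0.1.le hr0.2
        rw [hr.1] at h1
        rcases hσ i with h2 | ⟨h2, -⟩ <;> omega
    · filter_upwards [hs.const_right t ((hset.nonneg.trans ht₁).trans ht) htT] with r hr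
      rwa [hr.1]
  -- A bounded set of naturals contains its supremum. By monotonicity the signal is constant from a
  -- time at which it takes this maximal value.
  set S : Set ℕ := {m | ∃ t : ℝ, t₀ ≤ t ∧ (t : EReal) < T ∧ σ t i = m} with hS
  have hSne : S.Nonempty := ⟨_, t₀, le_rfl, hset.lt, rfl⟩
  have hSb : BddAbove S := ⟨k, by rintro m ⟨t, h1, h2, rfl⟩; exact hle t h1 h2⟩
  obtain ⟨t₁, h1, h2, h3⟩ := Nat.sSup_mem hSne hSb
  refine ⟨t₁, h1, h2, fun t ht htT => le_antisymm ?_ (hmono t₁ h1 t ht htT)⟩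
  rw [h3]
  exact le_csSup hSb ⟨t, h1.trans ht, htT, rfl⟩

theorem continuousOn_η (hs : IsClosedLoop D P x₀ χ₀ T x η χ σ) (hD : D.Admissible)
    (hχ₀ : ∀ i, |D.err (fun _ => 1) χ₀ x₀ i| < χ₀ i) {t₁ b : ℝ} (ht₁ : 0 ≤ t₁)
    (hb : (b : EReal) < T) {i : Fin n}
    (hσ : ∀ t : ℝ, t₁ ≤ t → (t : EReal) < T → ∀ j ≤ i, σ t j = σ t₁ j) :
    ContinuousOn (fun t => η t i) (Icc t₁ b) := by
  intro t ht
  have htT : (t : EReal) < T := (EReal.coe_le_coe_iff.2 ht.2).trans_lt hb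
  rcases ht.1.eq_or_lt with rfl | h
  · exact ((hasDerivWithinAt_pi.1 (hs.deriv_η t₁ ht₁ htT) i).continuousWithinAt).mono
      Icc_subset_Ici_self
  · refine (hs.continuousAt_η hD hχ₀ (ht₁.trans_lt h) htT fun j hj => ?_).continuousWithinAt
    refine Eventually.frequently ?_
    filter_upwards [Ioo_mem_nhdsLT h] with r hr
    rw [hσ t ht.1 htT j hj, hσ r hr.1.le ((EReal.coe_lt_coe_iff.2 hr.2).trans htT) j hj]

theorem settled_succ (hs : IsClosedLoop D P x₀ χ₀ T x η χ σ) (hD : D.Admissible)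
    (hP : P.Admissible) (hχ₀ : ∀ i, |D.err (fun _ => 1) χ₀ x₀ i| < χ₀ i) {i : Fin n} {t₀ M : ℝ}
    (hset : Settled D T x η χ σ i t₀ M) : ∃ t₁ M', Settled D T x η χ σ (i + 1) t₁ M' := by
  obtain ⟨t₁, ht₀₁, ht₁T, hσi⟩ := hs.exists_σ_const hD hP hχ₀ hset
  have hM : 0 ≤ M := (abs_nonneg _).trans (hset.x_le t₀ le_rfl hset.lt i le_rfl)
  have ht₁ : 0 ≤ t₁ := hset.nonneg.trans ht₀₁
  have hα := hD.α_pos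
  have hqi := hD.q_pos' i.2.le
  have hσ : ∀ t : ℝ, t₁ ≤ t → (t : EReal) < T → ∀ j : Fin n, (j : ℕ) < i + 1 →
      σ t j = σ t₁ j := by
    intro t ht htT j hj
    rcases (Nat.lt_succ_iff.1 hj).eq_or_lt with h | h
    · rw [Fin.ext h]; exact hσi t ht htT
    · rw [hset.σ_const t (ht₀₁.trans ht) htT j h, hset.σ_const t₁ ht₀₁ ht₁T j h]
  have hχ := hs.χ_const hD hχ₀ ht₁ hσ
  have hbar : ∀ t : ℝ, t₁ ≤ t → (t : EReal) < T → D.InBarrier (σ t) (χ t) (x t) :=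
    fun t ht htT => hs.inBarrier hD hχ₀ t (ht₁.trans ht) htT
  -- the auxiliary variable
  obtain ⟨B, hB⟩ : ∃ B, ∀ t : ℝ, t₁ ≤ t → (t : EReal) < T → η t i ≤ B := by
    set C : ℝ := ∑ j ∈ Finset.univ.filter (fun j : Fin n => j < i),
        D.c i j * χ t₁ j ^ (1 + (D.α : ℝ)) + (if hi : (i : ℕ) + 1 < n then
          D.c i ⟨i + 1, hi⟩ * χ t₁ ⟨i + 1, hi⟩ ^ (1 + (D.α : ℝ)) else 0) + D.ζ with hC
    have hlim : Tendsto (fun L : ℝ => D.a * L ^ ((1 + (D.α : ℝ)) / 2)) atTop atTop :=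
      (tendsto_rpow_atTop (by linarith)).const_mul_atTop hD.a_pos
    -- At the level `L` the damping outweighs the coupling terms, which the constant barriers bound
    -- by `C`.
    obtain ⟨L, hL1, hL0⟩ := ((hlim.eventually (eventually_gt_atTop C)).and
      (eventually_ge_atTop 0)).exists
    refine ⟨max (η t₁ i) L, fun t ht htT => ?_⟩
    refine le_max_of_right_deriv_le (f := fun t => η t i) ht hL0 hD.a_pos.le
      (by linarith : 0 ≤ (1 + (D.α : ℝ)) / 2) hL1
      (hs.continuousOn_η hD hχ₀ ht₁ htT fun t ht htT j hj => hσ t ht htT j (Nat.lt_succ_of_le hj))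
      fun r hr => ?_
    have hrT : (r : EReal) < T := (EReal.coe_lt_coe_iff.2 hr.2).trans htT
    have hr0 := ht₁.trans hr.1
    refine ⟨_, hasDerivWithinAt_pi.1 (hs.deriv_η r hr0 hrT) i, ?_⟩
    have h1 := auxRHS_le hD (i := i) (η := η r) (hbar r hr.1 hrT)
      ((hD.lyap_nonneg (hbar r hr.1 hrT i)).trans (hs.lyap_le_η hr0 hrT i))
    have h2 : ∑ j ∈ Finset.univ.filter (fun j : Fin n => j < i),
        D.c i j * χ r j ^ (1 + (D.α : ℝ)) = ∑ j ∈ Finset.univ.filter (fun j : Fin n => j < i),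
        D.c i j * χ t₁ j ^ (1 + (D.α : ℝ)) := Finset.sum_congr rfl fun j hj => by
      rw [hχ r hr.1 hrT j (by have := (Finset.mem_filter.1 hj).2; omega)]
    have h3 : (if hi : (i : ℕ) + 1 < n then
          D.c i ⟨i + 1, hi⟩ * χ r ⟨i + 1, hi⟩ ^ (1 + (D.α : ℝ)) else 0)
        = (if hi : (i : ℕ) + 1 < n then
          D.c i ⟨i + 1, hi⟩ * χ t₁ ⟨i + 1, hi⟩ ^ (1 + (D.α : ℝ)) else 0) := by
      split_ifs with hi
      · rw [hχ r hr.1 hrT ⟨i + 1, hi⟩ le_rfl]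
      · rfl
    rwa [h2, h3] at h1
  -- the error stays away from the barrier
  have hb : 0 < χ t₁ i := (hbar t₁ le_rfl ht₁T).pos i
  obtain ⟨κ, hκ, hκb⟩ := exists_le_sq_sub_sq_of_barrierInt_le hqi (hD.q_le_one i) hb B
    (M ^ (1 / (D.q i : ℝ)))
  have hstrict : ∀ t : ℝ, t₁ ≤ t → (t : EReal) < T → |D.err (σ t) (χ t) (x t) i| < χ t₁ i ∧
      κ ≤ χ t₁ i ^ 2 - D.err (σ t) (χ t) (x t) i ^ 2 := by
    intro t ht htT
    have h1 := hbar t ht htT i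
    have h2 := hs.lyap_le_η (ht₁.trans ht) htT i
    have h3 := hχ t ht htT i (Nat.le_succ _)
    rw [hD.lyap_eq h1, h3] at h2
    rw [h3] at h1
    refine ⟨h1, ?_⟩
    rw [hD.err_eq] at h1 ⊢
    refine hκb _ _ ?_ h1 (h2.trans (hB t ht htT))
    rw [Design.root, abs_opow (one_div_pos.2 hqi).ne']
    exact Real.rpow_le_rpow (abs_nonneg _) (hset.control_le t (ht₀₁.trans ht) htT i le_rfl)
      (one_div_pos.2 hqi).le
  -- the next virtual control
  have hsm := contDiffOn_rootLaw (γ := D.gain i (σ t₁ i)) (b := χ t₁ i) (q := D.q (i + 1))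
    (α := D.α) (hD.K_pos i) (hD.U_pos i)
  obtain ⟨R₁, hR₁⟩ := exists_bound_of_le_sq_sub_sq hκ hsm.continuousOn
  obtain ⟨R₂, hR₂⟩ := exists_bound_of_le_sq_sub_sq hκ
    (hsm.continuousOn_deriv_of_isOpen isOpen_Ioo le_rfl)
  have hroot : ∀ t : ℝ, t₁ ≤ t → (t : EReal) < T →
      |D.root (σ t) (χ t) (x t) (i + 1)| ≤ R₁ := by
    intro t ht htT
    obtain ⟨h1, h2⟩ := hstrict t ht htT
    rw [hD.root_succ (hbar t ht htT i), hσi t ht htT, hχ t ht htT i (Nat.le_succ _)]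
    exact hR₁ _ h1 h2
  have hR₁0 : 0 ≤ R₁ := (abs_nonneg _).trans (hroot t₁ le_rfl ht₁T)
  have hcontrol : ∀ t : ℝ, t₁ ≤ t → (t : EReal) < T →
      |D.virtualControl (σ t) (χ t) (x t) (i + 1)| ≤ R₁ ^ (D.q (i + 1) : ℝ) := fun t ht htT =>
    abs_le_rpow_of_opow_le (hD.q_pos' i.2) (hroot t ht htT)
  -- the next state
  obtain ⟨Mx, hMx⟩ : ∃ Mx, ∀ t : ℝ, t₁ ≤ t → (t : EReal) < T → ∀ hi : (i : ℕ) + 1 < n,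
      |x t ⟨i + 1, hi⟩| ≤ Mx := by
    by_cases hi : (i : ℕ) + 1 < n
    · refine ⟨(χ t₁ ⟨i + 1, hi⟩ + R₁) ^ (D.q (i + 1) : ℝ), fun t ht htT _ => ?_⟩
      refine abs_le_rpow_of_opow_le (hD.q_pos' i.2) ?_
      have h1 := hbar t ht htT ⟨i + 1, hi⟩
      rw [hχ t ht htT ⟨i + 1, hi⟩ le_rfl, hD.err_eq] at h1
      have h2 := hroot t ht htT
      have h3 := abs_sub_abs_le_abs_sub (opow (x t ⟨i + 1, hi⟩) (1 / (D.q (i + 1) : ℝ)))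
        (D.root (σ t) (χ t) (x t) (i + 1))
      simp only at h1
      linarith
    · exact ⟨0, fun _ _ _ h => absurd h hi⟩
  -- the derivative of the state
  obtain ⟨H, hH⟩ := (isCompact_closedBall (0 : Fin (i + 1) → ℝ) M).exists_bound_of_continuousOn
    (hP.contDiff_h i).continuous.continuousOn
  obtain ⟨F, hF⟩ := (isCompact_closedBall (0 : Fin (i + 1) → ℝ) M).exists_bound_of_continuousOn
    (hP.contDiff_f i).continuous.continuousOn
  have hdx : ∀ t : ℝ, t₁ ≤ t → (t : EReal) < T →
      |stateRHS D P (σ t) (χ t) (x t) i| ≤ H * (|Mx| + R₁ ^ (D.q (i + 1) : ℝ)) + F := by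
    intro t ht htT
    have hz : ‖fun j : Fin (i + 1) => x t ⟨j, by omega⟩‖ ≤ M :=
      norm_restrict_le hM (hset.x_le t (ht₀₁.trans ht) htT)
    have h1 := hH _ (mem_closedBall_zero_iff.2 hz)
    have h2 := hF _ (mem_closedBall_zero_iff.2 hz)
    rw [Real.norm_eq_abs] at h1 h2
    rw [stateRHS]
    refine (abs_add_le _ _).trans (add_le_add ?_ h2)
    rw [abs_mul]
    refine mul_le_mul h1 ?_ (abs_nonneg _) ((abs_nonneg _).trans h1)
    split_ifs with hi
    · have := hMx t ht htT hi
      have h4 : 0 ≤ R₁ ^ (D.q (i + 1) : ℝ) := by positivity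
      linarith [le_abs_self Mx]
    · have h3 := hcontrol t ht htT
      have : (i : ℕ) + 1 = n := by omega
      rw [Design.input]
      rw [this] at h3 ⊢
      linarith [abs_nonneg Mx]
  set G : ℝ := H * (|Mx| + R₁ ^ (D.q (i + 1) : ℝ)) + F
  have hG : 0 ≤ G := (abs_nonneg _).trans (hdx t₁ le_rfl ht₁T)
  have hq1 : 0 ≤ 1 / (D.q i : ℝ) - 1 := by
    have := (one_le_div hqi).2 (hD.q_le_one i)
    linarith
  set Md : ℝ := R₂ * (1 / (D.q i : ℝ) * M ^ (1 / (D.q i : ℝ) - 1) * G + M) with hMd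
  have hRq : 0 ≤ R₁ ^ (D.q (i + 1) : ℝ) := by positivity
  have hmaxM : M ≤ M + R₁ ^ (D.q (i + 1) : ℝ) + |Mx| + |B| + |Md| := by
    linarith [abs_nonneg Mx, abs_nonneg B, abs_nonneg Md]
  refine ⟨t₁, M + R₁ ^ (D.q (i + 1) : ℝ) + |Mx| + |B| + |Md|, ht₁, ht₁T, hσ, ?_, ?_, ?_, ?_⟩
  · intro t ht htT j hj
    rcases hj.eq_or_lt with h | h
    · obtain ⟨j, hj'⟩ := j
      simp only at h
      subst h
      have := hMx t ht htT hj'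
      linarith [le_abs_self Mx, abs_nonneg B, abs_nonneg Md]
    · exact (hset.x_le t (ht₀₁.trans ht) htT j (Nat.lt_succ_iff.1 h)).trans hmaxM
  · intro t ht htT j hj
    rcases hj.eq_or_lt with h | h
    · rw [h]
      have := hcontrol t ht htT
      linarith [abs_nonneg Mx, abs_nonneg B, abs_nonneg Md]
    · exact (hset.control_le t (ht₀₁.trans ht) htT j (Nat.lt_succ_iff.1 h)).trans hmaxM
  · intro t ht htT j hj
    rcases (Nat.lt_succ_iff.1 hj).eq_or_lt with h | h
    · rw [Fin.ext h, abs_of_nonneg ((hD.lyap_nonneg (hbar t ht htT i)).trans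
        (hs.lyap_le_η (ht₁.trans ht) htT i))]
      have := hB t ht htT
      linarith [abs_nonneg Mx, le_abs_self B, abs_nonneg Md]
    · exact (hset.η_le t (ht₀₁.trans ht) htT j h).trans hmaxM
  · intro t ht htT
    obtain ⟨d, hd, hder⟩ := hset.root_deriv t (ht₀₁.trans ht) htT
    refine ⟨_, ?_, hD.hasDerivWithinAt_root_succ (hbar t ht htT)
      (hs.deriv_x t (ht₁.trans ht) htT) hder⟩
    obtain ⟨h1, h2⟩ := hstrict t ht htT
    rw [hσi t ht htT, hχ t ht htT i (Nat.le_succ _), abs_mul]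
    have h3 := hR₂ _ h1 h2
    have h4 : |1 / (D.q i : ℝ) * |x t i| ^ (1 / (D.q i : ℝ) - 1)
          * stateRHS D P (σ t) (χ t) (x t) i - d|
        ≤ 1 / (D.q i : ℝ) * M ^ (1 / (D.q i : ℝ) - 1) * G + M := by
      refine (abs_sub _ _).trans (add_le_add ?_ hd)
      rw [abs_mul, abs_of_nonneg (a := 1 / (D.q i : ℝ) * |x t i| ^ (1 / (D.q i : ℝ) - 1))
        (by positivity)]
      have h5 := hset.x_le t (ht₀₁.trans ht) htT i le_rfl
      have h6 := hdx t ht htT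
      gcongr
    have h5 := mul_le_mul h3 h4 (abs_nonneg _) ((abs_nonneg _).trans h3)
    linarith [abs_nonneg Mx, abs_nonneg B, le_abs_self Md]

/-- Every channel settles. -/
theorem exists_settled (hs : IsClosedLoop D P x₀ χ₀ T x η χ σ) (hD : D.Admissible)
    (hP : P.Admissible) (hχ₀ : ∀ i, |D.err (fun _ => 1) χ₀ x₀ i| < χ₀ i) (hT : 0 < T) :
    ∃ t₀ M, Settled D T x η χ σ n t₀ M := by
  have : ∀ i ≤ n, ∃ t₀ M, Settled D T x η χ σ i t₀ M := by
    intro i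
    induction i with
    | zero => exact fun _ => ⟨0, hs.settled_zero hD hχ₀ hT⟩
    | succ i ih =>
      intro hi
      obtain ⟨t₀, M, h⟩ := ih (by omega)
      exact hs.settled_succ hD hP hχ₀ (i := ⟨i, hi⟩) h
  exact this n le_rfl

end IsClosedLoop
end SwitchingControl

/-! ### Existence and continuation of solutions -/

namespace SwitchingControl

/-- A bounded right derivative makes `f` Lipschitz on `[a, b)`, and a Lipschitz function extends
continuously to `b`. -/
theorem exists_tendsto_of_right_deriv_bounded {f : ℝ → ℝ} {a b C : ℝ} (hab : a < b)
    (hf : ∀ c < b, ContinuousOn f (Icc a c))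
    (hf' : ∀ t ∈ Ico a b, ∃ f', HasDerivWithinAt f f' (Ici t) t ∧ |f'| ≤ C) :
    ∃ L, Tendsto f (𝓝[<] b) (𝓝 L) := by
  have hC : 0 ≤ C := by
    obtain ⟨f', -, h⟩ := hf' a ⟨le_rfl, hab⟩
    exact (abs_nonneg _).trans h
  have hlip : LipschitzOnWith (Real.toNNReal C) f (Ico a b) := by
    refine LipschitzOnWith.of_dist_le_mul fun s hs t ht => ?_
    rw [Real.coe_toNNReal _ hC]
    wlog hst : s ≤ t generalizing s t
    · rw [dist_comm, dist_comm s]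
      exact this t ht s hs (le_of_not_ge hst)
    choose! f' h1 h2 using hf'
    have := norm_image_sub_le_of_norm_deriv_right_le_segment (f := f) (f' := f') (C := C)
      ((hf t ht.2).mono (Icc_subset_Icc_left hs.1))
      (fun r hr => h1 r ⟨hs.1.trans hr.1, hr.2.trans ht.2⟩)
      (fun r hr => h2 r ⟨hs.1.trans hr.1, hr.2.trans ht.2⟩) t ⟨hst, le_rfl⟩
    rw [dist_comm, dist_comm s, Real.dist_eq, Real.dist_eq, abs_of_nonneg (sub_nonneg.2 hst)]
    exact this
  obtain ⟨g, hg, heq⟩ := hlip.extend_real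
  refine ⟨g b, ((hg.continuous.tendsto b).mono_left nhdsWithin_le_nhds).congr' ?_⟩
  filter_upwards [Ioo_mem_nhdsLT hab] with t ht
  exact (heq ⟨ht.1.le, ht.2⟩).symm

variable {n : ℕ} {D : Design n} {P : Plant n}

/-- Local solutions of the closed loop with fixed adaptive parameters. -/
theorem exists_local_closedLoop (hD : D.Admissible) (hP : P.Admissible) {σ : Fin n → ℕ}
    {χ x : Fin n → ℝ} (hb : D.InBarrier σ χ x) (η : Fin n → ℝ) (t : ℝ) :
    ∃ δ > 0, ∃ y w : ℝ → Fin n → ℝ, y t = x ∧ w t = η ∧ Continuous y ∧ Continuous w ∧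
      ∀ r ∈ Ico t (t + δ),
        HasDerivWithinAt y (stateRHS D P σ χ (y r)) (Ici r) r ∧
        HasDerivWithinAt w (auxRHS D σ χ (y r) (w r)) (Ici r) r := by
  have hF : ∀ᶠ z in 𝓝 (x, η), ContinuousAt (fun z : (Fin n → ℝ) × (Fin n → ℝ) =>
      (stateRHS D P σ χ z.1, auxRHS D σ χ z.1 z.2)) z := by
    have h1 : ∀ᶠ z : (Fin n → ℝ) × (Fin n → ℝ) in 𝓝 (x, η), D.InBarrier σ χ z.1 :=
      continuousAt_fst.eventually (hD.eventually_inBarrier hb)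
    filter_upwards [h1] with z hz
    exact ((hD.continuousAt_stateRHS hP hz).comp_of_eq continuousAt_fst rfl).prodMk
      (hD.continuousAt_auxRHS hz z.2)
  obtain ⟨δ, hδ, y, hy0, hyc, hy⟩ := exists_local_solution hF t
  refine ⟨δ, hδ, fun r => (y r).1, fun r => (y r).2, by simp only [hy0], by simp only [hy0],
    continuous_fst.comp hyc, continuous_snd.comp hyc, fun r hr => ?_⟩
  have h := (hy r hr).hasFDerivWithinAt
  exact ⟨h.fst.hasDerivWithinAt.congr_deriv (by simp), h.snd.hasDerivWithinAt.congr_deriv (by simp)⟩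

/-- If the event does not occur, or the supervisory functions are negative, then there is a local
solution with supervisory functions that are not positive. -/
theorem exists_local_admissible (hD : D.Admissible) (hP : P.Admissible) {σ : Fin n → ℕ}
    {χ x η : Fin n → ℝ} (hb : D.InBarrier σ χ x) {t : ℝ} (hV : ∀ i, D.superv σ χ x η i ≤ 0)
    (h : ¬ Event D P t σ χ x η ∨ ∀ i, D.superv σ χ x η i < 0) :
    ∃ δ > 0, ∃ y w : ℝ → Fin n → ℝ, y t = x ∧ w t = η ∧ Continuous y ∧ Continuous w ∧
      ∀ r ∈ Ico t (t + δ),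
        HasDerivWithinAt y (stateRHS D P σ χ (y r)) (Ici r) r ∧
        HasDerivWithinAt w (auxRHS D σ χ (y r) (w r)) (Ici r) r ∧
        ∀ i, D.superv σ χ (y r) (w r) i ≤ 0 := by
  obtain ⟨δ, hδ, y, w, hy0, hw0, hyc, hwc, hder⟩ := exists_local_closedLoop hD hP hb η t
  have hev : ∀ᶠ r in 𝓝[>] t, ∀ i, D.superv σ χ (y r) (w r) i ≤ 0 := by
    rcases h with h | h
    -- If positive values occurred arbitrarily soon, this local solution would itself witness the
    -- event.
    · by_contra hcon
      refine h ⟨δ, hδ, y, w, hy0, hw0, hyc.continuousOn, hwc.continuousOn, hder, fun hno => hcon ?_⟩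
      filter_upwards [hno] with r hr i
      exact not_lt.1 fun hi => hr ⟨i, hi⟩
    · refine eventually_all.2 fun i => ?_
      have hc : ContinuousAt (fun r => D.superv σ χ (y r) (w r) i) t :=
        ((hD.continuousAt_lyap hb i).comp_of_eq hyc.continuousAt hy0).sub
          ((continuous_apply i).comp hwc).continuousAt
      have hlt : D.superv σ χ (y t) (w t) i < 0 := by rw [hy0, hw0]; exact h i
      exact ((hc.eventually (eventually_lt_nhds hlt)).filter_mono nhdsWithin_le_nhds).mono
        fun r hr => hr.le
  obtain ⟨u, hu, hsub⟩ := mem_nhdsGT_iff_exists_Ioo_subset.1 hev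
  have hu' : t < u := hu
  refine ⟨min δ (u - t), lt_min hδ (by linarith), y, w, hy0, hw0, hyc, hwc, fun r hr => ?_⟩
  have h1 : r < t + δ := hr.2.trans_le (by gcongr; exact min_le_left _ _)
  have h2 : r < u := hr.2.trans_le (by linarith [min_le_right δ (u - t)])
  refine ⟨(hder r ⟨hr.1, h1⟩).1, (hder r ⟨hr.1, h1⟩).2, fun i => ?_⟩
  rcases hr.1.eq_or_lt with h3 | h3
  · rw [← h3, hy0, hw0]; exact hV i
  · exact hsub ⟨h3, h2⟩ i

/-- The conditions on the new barriers look circular but are triangular: the error of a channel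
depends on the new barriers of earlier channels only, so they are determined successively. -/
theorem exists_update (D : Design n) (x : Fin n → ℝ) (σ : Fin n → ℕ) (χ η : Fin n → ℝ) :
    ∃ σ' χ' η', Update D x σ χ η σ' χ' η' := by
  set σ' : Fin n → ℕ := fun i => if 0 ≤ D.superv σ χ x η i then σ i + 1 else σ i
  have hrec : ∀ k ≤ n, ∃ χ' : Fin n → ℝ, ∀ i : Fin n, (i : ℕ) < k →
      χ' i = if |χ i| ≤ |D.err σ' χ' x i| then |D.err σ' χ' x i| + D.ς else χ i := by
    intro k
    induction k with
    | zero => exact fun _ => ⟨χ, fun _ h => absurd h (Nat.not_lt_zero _)⟩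
    | succ k ih =>
      intro hk
      obtain ⟨χ', hχ'⟩ := ih (by omega)
      set v : ℝ := if |χ ⟨k, hk⟩| ≤ |D.err σ' χ' x ⟨k, hk⟩| then |D.err σ' χ' x ⟨k, hk⟩| + D.ς
        else χ ⟨k, hk⟩
      have herr : ∀ i : Fin n, (i : ℕ) < k + 1 →
          D.err σ' (Function.update χ' ⟨k, hk⟩ v) x i = D.err σ' χ' x i := fun i hi =>
        D.err_congr x fun j hj => ⟨rfl, Function.update_of_ne (by
          rintro rfl
          have : k < (i : ℕ) := hj
          omega) _ _⟩
      refine ⟨Function.update χ' ⟨k, hk⟩ v, fun i hi => ?_⟩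
      rw [herr i hi]
      rcases (Nat.lt_succ_iff.1 hi).eq_or_lt with h | h
      · obtain rfl : i = ⟨k, hk⟩ := Fin.ext h
        rw [Function.update_self]
      · rw [Function.update_of_ne (by rintro rfl; exact absurd h (lt_irrefl _))]
        exact hχ' i h
  obtain ⟨χ', hχ'⟩ := hrec n le_rfl
  exact ⟨σ', χ', _, fun _ => rfl, fun i => hχ' i i.2, fun _ => rfl⟩

/-- The strict inequality lets the solution run on for a while after an update, without a second
event at the same instant. -/
theorem Update.superv_neg {σ σ' : Fin n → ℕ} {χ χ' η η' x : Fin n → ℝ} (hD : D.Admissible)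
    (h : Update D x σ χ η σ' χ' η') (i : Fin n) : D.superv σ' χ' x η' i < 0 := by
  have h1 := h.2.2 i
  rw [Design.superv]
  split_ifs at h1 with h2
  · rw [h1]; linarith [hD.ε_pos]
  · rw [h1]; linarith

/-- The closed loop is a local notion. -/
theorem IsClosedLoop.of_local {x₀ χ₀ : Fin n → ℝ} {T : EReal} (hT : 0 < T)
    {x η χ : ℝ → Fin n → ℝ} {σ : ℝ → Fin n → ℕ}
    (h : ∀ t : ℝ, 0 ≤ t → (t : EReal) < T → ∃ (T' : EReal) (x' η' χ' : ℝ → Fin n → ℝ)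
      (σ' : ℝ → Fin n → ℕ), IsClosedLoop D P x₀ χ₀ T' x' η' χ' σ' ∧ (t : EReal) < T' ∧
      ∀ r : ℝ, 0 ≤ r → (r : EReal) < T' → x r = x' r ∧ η r = η' r ∧ χ r = χ' r ∧ σ r = σ' r) :
    IsClosedLoop D P x₀ χ₀ T x η χ σ := by
  have hright : ∀ {t : ℝ} {T' : EReal}, 0 ≤ t → (t : EReal) < T' →
      ∀ᶠ r : ℝ in 𝓝[≥] t, 0 ≤ r ∧ (r : EReal) < T' := fun {t T'} ht htT => by
    filter_upwards [nhdsWithin_le_nhds (eventually_coe_lt htT), self_mem_nhdsWithin] with r h1 h2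
    exact ⟨ht.trans h2, h1⟩
  have hleft : ∀ {t : ℝ} {T' : EReal}, 0 < t → (t : EReal) < T' →
      ∀ᶠ r : ℝ in 𝓝[<] t, 0 ≤ r ∧ (r : EReal) < T' := fun {t T'} ht htT => by
    filter_upwards [Ioo_mem_nhdsLT ht] with r hr
    exact ⟨hr.1.le, (EReal.coe_lt_coe_iff.2 hr.2).trans htT⟩
  obtain ⟨T', x', η', χ', σ', hs, h0, heq⟩ := h 0 le_rfl hT
  obtain ⟨e1, e2, e3, e4⟩ := heq 0 le_rfl h0
  refine ⟨by rw [e1, hs.init_x], by rw [e4]; exact hs.init_σ, by rw [e3, hs.init_χ],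
    by rw [e2, e4]; exact hs.init_η, ?_, ?_, ?_, ?_, ?_, ?_⟩
  · intro t ht
    obtain ⟨T', x', η', χ', σ', hs, h0, heq⟩ := h t ht.1 ht.2
    have h1 := hs.continuous_x t ⟨ht.1, h0⟩
    have h2 : ContinuousWithinAt x' {t : ℝ | 0 ≤ t ∧ (t : EReal) < T} t := by
      refine h1.mono_of_mem_nhdsWithin ?_
      filter_upwards [nhdsWithin_le_nhds (eventually_coe_lt h0), self_mem_nhdsWithin] with r h1 h2
      exact ⟨h2.1, h1⟩
    refine h2.congr_of_eventuallyEq ?_ (heq t ht.1 h0).1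
    filter_upwards [nhdsWithin_le_nhds (eventually_coe_lt h0), self_mem_nhdsWithin] with r h1 h2
    exact (heq r h2.1 h1).1
  · intro t ht htT
    obtain ⟨T', x', η', χ', σ', hs, h0, heq⟩ := h t ht htT
    obtain ⟨e1, e2, e3, e4⟩ := heq t ht h0
    rw [e1, e3, e4]
    refine (hs.deriv_x t ht h0).congr_of_eventuallyEq ?_ e1
    filter_upwards [hright ht h0] with r hr using (heq r hr.1 hr.2).1
  · intro t ht htT
    obtain ⟨T', x', η', χ', σ', hs, h0, heq⟩ := h t ht htT
    obtain ⟨e1, e2, e3, e4⟩ := heq t ht h0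
    rw [e1, e2, e3, e4]
    refine (hs.deriv_η t ht h0).congr_of_eventuallyEq ?_ e2
    filter_upwards [hright ht h0] with r hr using (heq r hr.1 hr.2).2.1
  · intro t ht htT
    obtain ⟨T', x', η', χ', σ', hs, h0, heq⟩ := h t ht htT
    obtain ⟨e1, e2, e3, e4⟩ := heq t ht h0
    filter_upwards [hs.const_right t ht h0,
      nhdsWithin_mono _ Ioi_subset_Ici_self (hright ht h0)] with r h1 h2
    obtain ⟨f1, f2, f3, f4⟩ := heq r h2.1 h2.2
    rw [e3, e4, f3, f4]; exact h1
  · intro t ht htT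
    obtain ⟨T', x', η', χ', σ', hs, h0, heq⟩ := h t ht htT
    obtain ⟨e1, e2, e3, e4⟩ := heq t ht h0
    rw [e1, e2, e3, e4]
    exact hs.superv_nonpos t ht h0
  · intro t ht htT
    obtain ⟨T', x', η', χ', σ', hs, h0, heq⟩ := h t ht.le htT
    obtain ⟨e1, e2, e3, e4⟩ := heq t ht.le h0
    obtain ⟨σm, χm, ηm, hconst, hη, halt⟩ := hs.logic t ht h0
    refine ⟨σm, χm, ηm, ?_, hη.congr' ?_, by rwa [e1, e2, e3, e4]⟩
    · filter_upwards [hconst, hleft ht h0] with r h1 h2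
      obtain ⟨f1, f2, f3, f4⟩ := heq r h2.1 h2.2
      rw [f3, f4]; exact h1
    · filter_upwards [hleft ht h0] with r h2
      exact (heq r h2.1 h2.2).2.1.symm

/-- A solution up to a finite time is continued by a solution with fixed parameters. -/
theorem IsClosedLoop.glue {x₀ χ₀ : Fin n → ℝ} {T : ℝ} (hT : 0 < T)
    {x η χ : ℝ → Fin n → ℝ} {σ : ℝ → Fin n → ℕ} (hs : IsClosedLoop D P x₀ χ₀ T x η χ σ)
    {σm σ' : Fin n → ℕ} {χm ηm χ' : Fin n → ℝ} {y w : ℝ → Fin n → ℝ} {δ : ℝ}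
    (hconst : ∀ᶠ r in 𝓝[<] T, σ r = σm ∧ χ r = χm) (hη : Tendsto η (𝓝[<] T) (𝓝 ηm))
    (hx : Tendsto x (𝓝[<] T) (𝓝 (y T)))
    (halt : (σ' = σm ∧ χ' = χm ∧ w T = ηm) ∨
        (Event D P T σm χm (y T) ηm ∧ Update D (y T) σm χm ηm σ' χ' (w T)))
    (hy : Continuous y) (hw : Continuous w)
    (hder : ∀ r ∈ Ico T (T + δ),
        HasDerivWithinAt y (stateRHS D P σ' χ' (y r)) (Ici r) r ∧
        HasDerivWithinAt w (auxRHS D σ' χ' (y r) (w r)) (Ici r) r ∧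
        ∀ i, D.superv σ' χ' (y r) (w r) i ≤ 0) :
    IsClosedLoop D P x₀ χ₀ ((T + δ : ℝ) : EReal) (fun t => if t < T then x t else y t)
      (fun t => if t < T then η t else w t) (fun t => if t < T then χ t else χ')
      (fun t => if t < T then σ t else σ') := by
  have hlow : ∀ {t : ℝ}, t < T → ∀ᶠ r in 𝓝 t, r < T := fun h => eventually_lt_nhds h
  have hup : ∀ {t : ℝ}, T ≤ t → ∀ᶠ r in 𝓝[≥] t, ¬ r < T := fun {t} h => by
    filter_upwards [self_mem_nhdsWithin] with r hr
    exact not_lt.2 (h.trans hr)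
  have hcoe : ∀ {t : ℝ}, t < T → (t : EReal) < T := fun h => EReal.coe_lt_coe_iff.2 h
  have hIco : ∀ {t : ℝ}, T ≤ t → (t : EReal) < ((T + δ : ℝ) : EReal) → t ∈ Ico T (T + δ) :=
    fun h h' => ⟨h, EReal.coe_lt_coe_iff.1 h'⟩
  constructor
  · rw [if_pos hT]; exact hs.init_x
  · rw [if_pos hT]; exact hs.init_σ
  · rw [if_pos hT]; exact hs.init_χ
  · rw [if_pos hT, if_pos hT]; exact hs.init_η
  · intro t ht
    rcases lt_trichotomy t T with h | rfl | h
    · have h1 : ContinuousWithinAt x {t : ℝ | 0 ≤ t ∧ (t : EReal) < ((T + δ : ℝ) : EReal)} t := by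
        refine (hs.continuous_x t ⟨ht.1, hcoe h⟩).mono_of_mem_nhdsWithin ?_
        filter_upwards [nhdsWithin_le_nhds (hlow h), self_mem_nhdsWithin] with r h1 h2
        exact ⟨h2.1, hcoe h1⟩
      refine h1.congr_of_eventuallyEq ?_ (if_pos h)
      filter_upwards [nhdsWithin_le_nhds (hlow h)] with r h1 using if_pos h1
    · refine ContinuousAt.continuousWithinAt ?_
      rw [continuousAt_iff_continuous_left'_right']
      constructor
      · rw [ContinuousWithinAt, if_neg (lt_irrefl _)]
        refine hx.congr' ?_
        filter_upwards [self_mem_nhdsWithin] with r hr using (if_pos hr).symm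
      · refine hy.continuousWithinAt.congr_of_eventuallyEq ?_ (if_neg (lt_irrefl _))
        filter_upwards [self_mem_nhdsWithin] with r hr using if_neg (not_lt.2 (le_of_lt hr))
    · refine (hy.continuousAt.congr ?_).continuousWithinAt
      filter_upwards [eventually_gt_nhds h] with r hr using (if_neg (not_lt.2 hr.le)).symm
  · intro t ht htT
    rcases lt_or_ge t T with h | h
    · simp only [if_pos h]
      refine (hs.deriv_x t ht (hcoe h)).congr_of_eventuallyEq ?_ (if_pos h)
      filter_upwards [nhdsWithin_le_nhds (hlow h)] with r h1 using if_pos h1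
    · simp only [if_neg (not_lt.2 h)]
      refine (hder t (hIco h htT)).1.congr_of_eventuallyEq ?_ (if_neg (not_lt.2 h))
      filter_upwards [hup h] with r h1 using if_neg h1
  · intro t ht htT
    rcases lt_or_ge t T with h | h
    · simp only [if_pos h]
      refine (hs.deriv_η t ht (hcoe h)).congr_of_eventuallyEq ?_ (if_pos h)
      filter_upwards [nhdsWithin_le_nhds (hlow h)] with r h1 using if_pos h1
    · simp only [if_neg (not_lt.2 h)]
      refine (hder t (hIco h htT)).2.1.congr_of_eventuallyEq ?_ (if_neg (not_lt.2 h))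
      filter_upwards [hup h] with r h1 using if_neg h1
  · intro t ht htT
    rcases lt_or_ge t T with h | h
    · filter_upwards [hs.const_right t ht (hcoe h), nhdsWithin_le_nhds (hlow h)] with r h1 h2
      rwa [if_pos h, if_pos h, if_pos h2, if_pos h2]
    · filter_upwards [nhdsWithin_mono _ Ioi_subset_Ici_self (hup h)] with r h2
      rw [if_neg (not_lt.2 h), if_neg (not_lt.2 h), if_neg h2, if_neg h2]
      exact ⟨rfl, rfl⟩
  · intro t ht htT
    rcases lt_or_ge t T with h | h
    · simp only [if_pos h]
      exact hs.superv_nonpos t ht (hcoe h)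
    · simp only [if_neg (not_lt.2 h)]
      exact (hder t (hIco h htT)).2.2
  · intro t ht htT
    rcases lt_trichotomy t T with h | rfl | h
    · obtain ⟨σm, χm, ηm, hconst, hη, halt⟩ := hs.logic t ht (hcoe h)
      refine ⟨σm, χm, ηm, ?_, hη.congr' ?_, by simpa only [if_pos h] using halt⟩
      · filter_upwards [hconst, nhdsWithin_le_nhds (hlow h)] with r h1 h2
        rwa [if_pos h2, if_pos h2]
      · filter_upwards [nhdsWithin_le_nhds (hlow h)] with r h2 using (if_pos h2).symm
    · refine ⟨σm, χm, ηm, ?_, hη.congr' ?_, by simpa only [lt_irrefl, if_false] using halt⟩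
      · filter_upwards [hconst, self_mem_nhdsWithin] with r h1 h2
        rwa [if_pos (mem_Iio.1 h2), if_pos (mem_Iio.1 h2)]
      · filter_upwards [self_mem_nhdsWithin] with r h2 using (if_pos h2).symm
    · have hev : ∀ᶠ r in 𝓝[<] t, ¬ r < T := by
        filter_upwards [Ioo_mem_nhdsLT h] with r hr using not_lt.2 hr.1.le
      refine ⟨σ', χ', w t, ?_, ((hw.tendsto t).mono_left nhdsWithin_le_nhds).congr' ?_,
        Or.inl ⟨if_neg (not_lt.2 h.le), if_neg (not_lt.2 h.le), if_neg (not_lt.2 h.le)⟩⟩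
      · filter_upwards [hev] with r h2
        rw [if_neg h2, if_neg h2]; exact ⟨rfl, rfl⟩
      · filter_upwards [hev] with r h2 using (if_neg h2).symm

/-- The closed loop has a solution on a short interval. -/
theorem exists_initial_closedLoop (hD : D.Admissible) (hP : P.Admissible) {x₀ χ₀ : Fin n → ℝ}
    (hχ₀ : ∀ i, |D.err (fun _ => 1) χ₀ x₀ i| < χ₀ i) :
    ∃ δ : ℝ, 0 < δ ∧ ∃ (x η χ : ℝ → Fin n → ℝ) (σ : ℝ → Fin n → ℕ),
      IsClosedLoop D P x₀ χ₀ δ x η χ σ := by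
  have hneg : ∀ i, D.superv (fun _ => 1) χ₀ x₀
      (fun i => D.lyap (fun _ => 1) χ₀ x₀ i + D.ε) i < 0 := fun i => by
    rw [Design.superv]; linarith [hD.ε_pos]
  obtain ⟨δ, hδ, y, w, hy0, hw0, hyc, hwc, hder⟩ := exists_local_admissible hD hP hχ₀ (t := 0)
    (fun i => (hneg i).le) (Or.inr hneg)
  rw [zero_add] at hder
  refine ⟨δ, hδ, y, w, fun _ => χ₀, fun _ _ => 1, hy0, fun _ => rfl, rfl,
    fun i => by rw [hw0], hyc.continuousOn,
    fun t ht htT => (hder t ⟨ht, EReal.coe_lt_coe_iff.1 htT⟩).1,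
    fun t ht htT => (hder t ⟨ht, EReal.coe_lt_coe_iff.1 htT⟩).2.1,
    fun t _ _ => Eventually.of_forall fun _ => ⟨rfl, rfl⟩,
    fun t ht htT => (hder t ⟨ht, EReal.coe_lt_coe_iff.1 htT⟩).2.2,
    fun t ht htT => ⟨_, χ₀, w t, Eventually.of_forall fun _ => ⟨rfl, rfl⟩,
      (hwc.tendsto t).mono_left nhdsWithin_le_nhds, Or.inl ⟨rfl, rfl, rfl⟩⟩⟩

namespace IsClosedLoop
variable {x₀ χ₀ : Fin n → ℝ} {x η χ : ℝ → Fin n → ℝ} {σ : ℝ → Fin n → ℕ}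

/-- The right-hand sides are bounded once all channels have settled. -/
theorem exists_rhs_bound {T : EReal} (hs : IsClosedLoop D P x₀ χ₀ T x η χ σ) (hD : D.Admissible)
    (hP : P.Admissible) (hχ₀ : ∀ i, |D.err (fun _ => 1) χ₀ x₀ i| < χ₀ i) {t₀ M : ℝ}
    (hset : Settled D T x η χ σ n t₀ M) (i : Fin n) :
    ∃ C, ∀ t : ℝ, t₀ ≤ t → (t : EReal) < T → |stateRHS D P (σ t) (χ t) (x t) i| ≤ C ∧
      |auxRHS D (σ t) (χ t) (x t) (η t) i| ≤ C := by
  have hM : 0 ≤ M := (abs_nonneg _).trans (hset.control_le t₀ le_rfl hset.lt 0 (Nat.zero_le _))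
  have hχ := hs.χ_const hD hχ₀ hset.nonneg hset.σ_const
  set S : ℝ := ∑ j, χ t₀ j
  have hpos := (hs.inBarrier hD hχ₀ t₀ hset.nonneg hset.lt).pos
  have hS : 0 ≤ S := Finset.sum_nonneg fun j _ => (hpos j).le
  have hα : 0 < (1 + D.α) / 2 := by linarith [hD.half_lt]
  -- The input is treated as an independent variable, which makes the right-hand side continuous
  -- everywhere and bounded on a compact ball. The errors play the same role in `C₂`.
  obtain ⟨C₁, hC₁⟩ := (isCompact_closedBall (0 : (Fin n → ℝ) × ℝ) M).exists_bound_of_continuousOn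
    (f := fun z : (Fin n → ℝ) × ℝ => P.h i (fun j => z.1 ⟨j, by omega⟩)
      * (if hi : (i : ℕ) + 1 < n then z.1 ⟨i + 1, hi⟩ else z.2)
      + P.f i (fun j => z.1 ⟨j, by omega⟩)) (by
    have h1 := (hP.contDiff_h i).continuous
    have h2 := (hP.contDiff_f i).continuous
    refine Continuous.continuousOn (Continuous.add (Continuous.mul (h1.comp (by fun_prop)) ?_)
      (h2.comp (by fun_prop)))
    split_ifs <;> fun_prop)
  obtain ⟨C₂, hC₂⟩ := (isCompact_closedBall (0 : (Fin n → ℝ) × (Fin n → ℝ))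
    (max M S)).exists_bound_of_continuousOn
    (f := fun z : (Fin n → ℝ) × (Fin n → ℝ) =>
      -D.a * qpow (z.2 i) ((1 + D.α) / 2) - D.Q i * qpow (z.1 i) (1 + D.α)
      + ∑ j ∈ Finset.univ.filter (fun j : Fin n => j < i), D.c i j * qpow (z.1 j) (1 + D.α)
      + (if hi : (i : ℕ) + 1 < n then D.c i ⟨i + 1, hi⟩ * qpow (z.1 ⟨i + 1, hi⟩) (1 + D.α) else 0)
      + D.ζ) (by
    have h1 := hD.continuous_qpow_err
    have h2 := continuous_qpow hα
    have h3 : ∀ j, Continuous fun z : (Fin n → ℝ) × (Fin n → ℝ) => qpow (z.1 j) (1 + D.α) :=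
      fun j => h1.comp (by fun_prop)
    have h4 : Continuous fun z : (Fin n → ℝ) × (Fin n → ℝ) => qpow (z.2 i) ((1 + D.α) / 2) :=
      h2.comp (by fun_prop)
    refine Continuous.continuousOn ((((continuous_const.mul h4).sub
      (continuous_const.mul (h3 i))).add (continuous_finsetSum _ fun j _ =>
        continuous_const.mul (h3 j))).add ?_ |>.add continuous_const)
    split_ifs
    · exact continuous_const.mul (h3 _)
    · exact continuous_const)
  refine ⟨max C₁ C₂, fun t ht htT => ⟨?_, ?_⟩⟩
  · refine le_trans ?_ (le_max_left _ _)
    refine hC₁ (x t, D.input (σ t) (χ t) (x t)) (mem_closedBall_zero_iff.2 (max_le ?_ ?_))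
    · exact (pi_norm_le_iff_of_nonneg hM).2 fun j => hset.x_le t ht htT j j.2.le
    · exact hset.control_le t ht htT n le_rfl
  · refine le_trans ?_ (le_max_right _ _)
    refine hC₂ (D.err (σ t) (χ t) (x t), η t) (mem_closedBall_zero_iff.2 (max_le ?_ ?_))
    · refine (pi_norm_le_iff_of_nonneg (hM.trans (le_max_left _ _))).2 fun j => ?_
      have h1 := hs.inBarrier hD hχ₀ t (hset.nonneg.trans ht) htT j
      rw [hχ t ht htT j j.2.le] at h1
      exact h1.le.trans ((Finset.single_le_sum (f := χ t₀) (fun j _ => (hpos j).le)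
        (Finset.mem_univ j)).trans (le_max_right _ _))
    · exact (pi_norm_le_iff_of_nonneg (hM.trans (le_max_left _ _))).2 fun j =>
        (hset.η_le t ht htT j j.2).trans (le_max_left _ _)

/-- Every solution on a bounded interval can be continued to a longer one. -/
theorem exists_extension {T : ℝ} (hT : 0 < T) (hs : IsClosedLoop D P x₀ χ₀ T x η χ σ)
    (hD : D.Admissible) (hP : P.Admissible) (hχ₀ : ∀ i, |D.err (fun _ => 1) χ₀ x₀ i| < χ₀ i) :
    ∃ δ > 0, ∃ (x' η' χ' : ℝ → Fin n → ℝ) (σ' : ℝ → Fin n → ℕ),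
      IsClosedLoop D P x₀ χ₀ ((T + δ : ℝ) : EReal) x' η' χ' σ' ∧
      ∀ t < T, x' t = x t ∧ η' t = η t ∧ χ' t = χ t ∧ σ' t = σ t := by
  -- All channels settle strictly before `T`, so switching times cannot accumulate at `T`.
  obtain ⟨t₀, M, hset⟩ := hs.exists_settled hD hP hχ₀ (by exact_mod_cast hT)
  have ht₀T : t₀ < T := EReal.coe_lt_coe_iff.1 hset.lt
  have hχc := hs.χ_const hD hχ₀ hset.nonneg hset.σ_const
  have hcoe : ∀ {t : ℝ}, t < T → (t : EReal) < (T : EReal) := fun h => EReal.coe_lt_coe_iff.2 h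
  have hxlim : ∀ i, ∃ L, Tendsto (fun t => x t i) (𝓝[<] T) (𝓝 L) := fun i => by
    obtain ⟨C, hC⟩ := hs.exists_rhs_bound hD hP hχ₀ hset i
    refine exists_tendsto_of_right_deriv_bounded ht₀T (C := C) (fun c hc => ?_) fun t ht => ?_
    · exact (continuous_apply i).comp_continuousOn (hs.continuous_x.mono fun t ht =>
        ⟨hset.nonneg.trans ht.1, hcoe (ht.2.trans_lt hc)⟩)
    · exact ⟨_, hasDerivWithinAt_pi.1 (hs.deriv_x t (hset.nonneg.trans ht.1) (hcoe ht.2)) i,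
        (hC t ht.1 (hcoe ht.2)).1⟩
  have hηlim : ∀ i, ∃ L, Tendsto (fun t => η t i) (𝓝[<] T) (𝓝 L) := fun i => by
    obtain ⟨C, hC⟩ := hs.exists_rhs_bound hD hP hχ₀ hset i
    refine exists_tendsto_of_right_deriv_bounded ht₀T (C := C) (fun c hc => ?_) fun t ht => ?_
    · exact hs.continuousOn_η hD hχ₀ hset.nonneg (hcoe hc) fun t ht htT j _ =>
        hset.σ_const t ht htT j j.2
    · exact ⟨_, hasDerivWithinAt_pi.1 (hs.deriv_η t (hset.nonneg.trans ht.1) (hcoe ht.2)) i,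
        (hC t ht.1 (hcoe ht.2)).2⟩
  choose xT hxT using hxlim
  choose ηT hηT using hηlim
  have hx : Tendsto x (𝓝[<] T) (𝓝 xT) := tendsto_pi_nhds.2 hxT
  have hη : Tendsto η (𝓝[<] T) (𝓝 ηT) := tendsto_pi_nhds.2 hηT
  have hconst : ∀ᶠ r in 𝓝[<] T, σ r = σ t₀ ∧ χ r = χ t₀ := by
    filter_upwards [Ioo_mem_nhdsLT ht₀T] with r hr
    exact ⟨funext fun j => hset.σ_const r hr.1.le (hcoe hr.2) j j.2,
      funext fun j => hχc r hr.1.le (hcoe hr.2) j j.2.le⟩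
  have hbev : ∀ᶠ r in 𝓝[<] T, D.InBarrier (σ t₀) (χ t₀) (x r) ∧
      ∀ i, D.lyap (σ t₀) (χ t₀) (x r) i ≤ η r i := by
    filter_upwards [hconst, Ioo_mem_nhdsLT ht₀T] with r hr hr'
    rw [← hr.1, ← hr.2]
    have hr0 := hset.nonneg.trans hr'.1.le
    exact ⟨hs.inBarrier hD hχ₀ r hr0 (hcoe hr'.2), hs.lyap_le_η hr0 (hcoe hr'.2)⟩
  have hb : D.InBarrier (σ t₀) (χ t₀) xT :=
    hD.inBarrier_of_tendsto hx hη (hbev.mono fun _ h => h.1) (hbev.mono fun _ h => h.2)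
  have hV : ∀ i, D.superv (σ t₀) (χ t₀) xT ηT i ≤ 0 := fun i => sub_nonpos.2
    (le_of_tendsto_of_tendsto ((hD.continuousAt_lyap hb i).tendsto.comp hx) (hηT i)
      (hbev.mono fun _ h => h.2 i))
  -- If the event occurs at `T`, one update makes all supervisory functions negative. Otherwise the
  -- parameters are kept. Both cases allow a local solution to be glued on.
  suffices h : ∃ σ' χ' η', ((σ' = σ t₀ ∧ χ' = χ t₀ ∧ η' = ηT) ∨
      (Event D P T (σ t₀) (χ t₀) xT ηT ∧ Update D xT (σ t₀) (χ t₀) ηT σ' χ' η')) ∧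
      D.InBarrier σ' χ' xT ∧ (∀ i, D.superv σ' χ' xT η' i ≤ 0) ∧
      (¬ Event D P T σ' χ' xT η' ∨ ∀ i, D.superv σ' χ' xT η' i < 0) by
    obtain ⟨σ', χ', η', halt, hb', hV', hev⟩ := h
    obtain ⟨δ, hδ, y, w, hy0, hw0, hyc, hwc, hder⟩ :=
      exists_local_admissible hD hP hb' (t := T) hV' hev
    refine ⟨δ, hδ, _, _, _, _, hs.glue hT hconst hη (by rwa [hy0]) ?_ hyc hwc hder, fun t ht =>
      ⟨if_pos ht, if_pos ht, if_pos ht, if_pos ht⟩⟩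
    rwa [hy0, hw0]
  by_cases hE : Event D P T (σ t₀) (χ t₀) xT ηT
  · obtain ⟨σ', χ', η', hupd⟩ := exists_update D xT (σ t₀) (χ t₀) ηT
    exact ⟨σ', χ', η', Or.inr ⟨hE, hupd⟩, hupd.inBarrier hD hb.pos,
      fun i => (hupd.superv_neg hD i).le, Or.inr (hupd.superv_neg hD)⟩
  · exact ⟨_, _, _, Or.inl ⟨rfl, rfl, rfl⟩, hb, hV, Or.inl hE⟩

end IsClosedLoop

/-- A solution of the closed loop together with its interval. -/
structure ClosedLoopSol (D : Design n) (P : Plant n) (x₀ χ₀ : Fin n → ℝ) where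
  T : EReal
  pos : 0 < T
  x : ℝ → Fin n → ℝ
  η : ℝ → Fin n → ℝ
  χ : ℝ → Fin n → ℝ
  σ : ℝ → Fin n → ℕ
  isClosedLoop : IsClosedLoop D P x₀ χ₀ T x η χ σ

/-- The solution `b` extends the solution `a`. -/
def ClosedLoopSol.Extends {x₀ χ₀ : Fin n → ℝ} (a b : ClosedLoopSol D P x₀ χ₀) : Prop :=
  a.T ≤ b.T ∧ ∀ t : ℝ, 0 ≤ t → (t : EReal) < a.T →
    b.x t = a.x t ∧ b.η t = a.η t ∧ b.χ t = a.χ t ∧ b.σ t = a.σ t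

theorem ClosedLoopSol.Extends.trans {x₀ χ₀ : Fin n → ℝ} {a b c : ClosedLoopSol D P x₀ χ₀}
    (h : a.Extends b) (h' : b.Extends c) : a.Extends c := by
  refine ⟨h.1.trans h'.1, fun t ht htT => ?_⟩
  obtain ⟨e1, e2, e3, e4⟩ := h.2 t ht htT
  obtain ⟨f1, f2, f3, f4⟩ := h'.2 t ht (htT.trans_le h.1)
  exact ⟨f1.trans e1, f2.trans e2, f3.trans e3, f4.trans e4⟩

/-- The bound is the union of the chain: at each time the values of some member defined there are
used, and comparable members agree. Being a solution is a local property, so the union is one. -/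
theorem ClosedLoopSol.exists_bound_of_chain {x₀ χ₀ : Fin n → ℝ}
    {c : Set (ClosedLoopSol D P x₀ χ₀)} (hc : IsChain ClosedLoopSol.Extends c)
    (hne : c.Nonempty) : ∃ b : ClosedLoopSol D P x₀ χ₀, ∀ a ∈ c, a.Extends b := by
  classical
  have hpick : ∀ t : ℝ, ∃ a ∈ c, (∃ b ∈ c, (t : EReal) < b.T) → (t : EReal) < a.T := fun t => by
    by_cases h : ∃ b ∈ c, (t : EReal) < b.T
    · obtain ⟨b, hb, hbt⟩ := h
      exact ⟨b, hb, fun _ => hbt⟩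
    · obtain ⟨a, ha⟩ := hne
      exact ⟨a, ha, fun h' => absurd h' h⟩
  choose p hp hpT using hpick
  have hagree : ∀ a ∈ c, ∀ t : ℝ, 0 ≤ t → (t : EReal) < a.T → (p t).x t = a.x t ∧
      (p t).η t = a.η t ∧ (p t).χ t = a.χ t ∧ (p t).σ t = a.σ t := by
    intro a ha t ht htT
    by_cases hap : a = p t
    · rw [← hap]; exact ⟨rfl, rfl, rfl, rfl⟩
    · rcases hc ha (hp t) hap with h | h
      · exact h.2 t ht htT
      · obtain ⟨e1, e2, e3, e4⟩ := h.2 t ht (hpT t ⟨a, ha, htT⟩)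
        exact ⟨e1.symm, e2.symm, e3.symm, e4.symm⟩
  have hpos : 0 < sSup (ClosedLoopSol.T '' c) := by
    obtain ⟨a, ha⟩ := hne
    exact a.pos.trans_le (le_sSup ⟨a, ha, rfl⟩)
  refine ⟨⟨sSup (ClosedLoopSol.T '' c), hpos, fun t => (p t).x t, fun t => (p t).η t,
    fun t => (p t).χ t, fun t => (p t).σ t, IsClosedLoop.of_local hpos fun t ht htT => ?_⟩,
    fun a ha => ⟨le_sSup ⟨a, ha, rfl⟩, hagree a ha⟩⟩
  obtain ⟨-, ⟨a, ha, rfl⟩, hat⟩ := lt_sSup_iff.1 htT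
  exact ⟨a.T, a.x, a.η, a.χ, a.σ, a.isClosedLoop, hat, hagree a ha⟩

/-- Every solution extends to a solution for all times. -/
theorem ClosedLoopSol.exists_extends_top (hD : D.Admissible) (hP : P.Admissible)
    {x₀ χ₀ : Fin n → ℝ} (hχ₀ : ∀ i, |D.err (fun _ => 1) χ₀ x₀ i| < χ₀ i)
    (a : ClosedLoopSol D P x₀ χ₀) : ∃ b : ClosedLoopSol D P x₀ χ₀, b.T = ⊤ ∧ a.Extends b := by
  obtain ⟨⟨m, hm⟩, hmax⟩ := exists_maximal_of_chains_bounded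
    (α := {b : ClosedLoopSol D P x₀ χ₀ // a.Extends b}) (r := fun b b' => b.1.Extends b'.1)
    (fun c hc => by
      rcases c.eq_empty_or_nonempty with rfl | ⟨b₀, hb₀⟩
      · exact ⟨⟨a, le_rfl, fun _ _ _ => ⟨rfl, rfl, rfl, rfl⟩⟩, fun _ h => absurd h (notMem_empty _)⟩
      · obtain ⟨b, hb⟩ := ClosedLoopSol.exists_bound_of_chain (c := Subtype.val '' c)
          (by
            rintro _ ⟨u, hu, rfl⟩ _ ⟨v, hv, rfl⟩ huv
            exact hc hu hv fun h => huv (congrArg _ h)) ⟨b₀.1, b₀, hb₀, rfl⟩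
        exact ⟨⟨b, b₀.2.trans (hb _ ⟨b₀, hb₀, rfl⟩)⟩, fun u hu => hb _ ⟨u, hu, rfl⟩⟩)
    (fun h h' => h.trans h')
  refine ⟨m, ?_, hm⟩
  by_contra htop
  have hbot : m.T ≠ ⊥ := (bot_le.trans_lt m.pos).ne'
  obtain ⟨τ, hτ⟩ : ∃ τ : ℝ, m.T = τ := ⟨m.T.toReal, (EReal.coe_toReal htop hbot).symm⟩
  have hτ0 : 0 < τ := by
    have := m.pos
    rw [hτ] at this
    exact_mod_cast this
  have hcl := m.isClosedLoop
  rw [hτ] at hcl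
  obtain ⟨δ, hδ, x', η', χ', σ', hcl', heq⟩ := hcl.exists_extension hτ0 hD hP hχ₀
  have hext : m.Extends ⟨((τ + δ : ℝ) : EReal), by exact_mod_cast add_pos hτ0 hδ, x', η', χ', σ',
      hcl'⟩ := by
    refine ⟨?_, fun t ht htT => heq t ?_⟩
    · rw [hτ]; exact EReal.coe_le_coe_iff.2 (by linarith)
    · rw [hτ] at htT; exact EReal.coe_lt_coe_iff.1 htT
  have := (hmax ⟨_, hm.trans hext⟩ hext).1
  rw [hτ] at this
  have := EReal.coe_le_coe_iff.1 this
  linarith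

end SwitchingControl

/-! ### Boundedness and practical finite-time stability -/

namespace SwitchingControl

theorem rpow_sum_le {ι : Type*} (s : Finset ι) {φ : ℝ} (hφ : 0 < φ) (hφ1 : φ ≤ 1) {y : ι → ℝ}
    (hy : ∀ i, 0 ≤ y i) : (∑ i ∈ s, y i) ^ φ ≤ ∑ i ∈ s, y i ^ φ := by
  classical
  induction s using Finset.induction_on with
  | empty => simp [Real.zero_rpow hφ.ne']
  | insert i s hi ih =>
    rw [Finset.sum_insert hi, Finset.sum_insert hi]
    exact (Real.rpow_add_le_add_rpow (hy i) (Finset.sum_nonneg fun j _ => hy j) hφ.le hφ1).trans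
      (by gcongr)

/-- Above `L` the function falls at least at the rate `A L^φ - C > 0`, which a nonnegative function
cannot do forever. Once it is at most `L`, it stays so. -/
theorem exists_forall_ge_le_of_right_deriv_le {f : ℝ → ℝ} {t₀ A C L φ : ℝ} (hL : 0 ≤ L)
    (hA : 0 ≤ A) (hφ : 0 ≤ φ) (hCL : C < A * L ^ φ) (hf : ∀ b, ContinuousOn f (Icc t₀ b))
    (hnn : ∀ t ≥ t₀, 0 ≤ f t)
    (hf' : ∀ t ≥ t₀, ∃ f', HasDerivWithinAt f f' (Ici t) t ∧ f' ≤ -A * f t ^ φ + C) :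
    ∃ T₀ ≥ t₀, ∀ t ≥ T₀, f t ≤ L := by
  obtain ⟨T₀, hT₀, hfT⟩ : ∃ T₀ ≥ t₀, f T₀ ≤ L := by
    by_contra! hcon
    set d := A * L ^ φ - C with hd
    have hd0 : 0 < d := by linarith
    -- By this time a fall at the rate `d` would have brought `f` down to `-1`.
    set b := t₀ + (f t₀ + 1) / d with hb
    have hb0 : 0 < (f t₀ + 1) / d := div_pos (by linarith [hnn t₀ le_rfl]) hd0
    have hab : t₀ ≤ b := by linarith
    have h := add_mul_le_of_right_deriv_ge (f := fun t => -f t) (C := d) hab (hf b).neg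
      fun t ht => by
        obtain ⟨f', h1, h2⟩ := hf' t ht.1
        refine ⟨-f', h1.neg, ?_⟩
        have := mul_le_mul_of_nonneg_left (Real.rpow_le_rpow hL (hcon t ht.1).le hφ) hA
        linarith
    have h3 : d * (b - t₀) = f t₀ + 1 := by rw [hb]; field_simp; ring
    have := hnn b hab
    linarith
  refine ⟨T₀, hT₀, fun t ht => ?_⟩
  have := le_max_of_right_deriv_le ht hL hA hφ hCL ((hf t).mono (Icc_subset_Icc_left hT₀))
    fun r hr => hf' r (hT₀.trans hr.1)
  rwa [max_eq_right hfT] at this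

variable {n : ℕ} {D : Design n} {P : Plant n}

theorem sum_next_eq_sum_pred (c : Fin n → Fin n → ℝ) (S : Fin n → ℝ) :
    ∑ i : Fin n, (if hi : (i : ℕ) + 1 < n then c i ⟨i + 1, hi⟩ * S ⟨i + 1, hi⟩ else 0)
      = ∑ i : Fin n, (if 0 < (i : ℕ) then c ⟨i - 1, by omega⟩ i else 0) * S i := by
  cases n with
  | zero => simp
  | succ m =>
    rw [Fin.sum_univ_castSucc, Fin.sum_univ_succ]
    simp only [Fin.val_castSucc, Fin.val_last, lt_irrefl, dif_neg, not_false_eq_true, add_zero,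
      Fin.val_zero, if_false, zero_mul, zero_add, Fin.val_succ, Nat.succ_pos, if_true]
    refine Finset.sum_congr rfl fun i _ => ?_
    rw [dif_pos (by omega)]
    rfl

/-- The coupling terms cancel in the sum of the auxiliary equations. -/
theorem sum_auxRHS_le (hD : D.Admissible) (σ : Fin n → ℕ) (χ x : Fin n → ℝ) {η : Fin n → ℝ}
    (hη : ∀ i, 0 ≤ η i) :
    ∑ i, auxRHS D σ χ x η i
      ≤ -D.a * (∑ i, η i) ^ ((1 + (D.α : ℝ)) / 2) + n * D.ζ := by
  set S : Fin n → ℝ := fun i => qpow (D.err σ χ x i) (1 + D.α) with hS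
  have hSnn : ∀ i, 0 ≤ S i := fun i => by
    simp only [hS]; rw [hD.qpow_err]; positivity
  have h1 : ∑ i, ∑ j ∈ Finset.univ.filter (fun j : Fin n => j < i), D.c i j * S j
      = ∑ i, (∑ j ∈ Finset.univ.filter (fun j : Fin n => i < j), D.c j i) * S i := by
    simp_rw [Finset.sum_mul, Finset.sum_filter]
    rw [Finset.sum_comm]
  have h2 := sum_next_eq_sum_pred D.c S
  -- After both coupling sums are reindexed by the channel of the error, the total coefficient of
  -- each power is less than `Q i`.
  have h3 : ∑ i, ((∑ j ∈ Finset.univ.filter (fun j : Fin n => i < j), D.c j i) * S i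
      + (if 0 < (i : ℕ) then D.c ⟨i - 1, by omega⟩ i else 0) * S i) ≤ ∑ i, D.Q i * S i := by
    refine Finset.sum_le_sum fun i _ => ?_
    rw [← add_mul]
    exact mul_le_mul_of_nonneg_right (hD.Q_large i).le (hSnn i)
  rw [Finset.sum_add_distrib, ← h1, ← h2] at h3
  have h4 := rpow_sum_le Finset.univ (by linarith [hD.α_pos] : 0 < (1 + (D.α : ℝ)) / 2)
    (by linarith [hD.α_lt_one]) hη
  have h5 : ∑ i, auxRHS D σ χ x η i = -D.a * (∑ i, η i ^ ((1 + (D.α : ℝ)) / 2))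
      - ∑ i, D.Q i * S i
      + ∑ i, ∑ j ∈ Finset.univ.filter (fun j : Fin n => j < i), D.c i j * S j
      + ∑ i : Fin n, (if hi : (i : ℕ) + 1 < n then D.c i ⟨i + 1, hi⟩ * S ⟨i + 1, hi⟩ else 0)
      + n * D.ζ := by
    have h6 : ∑ _i : Fin n, D.ζ = n * D.ζ := by simp
    rw [← h6, Finset.mul_sum, ← Finset.sum_sub_distrib, ← Finset.sum_add_distrib,
      ← Finset.sum_add_distrib, ← Finset.sum_add_distrib]
    refine Finset.sum_congr rfl fun i _ => ?_
    rw [auxRHS, hD.qpow_aux (hη i)]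
  have h7 := mul_le_mul_of_nonneg_left h4 hD.a_pos.le
  rw [h5]
  linarith

namespace IsClosedLoop
variable {x₀ χ₀ : Fin n → ℝ} {x η χ : ℝ → Fin n → ℝ} {σ : ℝ → Fin n → ℕ}

/-- Signals that depend continuously on the states are bounded on compact time intervals. -/
theorem exists_bound_Icc {T : EReal} (hs : IsClosedLoop D P x₀ χ₀ T x η χ σ) (hD : D.Admissible)
    (hχ₀ : ∀ i, |D.err (fun _ => 1) χ₀ x₀ i| < χ₀ i)
    (Φ : (Fin n → ℕ) → (Fin n → ℝ) → (Fin n → ℝ) × (Fin n → ℝ) → ℝ)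
    (hΦ : ∀ σ χ x η, D.InBarrier σ χ x → ContinuousAt (Φ σ χ) (x, η)) :
    ∀ t : ℝ, 0 ≤ t → (t : EReal) < T →
      ∃ B, ∀ r ∈ Icc 0 t, |Φ (σ r) (χ r) (x r, η r)| ≤ B := by
  refine real_interval_induction (fun t ht htT hprev => ?_) (fun t ht htT hp => ?_)
  · rcases ht.eq_or_lt with rfl | ht0
    · refine ⟨|Φ (σ 0) (χ 0) (x 0, η 0)|, fun r hr => ?_⟩
      obtain rfl : r = 0 := le_antisymm hr.2 hr.1
      exact le_rfl
    · obtain ⟨σm, χm, ηm, hconst, hη, hb, -, -, -⟩ := hs.left_values hD hχ₀ ht0 htT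
      have hlim := (hΦ σm χm (x t) ηm hb).abs.tendsto.comp
        ((hs.tendsto_left ht0 htT).prodMk_nhds hη)
      have hev := (hlim.eventually (eventually_lt_nhds (lt_add_one _))).and hconst
      obtain ⟨c, hct, hc⟩ := (mem_nhdsLT_iff_exists_Ioo_subset' ht0).1 hev
      have hct' : c < t := hct
      -- The hypothesis covers `[0, m]` and the left limit covers the times between `m` and `t`. The
      -- maximum is needed because `c` may be negative.
      set m := max 0 ((c + t) / 2) with hm
      have hcm : c < m := lt_of_lt_of_le (by linarith) (le_max_right _ _)
      have hmt : m < t := max_lt ht0 (by linarith)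
      obtain ⟨B, hB⟩ := hprev m (le_max_left _ _) hmt
      refine ⟨max B (max (|Φ σm χm (x t, ηm)| + 1) |Φ (σ t) (χ t) (x t, η t)|), fun r hr => ?_⟩
      rcases le_or_gt r m with h | h
      · exact (hB r ⟨hr.1, h⟩).trans (le_max_left _ _)
      · rcases hr.2.eq_or_lt with h' | h'
        · rw [h']; exact (le_max_right _ _).trans (le_max_right _ _)
        · obtain ⟨h1, h2⟩ := hc ⟨hcm.trans h, h'⟩
          rw [h2.1, h2.2]
          exact le_trans (le_of_lt h1) ((le_max_left _ _).trans (le_max_right _ _))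
  · obtain ⟨B, hB⟩ := hp
    have hlim := (hΦ (σ t) (χ t) (x t) (η t) (hs.inBarrier hD hχ₀ t ht htT)).abs.tendsto.comp
      ((hs.tendsto_right ht htT).prodMk_nhds
        ((hs.deriv_η t ht htT).continuousWithinAt.tendsto.mono_left
          (nhdsWithin_mono _ Ioi_subset_Ici_self)))
    have hev := (hlim.eventually (eventually_lt_nhds (lt_add_one _))).and
      (hs.const_right t ht htT)
    obtain ⟨u, hu, hsub⟩ := mem_nhdsGT_iff_exists_Ioo_subset.1 hev
    filter_upwards [Ioo_mem_nhdsGT hu] with v hv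
    refine ⟨max B (|Φ (σ t) (χ t) (x t, η t)| + 1), fun r hr => ?_⟩
    rcases le_or_gt r t with h | h
    · exact (hB r ⟨hr.1, h⟩).trans (le_max_left _ _)
    · obtain ⟨h1, h2⟩ := hsub ⟨h, hr.2.trans_lt hv.2⟩
      rw [h2.1, h2.2]
      exact le_trans (le_of_lt h1) (le_max_right _ _)

/-- A signal is bounded if it depends continuously on the states and is bounded from some time
on. -/
theorem exists_bound (hs : IsClosedLoop D P x₀ χ₀ ⊤ x η χ σ) (hD : D.Admissible)
    (hχ₀ : ∀ i, |D.err (fun _ => 1) χ₀ x₀ i| < χ₀ i)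
    (Φ : (Fin n → ℕ) → (Fin n → ℝ) → (Fin n → ℝ) × (Fin n → ℝ) → Fin n → ℝ)
    (hΦ : ∀ σ χ x η i, D.InBarrier σ χ x → ContinuousAt (fun z => Φ σ χ z i) (x, η))
    {t₀ : ℝ} (ht₀ : 0 ≤ t₀)
    (htail : ∀ i, ∃ B, ∀ t ≥ t₀, |Φ (σ t) (χ t) (x t, η t) i| ≤ B) :
    ∃ B, 0 ≤ B ∧ ∀ t, 0 ≤ t → ∀ i, |Φ (σ t) (χ t) (x t, η t) i| ≤ B := by
  have h : ∀ i, ∃ B, ∀ t, 0 ≤ t → |Φ (σ t) (χ t) (x t, η t) i| ≤ B := fun i => by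
    obtain ⟨B, hB⟩ := htail i
    obtain ⟨B', hB'⟩ := hs.exists_bound_Icc hD hχ₀ (fun σ χ z => Φ σ χ z i)
      (fun σ χ x η hb => hΦ σ χ x η i hb) t₀ ht₀ (EReal.coe_lt_top _)
    refine ⟨max B B', fun t ht => ?_⟩
    rcases le_total t t₀ with h | h
    · exact (hB' t ⟨ht, h⟩).trans (le_max_right _ _)
    · exact (hB t h).trans (le_max_left _ _)
  choose B hB using h
  refine ⟨∑ i, |B i|, Finset.sum_nonneg fun i _ => abs_nonneg _, fun t ht i => ?_⟩
  exact (hB i t ht).trans ((le_abs_self _).trans (Finset.single_le_sum (f := fun i => |B i|)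
    (fun j _ => abs_nonneg _) (Finset.mem_univ i)))

theorem signals_bounded (hs : IsClosedLoop D P x₀ χ₀ ⊤ x η χ σ) (hD : D.Admissible)
    (hP : P.Admissible) (hχ₀ : ∀ i, |D.err (fun _ => 1) χ₀ x₀ i| < χ₀ i) :
    ∃ B : ℝ, ∀ t, 0 ≤ t →
        |D.input (σ t) (χ t) (x t)| ≤ B ∧
        ∀ i : Fin n, |x t i| ≤ B ∧ |η t i| ≤ B ∧ |χ t i| ≤ B ∧ (σ t i : ℝ) ≤ B ∧
          |D.gain i (σ t i)| ≤ B ∧ |D.err (σ t) (χ t) (x t) i| ≤ B ∧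
          |D.virtualControl (σ t) (χ t) (x t) i| ≤ B ∧
          |D.lyap (σ t) (χ t) (x t) i| ≤ B := by
  obtain ⟨t₀, M, hset⟩ := hs.exists_settled hD hP hχ₀ EReal.zero_lt_top
  have hχc := hs.χ_const hD hχ₀ hset.nonneg hset.σ_const
  have htop : ∀ t : ℝ, (t : EReal) < ⊤ := EReal.coe_lt_top
  have hbar : ∀ t, t₀ ≤ t → D.InBarrier (σ t) (χ t) (x t) := fun t ht =>
    hs.inBarrier hD hχ₀ t (hset.nonneg.trans ht) (htop t)
  have hcomp : ∀ {f : (Fin n → ℝ) → ℝ} {x η : Fin n → ℝ}, ContinuousAt f x →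
      ContinuousAt (fun z : (Fin n → ℝ) × (Fin n → ℝ) => f z.1) (x, η) := fun h =>
    ContinuousAt.comp_of_eq h continuousAt_fst rfl
  obtain ⟨B₁, p₁, h₁⟩ := hs.exists_bound hD hχ₀ (fun σ χ z _ => D.input σ χ z.1)
    (fun σ χ x η i hb => hcomp (hD.continuousAt_virtualControl le_rfl fun j _ => hb j))
    hset.nonneg (fun i => ⟨M, fun t ht => hset.control_le t ht (htop t) n le_rfl⟩)
  obtain ⟨B₂, p₂, h₂⟩ := hs.exists_bound hD hχ₀ (fun σ χ z i => z.1 i)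
    (fun σ χ x η i hb => by fun_prop)
    hset.nonneg (fun i => ⟨M, fun t ht => hset.x_le t ht (htop t) i i.2.le⟩)
  obtain ⟨B₃, p₃, h₃⟩ := hs.exists_bound hD hχ₀ (fun σ χ z i => z.2 i)
    (fun σ χ x η i hb => by fun_prop)
    hset.nonneg (fun i => ⟨M, fun t ht => hset.η_le t ht (htop t) i i.2⟩)
  obtain ⟨B₄, p₄, h₄⟩ := hs.exists_bound hD hχ₀ (fun σ χ z i => χ i)
    (fun σ χ x η i hb => continuousAt_const) hset.nonneg
    (fun i => ⟨|χ t₀ i|, fun t ht => by rw [hχc t ht (htop t) i i.2.le]⟩)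
  obtain ⟨B₅, p₅, h₅⟩ := hs.exists_bound hD hχ₀ (fun σ χ z i => (σ i : ℝ))
    (fun σ χ x η i hb => continuousAt_const) hset.nonneg
    (fun i => ⟨|(σ t₀ i : ℝ)|, fun t ht => by rw [hset.σ_const t ht (htop t) i i.2]⟩)
  obtain ⟨B₆, p₆, h₆⟩ := hs.exists_bound hD hχ₀ (fun σ χ z i => D.gain i (σ i))
    (fun σ χ x η i hb => continuousAt_const) hset.nonneg
    (fun i => ⟨|D.gain i (σ t₀ i)|, fun t ht => by rw [hset.σ_const t ht (htop t) i i.2]⟩)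
  obtain ⟨B₇, p₇, h₇⟩ := hs.exists_bound hD hχ₀ (fun σ χ z i => D.err σ χ z.1 i)
    (fun σ χ x η i hb => hcomp (hD.continuousAt_err fun j _ => hb j)) hset.nonneg
    (fun i => ⟨χ t₀ i, fun t ht => by
      rw [← hχc t ht (htop t) i i.2.le]; exact (hbar t ht i).le⟩)
  obtain ⟨B₈, p₈, h₈⟩ := hs.exists_bound hD hχ₀ (fun σ χ z i => D.virtualControl σ χ z.1 i)
    (fun σ χ x η i hb => hcomp (hD.continuousAt_virtualControl i.2.le fun j _ => hb j))
    hset.nonneg (fun i => ⟨M, fun t ht => hset.control_le t ht (htop t) i i.2.le⟩)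
  obtain ⟨B₉, p₉, h₉⟩ := hs.exists_bound hD hχ₀ (fun σ χ z i => D.lyap σ χ z.1 i)
    (fun σ χ x η i hb => hcomp (hD.continuousAt_lyap hb i)) hset.nonneg
    (fun i => ⟨M, fun t ht => by
      rw [abs_of_nonneg (hD.lyap_nonneg (hbar t ht i))]
      exact (hs.lyap_le_η (hset.nonneg.trans ht) (htop t) i).trans
        ((le_abs_self _).trans (hset.η_le t ht (htop t) i i.2))⟩)
  refine ⟨B₁ + B₂ + B₃ + B₄ + B₅ + B₆ + B₇ + B₈ + B₉, fun t ht => ⟨?_, fun i => ?_⟩⟩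
  -- The bound of the input was stated for each channel index, so the empty system is treated apart;
  -- its input is zero.
  · rcases Nat.eq_zero_or_pos n with rfl | hn
    · rw [Design.input, Design.virtualControl, abs_zero]; linarith
    · have := h₁ t ht ⟨0, hn⟩
      linarith
  · have e2 := h₂ t ht i
    have e3 := h₃ t ht i
    have e4 := h₄ t ht i
    have e5 := (le_abs_self _).trans (h₅ t ht i)
    have e6 := h₆ t ht i
    have e7 := h₇ t ht i
    have e8 := h₈ t ht i
    have e9 := h₉ t ht i
    simp only at e2 e3 e4 e5 e6 e7 e8 e9
    refine ⟨?_, ?_, ?_, ?_, ?_, ?_, ?_, ?_⟩ <;> linarith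

/-- The Lyapunov functions are finally below every level at which the sum of the auxiliary
variables decreases. -/
theorem exists_lyap_le (hs : IsClosedLoop D P x₀ χ₀ ⊤ x η χ σ) (hD : D.Admissible)
    (hP : P.Admissible) (hχ₀ : ∀ i, |D.err (fun _ => 1) χ₀ x₀ i| < χ₀ i) {L : ℝ} (hL : 0 ≤ L)
    (hL' : n * D.ζ < D.a * L ^ ((1 + (D.α : ℝ)) / 2)) :
    ∃ T₀, 0 ≤ T₀ ∧ ∀ t, T₀ ≤ t → ∀ i, |D.lyap (σ t) (χ t) (x t) i| ≤ L := by
  obtain ⟨t₀, M, hset⟩ := hs.exists_settled hD hP hχ₀ EReal.zero_lt_top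
  have htop : ∀ t : ℝ, (t : EReal) < ⊤ := EReal.coe_lt_top
  have hbar : ∀ t, t₀ ≤ t → D.InBarrier (σ t) (χ t) (x t) := fun t ht =>
    hs.inBarrier hD hχ₀ t (hset.nonneg.trans ht) (htop t)
  have hV : ∀ t, t₀ ≤ t → ∀ i, 0 ≤ D.lyap (σ t) (χ t) (x t) i ∧
      D.lyap (σ t) (χ t) (x t) i ≤ η t i := fun t ht i =>
    ⟨hD.lyap_nonneg (hbar t ht i), hs.lyap_le_η (hset.nonneg.trans ht) (htop t) i⟩
  have hη : ∀ t, t₀ ≤ t → ∀ i, 0 ≤ η t i := fun t ht i => (hV t ht i).1.trans (hV t ht i).2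
  obtain ⟨T₀, hT₀, h⟩ := exists_forall_ge_le_of_right_deriv_le (f := fun t => ∑ i, η t i)
    (t₀ := t₀) hL hD.a_pos.le (by linarith [hD.α_pos] : 0 ≤ (1 + (D.α : ℝ)) / 2) hL'
    (fun b => continuousOn_finsetSum _ fun i _ =>
      hs.continuousOn_η hD hχ₀ hset.nonneg (htop b) fun t ht htT j _ => hset.σ_const t ht htT j j.2)
    (fun t ht => Finset.sum_nonneg fun i _ => hη t ht i)
    (fun t ht => ⟨_, HasDerivWithinAt.fun_sum fun i _ =>
      hasDerivWithinAt_pi.1 (hs.deriv_η t (hset.nonneg.trans ht) (htop t)) i,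
      sum_auxRHS_le hD _ _ _ (hη t ht)⟩)
  refine ⟨T₀, hset.nonneg.trans hT₀, fun t ht i => ?_⟩
  have ht0 : t₀ ≤ t := le_trans hT₀ ht
  rw [abs_of_nonneg (hV t ht0 i).1]
  exact (hV t ht0 i).2.trans ((Finset.single_le_sum (f := fun i => η t i)
    (fun j _ => hη t ht0 j) (Finset.mem_univ i)).trans (h t ht))

theorem practical_stability (hs : IsClosedLoop D P x₀ χ₀ ⊤ x η χ σ) (hD : D.Admissible)
    (hP : P.Admissible) (hχ₀ : ∀ i, |D.err (fun _ => 1) χ₀ x₀ i| < χ₀ i) :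
    ∃ T₀ : ℝ, 0 ≤ T₀ ∧ ∀ t, T₀ ≤ t → ∀ i : Fin n,
        |D.lyap (σ t) (χ t) (x t) i| ≤ (2 * n * D.ζ / D.a) ^ (2 / (1 + (D.α : ℝ))) ∧
        (n * D.ζ / D.a < 2 ^ ((1 + (D.α : ℝ)) / (1 - (D.α : ℝ))) →
          |D.lyap (σ t) (χ t) (x t) i| ≤ 2 * n * D.ζ / D.a) := by
  rcases Nat.eq_zero_or_pos n with rfl | hn
  -- Without channels `R` would be zero and the strict inequality would fail, but there is nothing
  -- to prove.
  · exact ⟨0, le_rfl, fun _ _ i => i.elim0⟩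
  have hn' : (0 : ℝ) < n := by exact_mod_cast hn
  have ha := hD.a_pos
  have hζ := hD.ζ_pos
  have hα := hD.α_pos
  have hα1 := hD.α_lt_one
  set R : ℝ := n * D.ζ / D.a with hR
  have hR0 : 0 < R := by positivity
  have h2R : 2 * n * D.ζ / D.a = 2 * R := by rw [hR]; ring
  have hRa : n * D.ζ = D.a * R := by rw [hR]; field_simp
  rw [h2R]
  obtain ⟨T₁, hT₁, h₁⟩ := hs.exists_lyap_le hD hP hχ₀ (L := (2 * R) ^ (2 / (1 + (D.α : ℝ))))
    (by positivity) (by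
      rw [← Real.rpow_mul (by positivity), show 2 / (1 + (D.α : ℝ)) * ((1 + (D.α : ℝ)) / 2) = 1 by
        field_simp, Real.rpow_one, hRa]
      nlinarith)
  by_cases hcond : R < 2 ^ ((1 + (D.α : ℝ)) / (1 - (D.α : ℝ)))
  · obtain ⟨T₂, hT₂, h₂⟩ := hs.exists_lyap_le hD hP hχ₀ (L := 2 * R) (by positivity) (by
      rw [hRa]
      refine mul_lt_mul_of_pos_left ?_ ha
      -- The condition on `R`, raised to the power `(1 - α) / 2`.
      have h1 : R ^ ((1 - (D.α : ℝ)) / 2) < 2 ^ ((1 + (D.α : ℝ)) / 2) := by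
        have := Real.rpow_lt_rpow hR0.le hcond (by linarith : 0 < (1 - (D.α : ℝ)) / 2)
        rwa [← Real.rpow_mul (by norm_num), show (1 + (D.α : ℝ)) / (1 - (D.α : ℝ))
          * ((1 - (D.α : ℝ)) / 2) = (1 + (D.α : ℝ)) / 2 by
            have : 1 - (D.α : ℝ) ≠ 0 := by linarith
            field_simp] at this
      have h2 : R = R ^ ((1 - (D.α : ℝ)) / 2) * R ^ ((1 + (D.α : ℝ)) / 2) := by
        rw [← Real.rpow_add hR0, show (1 - (D.α : ℝ)) / 2 + (1 + (D.α : ℝ)) / 2 = 1 by ring,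
          Real.rpow_one]
      rw [Real.mul_rpow (by norm_num) hR0.le]
      nth_rewrite 1 [h2]
      exact mul_lt_mul_of_pos_right h1 (by positivity))
    exact ⟨max T₁ T₂, hT₁.trans (le_max_left _ _), fun t ht i =>
      ⟨h₁ t ((le_max_left _ _).trans ht) i, fun _ => h₂ t ((le_max_right _ _).trans ht) i⟩⟩
  · exact ⟨T₁, hT₁, fun t ht i => ⟨h₁ t ht i, fun h => absurd h hcond⟩⟩

end IsClosedLoop
end SwitchingControl

/-! ### The main theorem -/

theorem corollary1 {n : ℕ} (D : Design n) (hD : D.Admissible) (P : Plant n) (hP : P.Admissible)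
    (x₀ χ₀ : Fin n → ℝ) (hχ₀ : ∀ i, |D.err (fun _ => 1) χ₀ x₀ i| < χ₀ i) :
    -- the closed loop has a solution on `[0, ∞)`
    (∃ (x η χ : ℝ → Fin n → ℝ) (σ : ℝ → Fin n → ℕ), IsClosedLoop D P x₀ χ₀ ⊤ x η χ σ) ∧
    -- every solution on a bounded interval `[0, T)` can be continued to `[0, ∞)`
    (∀ (T : ℝ) (x η χ : ℝ → Fin n → ℝ) (σ : ℝ → Fin n → ℕ), 0 < T →
      IsClosedLoop D P x₀ χ₀ T x η χ σ →
      ∃ (x' η' χ' : ℝ → Fin n → ℝ) (σ' : ℝ → Fin n → ℕ),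
        IsClosedLoop D P x₀ χ₀ ⊤ x' η' χ' σ' ∧
        ∀ t ∈ Set.Ico 0 T, x' t = x t ∧ η' t = η t ∧ χ' t = χ t ∧ σ' t = σ t) ∧
    -- every solution on `[0, ∞)` has the asserted properties
    (∀ (x η χ : ℝ → Fin n → ℝ) (σ : ℝ → Fin n → ℕ), IsClosedLoop D P x₀ χ₀ ⊤ x η χ σ →
      -- the errors stay within the barriers
      (∀ t, 0 ≤ t → ∀ i, |D.err (σ t) (χ t) (x t) i| < χ t i) ∧
      -- all signals are bounded
      (∃ B : ℝ, ∀ t, 0 ≤ t →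
        |D.input (σ t) (χ t) (x t)| ≤ B ∧
        ∀ i : Fin n, |x t i| ≤ B ∧ |η t i| ≤ B ∧ |χ t i| ≤ B ∧ (σ t i : ℝ) ≤ B ∧
          |D.gain i (σ t i)| ≤ B ∧ |D.err (σ t) (χ t) (x t) i| ≤ B ∧
          |D.virtualControl (σ t) (χ t) (x t) i| ≤ B ∧
          |D.lyap (σ t) (χ t) (x t) i| ≤ B) ∧
      -- practical finite-time stability
      (∃ T₀ : ℝ, 0 ≤ T₀ ∧ ∀ t, T₀ ≤ t → ∀ i : Fin n,
        |D.lyap (σ t) (χ t) (x t) i| ≤ (2 * n * D.ζ / D.a) ^ (2 / (1 + (D.α : ℝ))) ∧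
        (n * D.ζ / D.a < 2 ^ ((1 + (D.α : ℝ)) / (1 - (D.α : ℝ))) →
          |D.lyap (σ t) (χ t) (x t) i| ≤ 2 * n * D.ζ / D.a))) := by
  refine ⟨?_, fun T x η χ σ hT hs => ?_, fun x η χ σ hs =>
    ⟨fun t ht => hs.inBarrier hD hχ₀ t ht (EReal.coe_lt_top t),
      hs.signals_bounded hD hP hχ₀, hs.practical_stability hD hP hχ₀⟩⟩
  · obtain ⟨δ, hδ, x, η, χ, σ, hs⟩ := exists_initial_closedLoop hD hP hχ₀
    obtain ⟨b, hb, -⟩ := ClosedLoopSol.exists_extends_top hD hP hχ₀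
      ⟨δ, by exact_mod_cast hδ, x, η, χ, σ, hs⟩
    exact ⟨b.x, b.η, b.χ, b.σ, hb ▸ b.isClosedLoop⟩
  · obtain ⟨b, hb, hext⟩ := ClosedLoopSol.exists_extends_top hD hP hχ₀
      ⟨T, by exact_mod_cast hT, x, η, χ, σ, hs⟩
    exact ⟨b.x, b.η, b.χ, b.σ, hb ▸ b.isClosedLoop,
      fun t ht => hext.2 t ht.1 (EReal.coe_lt_coe_iff.2 ht.2)⟩
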